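/- All graphs are finite, simple and undirected. For $\lambda\ge 1$, a graph $G$ is called $\lambda$-connected if deleting any set of at most $\lambda-1$ edges leaves it connected. An edge $e$ of a $\lambda$-connected graph $G$ is called deletable if $G-e$ is $\lambda$-connected. For an integer $k\ge 0$ and a set $\mathcal R\subseteq E(G)$, a deletion set of cardinality $k$ disjoint from $\mathcal R$ is a set $F\subseteq E(G)\setminus\mathcal R$ with $|F|=k$ such that $G-F$ is $\lambda$-connected. There is a deterministic algorithm that takes as input an odd number $\lambda\in\mathbb N$, a $\lambda$-connected graph $G$ on $n$ vertices, an integer $k\ge 0$ and a set $\mathcal R\subseteq E(G)$, runs in time polynomial in $n$ and in the binary lengths of $\lambda$ and $k$, and does one of the following: 1. it outputs a set $F\subseteq E(G)\setminus\mathcal R$ with $|F|=k$ such that $G-F$ is $\lambda$-connected; or 2. it outputs an edge $e\in E(G)\setminus\mathcal R$ such that $G$ has a deletion set of cardinality $k$ disjoint from $\mathcal R$ if and only if $G$ has a deletion set of cardinality $k$ disjoint from $\mathcal R\cup\{e\}$; or 3. it correctly concludes that at most $\lambda(6k^3+9k^2+k)$ edges of $E(G)\setminus\mathcal R$ are deletable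 in $G$. -/

import Mathlib

/-! ### A random access machine with unit-cost steps

The memory consists of registers and of (named, two-dimensional) tables, all holding natural numbers.
Programs are structured: assignments, conditionals and loops.  The only arithmetic operations are
addition, truncated subtraction and comparison (no multiplication), so one operation lengthens the
numbers in memory by at most one bit, and unit-cost polynomial time is the usual polynomial time. -/

namespace RAM

/-- Contents of the memory: `reg r` is the content of register `r`,
`tab a i j` the entry `(i, j)` of table `a`. -/
structure Memory where
  reg : ℕ → ℕ
  tab : ℕ → ℕ → ℕ → ℕ

/-- Write `x` into register `r`. -/
def Memory.setReg (s : Memory) (r x : ℕ) : Memory where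
  reg := Function.update s.reg r x
  tab := s.tab

/-- Write `x` into entry `(i, j)` of table `a`. -/
def Memory.setTab (s : Memory) (a i j x : ℕ) : Memory where
  reg := s.reg
  tab := fun a' i' j' => if a' = a ∧ i' = i ∧ j' = j then x else s.tab a' i' j'

/-- Expressions of the programming language. -/
inductive Expr where
  | const (c : ℕ)
  | reg (r : ℕ)
  | tab (a : ℕ) (i j : Expr)
  | add (x y : Expr)
  | sub (x y : Expr)
  | lt (x y : Expr)
  | eq (x y : Expr)

/-- The value of an expression; comparisons have value `1` if true and `0` if false. -/
def Expr.eval (s : Memory) : Expr → ℕ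
  | const c => c
  | reg r => s.reg r
  | tab a i j => s.tab a (i.eval s) (j.eval s)
  | add x y => x.eval s + y.eval s
  | sub x y => x.eval s - y.eval s
  | lt x y => if x.eval s < y.eval s then 1 else 0
  | eq x y => if x.eval s = y.eval s then 1 else 0

/-- The number of steps for evaluating an expression: one for each of its operations. -/
def Expr.cost : Expr → ℕ
  | const _ => 1
  | reg _ => 1
  | tab _ i j => i.cost + j.cost + 1
  | add x y => x.cost + y.cost + 1
  | sub x y => x.cost + y.cost + 1
  | lt x y => x.cost + y.cost + 1
  | eq x y => x.cost + y.cost + 1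

/-- Programs.  A test `x` of a conditional or of a loop succeeds if the value of `x` is not `0`. -/
inductive Program where
  | skip
  | setReg (r : ℕ) (x : Expr)
  | setTab (a : ℕ) (i j x : Expr)
  | seq (P Q : Program)
  | ite (x : Expr) (P Q : Program)
  | while (x : Expr) (P : Program)

/-- `Run P s s' t`: started on the memory `s`, the program `P` halts after exactly `t` steps and
leaves the memory `s'`. -/
inductive Run : Program → Memory → Memory → ℕ → Prop where
  | skip (s : Memory) : Run .skip s s 1
  | setReg (s : Memory) (r : ℕ) (x : Expr) :
      Run (.setReg r x) s (s.setReg r (x.eval s)) (x.cost + 1)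
  | setTab (s : Memory) (a : ℕ) (i j x : Expr) :
      Run (.setTab a i j x) s (s.setTab a (i.eval s) (j.eval s) (x.eval s))
        (i.cost + j.cost + x.cost + 1)
  | seq {P Q : Program} {s s' s'' : Memory} {t t' : ℕ} :
      Run P s s' t → Run Q s' s'' t' → Run (.seq P Q) s s'' (t + t')
  | ite_true {x : Expr} {P Q : Program} {s s' : Memory} {t : ℕ} :
      x.eval s ≠ 0 → Run P s s' t → Run (.ite x P Q) s s' (x.cost + 1 + t)
  | ite_false {x : Expr} {P Q : Program} {s s' : Memory} {t : ℕ} :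
      x.eval s = 0 → Run Q s s' t → Run (.ite x P Q) s s' (x.cost + 1 + t)
  | while_true {x : Expr} {P : Program} {s s' s'' : Memory} {t t' : ℕ} :
      x.eval s ≠ 0 → Run P s s' t → Run (.while x P) s' s'' t' →
        Run (.while x P) s s'' (x.cost + 1 + t + t')
  | while_false {x : Expr} {P : Program} {s : Memory} :
      x.eval s = 0 → Run (.while x P) s s (x.cost + 1)

/-- The machine is deterministic. -/
theorem Run.deterministic {P : Program} {s s₁ s₂ : Memory} {t₁ t₂ : ℕ}
    (h₁ : Run P s s₁ t₁) (h₂ : Run P s s₂ t₂) : s₁ = s₂ ∧ t₁ = t₂ := by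
  induction h₁ generalizing s₂ t₂ with
  | skip => cases h₂; exact ⟨rfl, rfl⟩
  | setReg => cases h₂; exact ⟨rfl, rfl⟩
  | setTab => cases h₂; exact ⟨rfl, rfl⟩
  | seq _ _ ih ih' =>
    cases h₂ with
    | seq a b =>
      obtain ⟨rfl, rfl⟩ := ih a
      obtain ⟨rfl, rfl⟩ := ih' b
      exact ⟨rfl, rfl⟩
  | ite_true hx _ ih =>
    cases h₂ with
    | ite_true _ a => obtain ⟨rfl, rfl⟩ := ih a; exact ⟨rfl, rfl⟩
    | ite_false hx' _ => exact absurd hx' hx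
  | ite_false hx _ ih =>
    cases h₂ with
    | ite_true hx' _ => exact absurd hx hx'
    | ite_false _ a => obtain ⟨rfl, rfl⟩ := ih a; exact ⟨rfl, rfl⟩
  | while_true hx _ _ ih ih' =>
    cases h₂ with
    | while_true _ a b =>
      obtain ⟨rfl, rfl⟩ := ih a
      obtain ⟨rfl, rfl⟩ := ih' b
      exact ⟨rfl, rfl⟩
    | while_false hx' => exact absurd hx' hx
  | while_false hx =>
    cases h₂ with
    | while_true hx' _ _ => exact absurd hx hx'
    | while_false _ => exact ⟨rfl, rfl⟩

end RAM

/-! ### Deletion sets and deletable edges -/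

namespace EdgeDeletion

/-- `F` is a set of `k` edges of `G`, none of them in `R`, such that `G - F` is
`lam`-edge-connected. -/
def IsDeletionSet {n : ℕ} (G : SimpleGraph (Fin n)) (lam k : ℕ) (R : Set (Sym2 (Fin n)))
    (F : Finset (Sym2 (Fin n))) : Prop :=
  (F : Set (Sym2 (Fin n))) ⊆ G.edgeSet \ R ∧ F.card = k ∧
    (G.deleteEdges (F : Set (Sym2 (Fin n)))).IsEdgeConnected lam

/-- The set of deletable edges of `G`: those whose deletion leaves `G` `lam`-edge-connected. -/
def deletable {n : ℕ} (G : SimpleGraph (Fin n)) (lam : ℕ) : Set (Sym2 (Fin n)) :=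
  {e | e ∈ G.edgeSet ∧ (G.deleteEdges {e}).IsEdgeConnected lam}

/-- The three kinds of answers of the algorithm. -/
inductive Answer (n : ℕ) where
  | deletionSet (F : Finset (Sym2 (Fin n)))
  | irrelevantEdge (e : Sym2 (Fin n))
  | fewDeletable

/-- What it means for an answer to be correct for the input `(G, lam, k, R)`. -/
def Answer.Correct {n : ℕ} (G : SimpleGraph (Fin n)) (lam k : ℕ) (R : Set (Sym2 (Fin n))) :
    Answer n → Prop
  | deletionSet F => IsDeletionSet G lam k R F
  | irrelevantEdge e => e ∈ G.edgeSet \ R ∧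
      ((∃ F, IsDeletionSet G lam k R F) ↔ ∃ F, IsDeletionSet G lam k (R ∪ {e}) F)
  | fewDeletable => (deletable G lam \ R).ncard ≤ lam * (6 * k ^ 3 + 9 * k ^ 2 + k)

open Classical in
/-- The input `(G, lam, k, R)` in memory: registers `0`, `1`, `2` hold `n`, `lam`, `k`;
tables `0` and `1` hold the adjacency matrices of `G` and of the edge set `R`;
the rest of the memory is `0`. -/
noncomputable def input {n : ℕ} (G : SimpleGraph (Fin n)) (lam k : ℕ) (R : Set (Sym2 (Fin n))) :
    RAM.Memory where
  reg := fun r => if r = 0 then n else if r = 1 then lam else if r = 2 then k else 0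
  tab := fun a i j =>
    if h : i < n ∧ j < n then
      if a = 0 then (if G.Adj ⟨i, h.1⟩ ⟨j, h.2⟩ then 1 else 0)
      else if a = 1 then (if s(⟨i, h.1⟩, ⟨j, h.2⟩) ∈ R then 1 else 0)
      else 0
    else 0

/-- The length of the input, up to a polynomial: the number of vertices plus the lengths of the
binary representations of `lam` and `k`. -/
def inputSize (n lam k : ℕ) : ℕ := n + lam.size + k.size

open Classical in
/-- The memory `s` shows the given answer.  Register `0` tells its kind (`1`, `2` or `3`).
A deletion set is given by its adjacency matrix in table `0`, an irrelevant edge by its two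
endpoints in registers `1` and `2`. -/
def Shows {n : ℕ} (s : RAM.Memory) : Answer n → Prop
  | .deletionSet F => s.reg 0 = 1 ∧
      ∀ u v : Fin n, s.tab 0 u v = if s(u, v) ∈ F then 1 else 0
  | .irrelevantEdge e => s.reg 0 = 2 ∧
      ∃ u v : Fin n, s.reg 1 = u ∧ s.reg 2 = v ∧ e = s(u, v)
  | .fewDeletable => s.reg 0 = 3

end EdgeDeletion

/-! Let `d` be the cut degree, and call a cut tight if `d` equals `lam` on it. The degree function
is submodular and posimodular, and `d(X ∩ Y) + d(X \ Y) + d(X)` is even. Hence for odd `lam` two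
tight cuts never cross: all four corners would be tight, and three times an odd number is not even.
Everything structural rests on this. A free edge is an edge of `G` outside `R`. Two deletable edges
are in conflict if they cannot be deleted together; they then lie in a common cut with `lam + 1`
edges.

The algorithm looks for an irrelevant edge. A free edge that is not deletable is irrelevant, since
it belongs to no deletion set. If all free edges are deletable, an edge `e` with more than `2(k -
1)lam` conflicts is irrelevant (`exists_deletionSet_avoiding`): for a deletion set `F` containing
`e`, either some edge in conflict with `e` can replace `e`, or every such edge crosses a maximal
tight cut of `G - (F - e)` that avoids the ends of `e` and contains an end of `F - e`. There are at
most `2(k - 1)` such maximal cuts, with `lam` edges each.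

It also runs a local search: starting from the empty set, enlarge a deletion set `F` by adding one
free edge, or by exchanging one edge for two, until `F` has `k` edges or no move applies. Suppose
that `F` is stuck with fewer than `k` edges and that no irrelevant edge was found. Then every free
edge `f` outside `F` lies in a tight cut of `H = G - F`, and that cut separates the ends of some `e`
in `F`. For fixed `e = uv` the tight cuts containing `u` but not `v` form a chain. Each end `w` of
`F` marks two members of the chain: the smallest one containing `w` and the largest one avoiding
`w`. Edges in marked cuts are few. The other edges fall into gaps between marks
(`exists_crosses_extreme_tightCut`), and a gap has at most `lam + 2(k - 1)lam` edges
(`card_gap_le`): if two of its edges share no tight cut, the failed exchange gives a small cut,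
which uncrosses to a cut free of ends of `F`, and this shows a conflict in `G` itself. Summation
gives the bound (`card_le_of_locally_maximal`).

For the running time, all loops run through the numbers below `n`, so that the number of steps is
bounded by a polynomial in `n` read off from the program text (`run_compile`). Connectivity is
tested with the minimum cut algorithm of Stoer and Wagner: in a maximum adjacency ordering the last
vertex alone is a minimum cut between the last two vertices, which are then merged. -/

set_option linter.unusedSectionVars false

/-! ### Cut degrees, uncrossing and parity -/

namespace EdgeCut

variable {V : Type*} [Fintype V] [DecidableEq V]

/-- The edge `e` has exactly one end in `X`. -/
def Crosses (X : Finset V) (e : Sym2 V) : Prop := ∃ x y, e = s(x, y) ∧ x ∈ X ∧ y ∉ X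

@[simp]
theorem crosses_mk {X : Finset V} {x y : V} :
    Crosses X s(x, y) ↔ (x ∈ X ∧ y ∉ X) ∨ (y ∈ X ∧ x ∉ X) := by
  constructor
  · rintro ⟨a, b, h, ha, hb⟩
    rcases Sym2.eq_iff.1 h with ⟨rfl, rfl⟩ | ⟨rfl, rfl⟩ <;> tauto
  · rintro (⟨h, h'⟩ | ⟨h, h'⟩)
    exacts [⟨x, y, rfl, h, h'⟩, ⟨y, x, Sym2.eq_swap, h, h'⟩]

open Classical in
/-- The edges of `E` that leave `X`. -/
noncomputable def boundary (E : Finset (Sym2 V)) (X : Finset V) : Finset (Sym2 V) :=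
  E.filter (Crosses X)

/-- The number of edges of `E` that leave `X`. -/
noncomputable def cutDeg (E : Finset (Sym2 V)) (X : Finset V) : ℕ := (boundary E X).card

/-- Every cut of the graph with edge set `E` has at least `lam` edges. -/
def CutConnected (E : Finset (Sym2 V)) (lam : ℕ) : Prop :=
  ∀ X : Finset V, X.Nonempty → X ≠ Finset.univ → lam ≤ cutDeg E X

theorem mem_boundary {E : Finset (Sym2 V)} {X : Finset V} {e : Sym2 V} :
    e ∈ boundary E X ↔ e ∈ E ∧ Crosses X e := by
  simp [boundary]

theorem crosses_compl {X : Finset V} {e : Sym2 V} : Crosses Xᶜ e ↔ Crosses X e := by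
  induction e with
  | _ x y => simp; tauto

theorem cutDeg_compl (E : Finset (Sym2 V)) (X : Finset V) : cutDeg E Xᶜ = cutDeg E X := by
  rw [cutDeg, cutDeg]
  congr 1
  ext e
  simp [mem_boundary, crosses_compl]

theorem cutDeg_eq_sum (E : Finset (Sym2 V)) (X : Finset V) [DecidablePred (Crosses X)] :
    cutDeg E X = ∑ e ∈ E, if Crosses X e then 1 else 0 := by
  rw [cutDeg, boundary, Finset.card_filter]
  refine Finset.sum_congr rfl fun e _ => ?_
  congr

/-- Submodularity; it holds edge by edge, by the position of the two ends. -/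
theorem cutDeg_inter_add_union_le (E : Finset (Sym2 V)) (X Y : Finset V) :
    cutDeg E (X ∩ Y) + cutDeg E (X ∪ Y) ≤ cutDeg E X + cutDeg E Y := by
  classical
  simp only [cutDeg_eq_sum, ← Finset.sum_add_distrib]
  refine Finset.sum_le_sum fun e _ => ?_
  induction e with
  | _ x y =>
    by_cases h1 : x ∈ X <;> by_cases h2 : x ∈ Y <;> by_cases h3 : y ∈ X <;> by_cases h4 : y ∈ Y <;>
      simp [h1, h2, h3, h4]

/-- Posimodularity, that is, submodularity for `X` and the complement of `Y`. -/
theorem cutDeg_sdiff_add_sdiff_le (E : Finset (Sym2 V)) (X Y : Finset V) :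
    cutDeg E (X \ Y) + cutDeg E (Y \ X) ≤ cutDeg E X + cutDeg E Y := by
  classical
  simp only [cutDeg_eq_sum, ← Finset.sum_add_distrib]
  refine Finset.sum_le_sum fun e _ => ?_
  induction e with
  | _ x y =>
    by_cases h1 : x ∈ X <;> by_cases h2 : x ∈ Y <;> by_cases h3 : y ∈ X <;> by_cases h4 : y ∈ Y <;>
      simp [h1, h2, h3, h4]

/-- `X` is the disjoint union of the two parts. An edge between the parts is counted once for each
part, an edge leaving `X` once for its part and once for `X`. This is the only source of parity in
the proof. -/
theorem even_cutDeg_inter_add_sdiff (E : Finset (Sym2 V)) (X Y : Finset V) :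
    Even (cutDeg E (X ∩ Y) + cutDeg E (X \ Y) + cutDeg E X) := by
  classical
  simp only [cutDeg_eq_sum, ← Finset.sum_add_distrib]
  refine Finset.even_sum _ fun e _ => ?_
  induction e with
  | _ x y =>
    by_cases h1 : x ∈ X <;> by_cases h2 : x ∈ Y <;> by_cases h3 : y ∈ X <;> by_cases h4 : y ∈ Y <;>
      simp [h1, h2, h3, h4]

theorem cutDeg_mono {E E' : Finset (Sym2 V)} (h : E ⊆ E') (X : Finset V) :
    cutDeg E X ≤ cutDeg E' X := by
  refine Finset.card_le_card fun e he => ?_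
  rw [mem_boundary] at he ⊢
  exact ⟨h he.1, he.2⟩

theorem CutConnected.mono {E E' : Finset (Sym2 V)} {lam : ℕ} (h : E ⊆ E')
    (hE : CutConnected E lam) : CutConnected E' lam :=
  fun X h1 h2 => (hE X h1 h2).trans (cutDeg_mono h X)

theorem cutDeg_sdiff_singleton_add_one {E : Finset (Sym2 V)} {X : Finset V} {e : Sym2 V}
    (he : e ∈ E) (hX : Crosses X e) : cutDeg (E \ {e}) X + 1 = cutDeg E X := by
  have h : boundary (E \ {e}) X = (boundary E X).erase e := by
    ext f
    simp only [mem_boundary, Finset.mem_sdiff, Finset.mem_singleton, Finset.mem_erase]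
    tauto
  rw [cutDeg, h, Finset.card_erase_add_one (mem_boundary.2 ⟨he, hX⟩), cutDeg]

theorem cutDeg_sdiff_eq {E F : Finset (Sym2 V)} {X : Finset V}
    (h : ∀ e ∈ F, ¬ Crosses X e) : cutDeg (E \ F) X = cutDeg E X := by
  have : boundary (E \ F) X = boundary E X := by
    ext f
    simp only [mem_boundary, Finset.mem_sdiff]
    constructor
    · tauto
    · exact fun hf => ⟨⟨hf.1, fun h' => h f h' hf.2⟩, hf.2⟩
  rw [cutDeg, this, cutDeg]

theorem Crosses.nonempty {X : Finset V} {e : Sym2 V} (h : Crosses X e) : X.Nonempty := by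
  obtain ⟨x, _, _, hx, _⟩ := h
  exact ⟨x, hx⟩

theorem Crosses.ne_univ {X : Finset V} {e : Sym2 V} (h : Crosses X e) : X ≠ Finset.univ := by
  obtain ⟨_, y, _, _, hy⟩ := h
  rintro rfl
  exact hy (Finset.mem_univ y)

/-- A cut through a deletable edge has more than `lam` edges. -/
theorem CutConnected.lt_cutDeg {E : Finset (Sym2 V)} {lam : ℕ} {e : Sym2 V} {X : Finset V}
    (h : CutConnected (E \ {e}) lam) (he : e ∈ E) (hX : Crosses X e) : lam < cutDeg E X := by
  have h1 := h X hX.nonempty hX.ne_univ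
  have h2 := cutDeg_sdiff_singleton_add_one he hX
  omega

/-- A non-deletable edge lies in a cut with `lam` edges. -/
theorem exists_cut_of_not_deletable {E : Finset (Sym2 V)} {lam : ℕ} {e : Sym2 V}
    (hE : CutConnected E lam) (he : e ∈ E) (h : ¬ CutConnected (E \ {e}) lam) :
    ∃ X, Crosses X e ∧ cutDeg E X = lam := by
  simp only [CutConnected, not_forall, not_le] at h
  obtain ⟨X, h1, h2, h3⟩ := h
  have h4 := hE X h1 h2
  by_cases hX : Crosses X e
  · have h5 := cutDeg_sdiff_singleton_add_one he hX
    exact ⟨X, hX, by omega⟩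
  · have h5 : cutDeg (E \ {e}) X = cutDeg E X := cutDeg_sdiff_eq (by simpa using hX)
    omega

/-- Two deletable edges that cannot be deleted together lie in a common cut with `lam + 1`
edges. -/
theorem exists_cut_of_conflict {E : Finset (Sym2 V)} {lam : ℕ} {e f : Sym2 V}
    (he : e ∈ E) (hf : f ∈ E)
    (hEe : CutConnected (E \ {e}) lam) (hEf : CutConnected (E \ {f}) lam)
    (h : ¬ CutConnected (E \ {e, f}) lam) :
    e ≠ f ∧ ∃ X, Crosses X e ∧ Crosses X f ∧ cutDeg E X = lam + 1 := by
  have hne : e ≠ f := by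
    rintro rfl
    exact h (by simpa using hEe)
  have hS : E \ {e, f} = (E \ {e}) \ {f} := by
    ext g
    simp only [Finset.mem_sdiff, Finset.mem_insert, Finset.mem_singleton]
    tauto
  rw [hS] at h
  obtain ⟨X, hX, hd⟩ := exists_cut_of_not_deletable hEe (by simp [hf, hne.symm]) h
  -- If `e` did not cross `X`, then `X` would have only `lam` edges in `E` as well, although the
  -- deletable edge `f` crosses it. So `e` crosses `X` and is the one additional edge.
  refine ⟨hne, X, ?_, hX, ?_⟩
  · by_contra hX'
    have h5 : cutDeg (E \ {e}) X = cutDeg E X := cutDeg_sdiff_eq (by simpa using hX')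
    have := hEf.lt_cutDeg hf hX
    omega
  · by_cases hX' : Crosses X e
    · have := cutDeg_sdiff_singleton_add_one he hX'
      omega
    · have h5 : cutDeg (E \ {e}) X = cutDeg E X := cutDeg_sdiff_eq (by simpa using hX')
      have := hEf.lt_cutDeg hf hX
      omega

/-- For odd `lam`, cuts with `lam` edges do not cross. -/
theorem not_crossing_of_odd {E : Finset (Sym2 V)} {lam : ℕ} (hlam : Odd lam)
    (hE : CutConnected E lam) {X Y : Finset V} (hX : cutDeg E X = lam) (hY : cutDeg E Y = lam)
    (h1 : (X ∩ Y).Nonempty) (h2 : (X \ Y).Nonempty) (h3 : (Y \ X).Nonempty)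
    (h4 : X ∪ Y ≠ Finset.univ) : False := by
  have hXu : X ∩ Y ≠ Finset.univ := by
    intro h
    obtain ⟨x, hx⟩ := h2
    have := h ▸ Finset.mem_univ x
    simp at hx this
    tauto
  have hXu' : X \ Y ≠ Finset.univ := by
    intro h
    obtain ⟨x, hx⟩ := h1
    have := h ▸ Finset.mem_univ x
    simp at hx this
    tauto
  have hYu' : Y \ X ≠ Finset.univ := by
    intro h
    obtain ⟨x, hx⟩ := h1
    have := h ▸ Finset.mem_univ x
    simp at hx this
    tauto
  have a1 := hE _ h1 hXu
  have a2 := hE _ h2 hXu'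
  have a3 := hE _ h3 hYu'
  have a4 := hE (X ∪ Y) (h1.mono (by intro x; simp; tauto)) h4
  have b1 := cutDeg_inter_add_union_le E X Y
  have b2 := cutDeg_sdiff_add_sdiff_le E X Y
  have b3 := even_cutDeg_inter_add_sdiff E X Y
  -- All four corners have degree at least `lam`, so both uncrossing inequalities are tight; parity
  -- then makes `3 * lam` even.
  have c1 : cutDeg E (X ∩ Y) = lam := by omega
  have c2 : cutDeg E (X \ Y) = lam := by omega
  rw [c1, c2, hX] at b3
  obtain ⟨a, ha⟩ := hlam
  obtain ⟨b, hb⟩ := b3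
  omega

end EdgeCut

/-! ### Edges with many conflicts are irrelevant -/

namespace EdgeCut

variable {V : Type*} [Fintype V] [DecidableEq V]

open Classical in
/-- The ends of the edges in `F`. -/
noncomputable def ends (F : Finset (Sym2 V)) : Finset V :=
  Finset.univ.filter fun w => ∃ e ∈ F, w ∈ e

theorem mem_ends {F : Finset (Sym2 V)} {w : V} : w ∈ ends F ↔ ∃ e ∈ F, w ∈ e := by
  simp [ends]

theorem card_ends_le (F : Finset (Sym2 V)) : (ends F).card ≤ 2 * F.card := by
  have h : ends F ⊆ F.biUnion fun e => e.toFinset := by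
    intro w
    simp [mem_ends]
  calc (ends F).card ≤ _ := Finset.card_le_card h
    _ ≤ ∑ e ∈ F, e.toFinset.card := Finset.card_biUnion_le
    _ ≤ ∑ _e ∈ F, 2 := Finset.sum_le_sum fun e _ => by rw [Sym2.card_toFinset]; split <;> omega
    _ = 2 * F.card := by simp [mul_comm]

theorem Crosses.exists_mem_ends {F : Finset (Sym2 V)} {X : Finset V} {e : Sym2 V}
    (h : Crosses X e) (he : e ∈ F) : ∃ w ∈ ends F, w ∈ X := by
  obtain ⟨x, y, rfl, hx, _⟩ := h
  exact ⟨x, mem_ends.2 ⟨_, he, by simp⟩, hx⟩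

/-- If all edges leaving a cut with `lam` edges of `E \ F` include a deletable edge of `E`, then
some edge of `F` leaves the cut. -/
theorem exists_crosses_of_deletable {E F : Finset (Sym2 V)} {lam : ℕ} {X : Finset V}
    {f : Sym2 V} (hf : f ∈ E) (hdel : CutConnected (E \ {f}) lam) (hX : Crosses X f)
    (hd : cutDeg (E \ F) X ≤ lam) : ∃ e ∈ F, Crosses X e := by
  by_contra! h
  have h1 := cutDeg_sdiff_eq (E := E) h
  have h2 := hdel.lt_cutDeg hf hX
  omega

/-- The inner end of `f` lies in `X`, hence in `Z`, so the other end lies outside `Z` and outside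
every set in between. -/
theorem Crosses.of_subset {X Y Z : Finset V} {f : Sym2 V} (hX : Crosses X f) (hZ : Crosses Z f)
    (h1 : X ⊆ Y) (h2 : Y ⊆ Z) : Crosses Y f := by
  obtain ⟨x, y, rfl, hx, hy⟩ := hX
  rw [crosses_mk] at hZ ⊢
  have hxY := h1 hx
  have hxZ := h2 hxY
  left
  refine ⟨hxY, fun hyY => ?_⟩
  have := h2 hyY
  tauto

theorem not_crosses_iff {X : Finset V} {x y : V} : ¬ Crosses X s(x, y) ↔ (x ∈ X ↔ y ∈ X) := by
  rw [crosses_mk]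
  tauto

/-- An edge in conflict with many deletable edges can be avoided by deletion sets. -/
theorem exists_deletionSet_avoiding {E D F : Finset (Sym2 V)} {lam k : ℕ} {e : Sym2 V}
    (hlam : Odd lam) (hD : D ⊆ E) (hdel : ∀ f ∈ D, CutConnected (E \ {f}) lam) (he : e ∈ D)
    {N : Finset (Sym2 V)} (hN : ∀ g ∈ N, g ∈ D ∧ ¬ CutConnected (E \ {e, g}) lam)
    (hcard : 2 * (k - 1) * lam < N.card)
    (hF : F ⊆ D) (hFk : F.card = k) (hFc : CutConnected (E \ F) lam) :
    ∃ F' ⊆ D, F'.card = k ∧ e ∉ F' ∧ CutConnected (E \ F') lam := by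
  classical
  by_cases heF : e ∉ F
  · exact ⟨F, hF, hFk, heF, hFc⟩
  rw [not_not] at heF
  set F₀ := F.erase e with hF₀
  set E' := E \ F₀ with hE'
  have heE' : e ∈ E' := by simp [hE', hF₀, hD he]
  have hEF : E' \ {e} = E \ F := by
    ext g
    simp only [hE', hF₀, Finset.mem_sdiff, Finset.mem_erase, Finset.mem_singleton]
    constructor
    · tauto
    · rintro ⟨h1, h2⟩
      exact ⟨⟨h1, fun h => h2 h.2⟩, fun h => h2 (h ▸ heF)⟩
  have hE'e : CutConnected (E' \ {e}) lam := hEF ▸ hFc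
  have hE'c : CutConnected E' lam := hE'e.mono Finset.sdiff_subset
  -- With `F` intact except for `e`, every cut through `e` has an edge to spare.
  have hcut : ∀ X, Crosses X e → lam < cutDeg E' X := fun X => hE'e.lt_cutDeg heE'
  have hconf : ∀ g ∈ N, e ≠ g ∧ ∃ X, Crosses X e ∧ Crosses X g ∧ cutDeg E X = lam + 1 :=
    fun g hg => exists_cut_of_conflict (hD he) (hD (hN g hg).1) (hdel e he)
      (hdel g (hN g hg).1) (hN g hg).2
  -- Otherwise the conflict cut of `e` and `g`, with `lam + 1` edges in `E`, would keep at most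
  -- `lam` edges in `E'`, contradicting `hcut`.
  have hgE' : ∀ g ∈ N, g ∈ E' := by
    intro g hg
    by_contra hg'
    have hgF : g ∈ F₀ := by simpa [hE', hD (hN g hg).1] using hg'
    obtain ⟨hne, Z, hZe, hZg, hZ⟩ := hconf g hg
    have h1 := hcut Z hZe
    have h2 := cutDeg_sdiff_singleton_add_one (hD (hN g hg).1) hZg
    have h3 : cutDeg E' Z ≤ cutDeg (E \ {g}) Z := cutDeg_mono
      (Finset.sdiff_subset_sdiff le_rfl (by simpa using hgF)) Z
    omega
  -- If some `g` can be deleted from `E'`, then exchanging `e` for `g` avoids `e`. It remains to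
  -- refute the other case by counting `N`.
  by_cases hgood : ∃ g ∈ N, CutConnected (E' \ {g}) lam
  · obtain ⟨g, hg, hgc⟩ := hgood
    have hgF₀ : g ∉ F₀ := by
      have := hgE' g hg
      simp only [hE', Finset.mem_sdiff] at this
      exact this.2
    refine ⟨insert g F₀, ?_, ?_, ?_, ?_⟩
    · intro f hf
      rcases Finset.mem_insert.1 hf with rfl | hf
      · exact (hN _ hg).1
      · exact hF (Finset.mem_of_mem_erase hf)
    · rw [Finset.card_insert_of_notMem hgF₀, hF₀, Finset.card_erase_add_one heF, hFk]
    · simp [hF₀, (hconf g hg).1]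
    · convert hgc using 1
      ext f
      simp only [hE', Finset.mem_sdiff, Finset.mem_insert, Finset.mem_singleton]
      tauto
  push Not at hgood
  exfalso
  obtain ⟨x, y, hxy⟩ : ∃ x y, e = s(x, y) := by
    induction e with
    | _ x y => exact ⟨x, y, rfl⟩
  -- By `hcut` no tight cut of `E'` separates `x` from `y`; up to complement it avoids both.
  let P : Finset V → Prop := fun Y => x ∉ Y ∧ y ∉ Y ∧ cutDeg E' Y = lam
  have hbad : ∀ g ∈ N, ∃ Y, P Y ∧ Crosses Y g := by
    intro g hg
    obtain ⟨Y, hYg, hY⟩ := exists_cut_of_not_deletable hE'c (hgE' g hg) (hgood g hg)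
    have hYe : ¬ Crosses Y e := fun h => by
      have := hcut Y h
      omega
    rw [hxy, not_crosses_iff] at hYe
    by_cases hx : x ∈ Y
    · exact ⟨Yᶜ, ⟨by simpa using hx, by simpa using hYe.1 hx, by rw [cutDeg_compl, hY]⟩,
        crosses_compl.2 hYg⟩
    · exact ⟨Y, ⟨hx, fun h => hx (hYe.2 h), hY⟩, hYg⟩
  have hmax : ∀ w, ∃ M, cutDeg E' M ≤ lam ∧
      ∀ Y, P Y → w ∈ Y → P M ∧ Y ⊆ M := by
    intro w
    by_cases hex : ∃ Y, P Y ∧ w ∈ Y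
    · obtain ⟨M, hM, hMmax⟩ := Finset.exists_max_image
        (Finset.univ.filter fun Y => P Y ∧ w ∈ Y) Finset.card
        (by obtain ⟨Y, hY⟩ := hex; exact ⟨Y, by simpa using hY⟩)
      simp only [Finset.mem_filter, Finset.mem_univ, true_and] at hM hMmax
      refine ⟨M, hM.1.2.2.le, fun Y hY hw => ⟨hM.1, ?_⟩⟩
      -- Tight sets that share `w` and miss `x` have a tight union by submodularity, so a largest
      -- one contains all others. Parity is not needed here.
      have hPu : P (M ∪ Y) := by
        have hx : x ∉ M ∪ Y := by simp [hM.1.1, hY.1]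
        refine ⟨hx, by simp [hM.1.2.1, hY.2.1], ?_⟩
        have hxi : x ∉ M ∩ Y := by simp [hM.1.1]
        have a1 := hE'c (M ∩ Y) ⟨w, by simp [hM.2, hw]⟩ (fun h => hxi (h ▸ Finset.mem_univ x))
        have a2 := hE'c (M ∪ Y) ⟨w, by simp [hw]⟩ (fun h => hx (h ▸ Finset.mem_univ x))
        have a3 := cutDeg_inter_add_union_le E' M Y
        have a4 := hM.1.2.2
        have a5 := hY.2.2
        omega
      have := hMmax _ ⟨hPu, by simp [hw]⟩
      rw [Finset.eq_of_subset_of_card_le Finset.subset_union_left this]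
      exact Finset.subset_union_right
    · push Not at hex
      refine ⟨∅, ?_, fun Y hY hw => absurd hw (hex Y hY)⟩
      have : boundary E' ∅ = ∅ := by
        ext g
        simp only [mem_boundary, Finset.notMem_empty, iff_false, not_and]
        intro _ h
        simpa using h.nonempty
      simp [cutDeg, this]
  choose M hMlam hM using hmax
  -- As `g` is deletable in `E`, its tight cut `Y` is crossed by an edge of `F₀` and so contains an
  -- end `w` of `F₀`. The claim is that `g` leaves even the largest such set `M w`.
  have hNsub : N ⊆ (ends F₀).biUnion fun w => boundary E' (M w) := by
    intro g hg
    obtain ⟨Y, hY, hYg⟩ := hbad g hg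
    obtain ⟨f, hf, hfY⟩ := exists_crosses_of_deletable (hD (hN g hg).1) (hdel g (hN g hg).1) hYg
      hY.2.2.le
    obtain ⟨w, hw, hwY⟩ := hfY.exists_mem_ends hf
    obtain ⟨hPM, hYM⟩ := hM w Y hY hwY
    refine Finset.mem_biUnion.2 ⟨w, hw, mem_boundary.2 ⟨hgE' g hg, ?_⟩⟩
    obtain ⟨p, q, rfl, hp, hq⟩ := hYg
    rw [crosses_mk]
    refine Or.inl ⟨hYM hp, fun hqM => ?_⟩
    set Y' := M w
    obtain ⟨Z, hZe, hpZ, hqZ, hZ⟩ : ∃ Z, Crosses Z e ∧ p ∉ Z ∧ q ∈ Z ∧ cutDeg E' Z ≤ lam + 1 := by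
      obtain ⟨-, Z, hZe, hZg, hZ⟩ := hconf _ hg
      have hle : cutDeg E' Z ≤ cutDeg E Z := cutDeg_mono Finset.sdiff_subset Z
      rw [crosses_mk] at hZg
      rcases hZg with ⟨h1, h2⟩ | ⟨h1, h2⟩
      · exact ⟨Zᶜ, crosses_compl.2 hZe, by simpa using h1, by simpa using h2,
          by rw [cutDeg_compl]; omega⟩
      · exact ⟨Z, hZe, h2, h1, by omega⟩
    -- Suppose `g` lies inside `Y'`. The conflict cut `Z` splits `Y'` between `p` and `q`. Since
    -- `Y'` avoids the ends of `e`, both `Z \ Y'` and `Y' ∪ Z` still separate them and have more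
    -- than `lam` edges. Uncrossing makes `Y' ∩ Z` and `Y' \ Z` tight, against parity.
    have hc1 : Crosses (Z \ Y') e := by
      rw [hxy, crosses_mk] at hZe ⊢
      simp only [Finset.mem_sdiff]
      have := hPM.1
      have := hPM.2.1
      tauto
    have hc2 : Crosses (Y' ∪ Z) e := by
      rw [hxy, crosses_mk] at hZe ⊢
      simp only [Finset.mem_union]
      have := hPM.1
      have := hPM.2.1
      tauto
    have hxi : x ∉ Y' ∩ Z := by simp [hPM.1]
    have hxi' : x ∉ Y' \ Z := by simp [hPM.1]
    have a1 := hcut _ hc1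
    have a2 := hcut _ hc2
    have a3 := hE'c (Y' ∩ Z) ⟨q, by simp [hqM, hqZ]⟩ (fun h => hxi (h ▸ Finset.mem_univ x))
    have a4 := hE'c (Y' \ Z) ⟨p, by simp [hYM hp, hpZ]⟩ (fun h => hxi' (h ▸ Finset.mem_univ x))
    have a5 := cutDeg_inter_add_union_le E' Y' Z
    have a6 := cutDeg_sdiff_add_sdiff_le E' Y' Z
    have a7 := even_cutDeg_inter_add_sdiff E' Y' Z
    have a8 := hPM.2.2
    have c1 : cutDeg E' (Y' ∩ Z) = lam := by omega
    have c2 : cutDeg E' (Y' \ Z) = lam := by omega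
    rw [c1, c2, a8] at a7
    obtain ⟨a, ha⟩ := hlam
    obtain ⟨b, hb⟩ := a7
    omega
  have h1 := Finset.card_le_card hNsub
  have h2 : ((ends F₀).biUnion fun w => boundary E' (M w)).card ≤ (ends F₀).card * lam :=
    Finset.card_biUnion_le_card_mul _ _ _ fun w _ => hMlam w
  have h3 : (ends F₀).card ≤ 2 * (k - 1) := by
    have := card_ends_le F₀
    rw [hF₀, Finset.card_erase_of_mem heF, hFk] at this
    rwa [hF₀]
  have h4 := Nat.mul_le_mul_right lam h3
  omega

end EdgeCut

/-! ### The number of deletable edges at a local maximum -/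

namespace EdgeCut

variable {V : Type*} [Fintype V] [DecidableEq V]

theorem cutDeg_empty (E : Finset (Sym2 V)) : cutDeg E ∅ = 0 := by
  rw [cutDeg, Finset.card_eq_zero]
  ext g
  simp only [mem_boundary, Finset.notMem_empty, iff_false, not_and]
  intro _ h
  simpa using h.nonempty

/-- `X` is a cut of `E` with `lam` edges that separates `u` from `v`. -/
def IsTightCut (E : Finset (Sym2 V)) (lam : ℕ) (u v : V) (X : Finset V) : Prop :=
  u ∈ X ∧ v ∉ X ∧ cutDeg E X = lam

/-- Both sets contain `u` and miss `v`, so two of the four corners are nonempty, and by non-crossing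
a third is empty. Thus these cuts form a chain, ordered by size. -/
theorem IsTightCut.subset_of_card_le {E : Finset (Sym2 V)} {lam : ℕ} {u v : V} {X Y : Finset V}
    (hlam : Odd lam) (hE : CutConnected E lam) (hX : IsTightCut E lam u v X)
    (hY : IsTightCut E lam u v Y) (h : X.card ≤ Y.card) : X ⊆ Y := by
  by_contra hXY
  have h2 : (X \ Y).Nonempty := Finset.sdiff_nonempty.2 hXY
  have h3 : (Y \ X).Nonempty := by
    rw [Finset.sdiff_nonempty]
    intro hYX
    exact hXY (Finset.eq_of_subset_of_card_le hYX h).ge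
  exact not_crossing_of_odd hlam hE hX.2.2 hY.2.2 ⟨u, by simp [hX.1, hY.1]⟩ h2 h3
    fun h => by
      have := Finset.mem_univ v
      rw [← h] at this
      simp [hX.2.1, hY.2.1] at this

/-- Non-crossing once more: `u` lies in `X \ Y` and `v` outside both sets. -/
theorem IsTightCut.disjoint_or_subset {E : Finset (Sym2 V)} {lam : ℕ} {u v : V}
    {X Y : Finset V} (hlam : Odd lam) (hE : CutConnected E lam) (hX : IsTightCut E lam u v X)
    (hu : u ∉ Y) (hv : v ∉ Y) (hY : cutDeg E Y = lam) : Disjoint Y X ∨ Y ⊆ X := by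
  by_contra! h
  refine not_crossing_of_odd hlam hE hX.2.2 hY ?_ ⟨u, by simp [hX.1, hu]⟩
    (Finset.sdiff_nonempty.2 h.2) fun h => by
      have := Finset.mem_univ v
      rw [← h] at this
      simp [hX.2.1, hv] at this
  have := Finset.not_disjoint_iff_nonempty_inter.1 h.1
  rwa [Finset.inter_comm]

/-- The lower mark of `w` in the chain. The degree bound has to hold even if no member of the chain
contains `w`; the empty set then serves as a default with no boundary. -/
theorem exists_smallest_tightCut {E : Finset (Sym2 V)} {lam : ℕ} (hlam : Odd lam)
    (hE : CutConnected E lam) (u v w : V) :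
    ∃ M, cutDeg E M ≤ lam ∧ ∀ X, IsTightCut E lam u v X → w ∈ X →
      IsTightCut E lam u v M ∧ w ∈ M ∧ M ⊆ X := by
  classical
  by_cases hex : ∃ X, IsTightCut E lam u v X ∧ w ∈ X
  · obtain ⟨M, hM, hMmin⟩ := Finset.exists_min_image
      (Finset.univ.filter fun X => IsTightCut E lam u v X ∧ w ∈ X) Finset.card
      (by obtain ⟨Y, hY⟩ := hex; exact ⟨Y, by simpa using hY⟩)
    simp only [Finset.mem_filter, Finset.mem_univ, true_and] at hM hMmin
    exact ⟨M, hM.1.2.2.le, fun X hX hw =>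
      ⟨hM.1, hM.2, hM.1.subset_of_card_le hlam hE hX (hMmin X ⟨hX, hw⟩)⟩⟩
  · push Not at hex
    exact ⟨∅, by simp [cutDeg_empty], fun X hX hw => absurd hw (hex X hX)⟩

/-- The upper mark of `w` in the chain, with the same default. -/
theorem exists_largest_tightCut {E : Finset (Sym2 V)} {lam : ℕ} (hlam : Odd lam)
    (hE : CutConnected E lam) (u v w : V) :
    ∃ M, cutDeg E M ≤ lam ∧ ∀ X, IsTightCut E lam u v X → w ∉ X →
      IsTightCut E lam u v M ∧ w ∉ M ∧ X ⊆ M := by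
  classical
  by_cases hex : ∃ X, IsTightCut E lam u v X ∧ w ∉ X
  · obtain ⟨M, hM, hMmax⟩ := Finset.exists_max_image
      (Finset.univ.filter fun X => IsTightCut E lam u v X ∧ w ∉ X) Finset.card
      (by obtain ⟨Y, hY⟩ := hex; exact ⟨Y, by simpa using hY⟩)
    simp only [Finset.mem_filter, Finset.mem_univ, true_and] at hM hMmax
    exact ⟨M, hM.1.2.2.le, fun X hX hw =>
      ⟨hM.1, hM.2, hX.subset_of_card_le hlam hE hM.1 (hMmax X ⟨hX, hw⟩)⟩⟩
  · push Not at hex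
    exact ⟨∅, by simp [cutDeg_empty], fun X hX hw => absurd (hex X hX) hw⟩

/-- Let `f` lie in a tight cut `X` of `E \ F` separating the ends of `e`, and in another tight cut
that does not.  Then `f` crosses an extreme tight cut at some end of an edge in `F`. -/
theorem exists_crosses_extreme_tightCut {E F : Finset (Sym2 V)} {lam : ℕ} (hlam : Odd lam)
    (hF : CutConnected (E \ F) lam) {u v : V} {M M' : V → Finset V}
    (hM : ∀ w X, IsTightCut (E \ F) lam u v X → w ∈ X →
      IsTightCut (E \ F) lam u v (M w) ∧ w ∈ M w ∧ M w ⊆ X)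
    (hM' : ∀ w X, IsTightCut (E \ F) lam u v X → w ∉ X →
      IsTightCut (E \ F) lam u v (M' w) ∧ w ∉ M' w ∧ X ⊆ M' w)
    {f : Sym2 V} (hfE : f ∈ E) (hdel : CutConnected (E \ {f}) lam)
    {X : Finset V} (hX : IsTightCut (E \ F) lam u v X) (hXf : Crosses X f)
    {Y : Finset V} (hY : cutDeg (E \ F) Y = lam) (hYf : Crosses Y f)
    (hYe : ¬ Crosses Y s(u, v)) :
    ∃ w ∈ ends F, Crosses (M w) f ∨ Crosses (M' w) f := by
  wlog hu : u ∉ Y generalizing Y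
  · rw [not_not] at hu
    exact this (by rwa [cutDeg_compl]) (crosses_compl.2 hYf) (by rwa [crosses_compl])
      (by simpa using hu)
  have hv : v ∉ Y := fun h => hu ((not_crosses_iff.1 hYe).2 h)
  obtain ⟨e', he', hYe'⟩ := exists_crosses_of_deletable hfE hdel hYf hY.le
  obtain ⟨w, hw, hwY⟩ := hYe'.exists_mem_ends he'
  refine ⟨w, hw, ?_⟩
  -- If `Y` is disjoint from `X`, then it is also disjoint from `M' w`, and `f` runs from `Y` to `X
  -- ⊆ M' w`. If `Y ⊆ X`, then `Y ⊆ M w ⊆ X`, and `f` leaves the inner and the outer set.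
  rcases hX.disjoint_or_subset hlam hF hu hv hY with hd | hs
  · obtain ⟨h1, h2, h3⟩ := hM' w X hX (Finset.disjoint_left.1 hd hwY)
    have hd' : Disjoint Y (M' w) := by
      rcases h1.disjoint_or_subset hlam hF hu hv hY with hd | hs
      · exact hd
      · exact absurd (hs hwY) h2
    right
    obtain ⟨x, y, rfl, hx, hy⟩ := hYf
    have hx1 := Finset.disjoint_left.1 hd hx
    have hx2 := Finset.disjoint_left.1 hd' hx
    rw [crosses_mk] at hXf ⊢
    have := @h3 y
    tauto
  · obtain ⟨h1, h2, h3⟩ := hM w X hX (hs hwY)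
    have hs' : Y ⊆ M w := by
      rcases h1.disjoint_or_subset hlam hF hu hv hY with hd | hs
      · exact absurd h2 (Finset.disjoint_left.1 hd hwY)
      · exact hs
    exact Or.inl (hYf.of_subset hXf hs' h3)

/-- Bound on the number of edges of a gap between extreme tight cuts: any two of these edges
either lie in a common tight cut, or are in conflict in `E`. -/
theorem card_gap_le {E D F : Finset (Sym2 V)} {lam c C : ℕ} (hlam : Odd lam)
    (hD : D ⊆ E) (hFE : F ⊆ E) (hF : CutConnected (E \ F) lam)
    {u v : V} (heF : s(u, v) ∈ F)
    (hswap : ∀ f ∈ D \ F, ∀ g ∈ D \ F, f ≠ g →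
      ¬ CutConnected (E \ (F.erase s(u, v) ∪ {f, g})) lam)
    (hconf : ∀ f ∈ D, ∀ N : Finset (Sym2 V),
      (∀ g ∈ N, g ∈ D ∧ ¬ CutConnected (E \ {f, g}) lam) → N.card ≤ C)
    {M M' : V → Finset V}
    (hM : ∀ w X, IsTightCut (E \ F) lam u v X → w ∈ X →
      IsTightCut (E \ F) lam u v (M w) ∧ w ∈ M w ∧ M w ⊆ X)
    (hM' : ∀ w X, IsTightCut (E \ F) lam u v X → w ∉ X →
      IsTightCut (E \ F) lam u v (M' w) ∧ w ∉ M' w ∧ X ⊆ M' w)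
    {Γ : Finset (Sym2 V)}
    (hΓ : ∀ f ∈ Γ, f ∈ D \ F ∧
      (∀ Y, cutDeg (E \ F) Y = lam → Crosses Y f → Crosses Y s(u, v)) ∧
      (∀ w ∈ ends F, ¬ Crosses (M w) f ∧ ¬ Crosses (M' w) f) ∧
      ∃ X, IsTightCut (E \ F) lam u v X ∧ Crosses X f ∧ (ends F ∩ X).card = c) :
    Γ.card ≤ lam + C := by
  classical
  rcases Γ.eq_empty_or_nonempty with rfl | hne
  · simp
  set H := E \ F with hH
  -- `ρ f` is the largest member of the chain crossed by `f`; below, `f₀` is an edge of the gap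
  -- whose `ρ` is smallest.
  have hr : ∀ f : Sym2 V, ∃ ρ : Finset V, f ∈ Γ → (IsTightCut H lam u v ρ ∧ Crosses ρ f ∧
      ∀ X, IsTightCut H lam u v X → Crosses X f → X.card ≤ ρ.card) := by
    intro f
    by_cases hf : f ∈ Γ
    · obtain ⟨-, -, -, X, hX, hXf, -⟩ := hΓ f hf
      obtain ⟨ρ, h1, h2⟩ := Finset.exists_max_image
        (Finset.univ.filter fun X => IsTightCut H lam u v X ∧ Crosses X f) Finset.card
        ⟨X, by simp [hX, hXf]⟩
      simp only [Finset.mem_filter, Finset.mem_univ, true_and] at h1 h2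
      exact ⟨ρ, fun _ => ⟨h1.1, h1.2, fun X a b => h2 X ⟨a, b⟩⟩⟩
    · exact ⟨∅, fun h => absurd h hf⟩
  choose ρ hρ using hr
  obtain ⟨f₀, hf₀, hmin⟩ := Finset.exists_min_image Γ (fun f => (ρ f).card) hne
  obtain ⟨hX₀, hX₀f, hX₀max⟩ := hρ f₀ hf₀
  obtain ⟨hf₀D, hf₀tight, hf₀marks, Xf, hXf, hXff, hXfc⟩ := hΓ f₀ hf₀
  have hue : u ∈ ends F := mem_ends.2 ⟨_, heF, by simp⟩
  have hve : v ∈ ends F := mem_ends.2 ⟨_, heF, by simp⟩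
  -- The gap lies between the largest lower mark `M w₁` of the ends of `F` inside `Xf` and the
  -- smallest upper mark `M' w₂` of those outside. It contains no end of `F` (`hA`, `hA'`).
  obtain ⟨w₁, hw₁, hw₁max⟩ := Finset.exists_max_image (ends F ∩ Xf) (fun w => (M w).card)
    ⟨u, by simp [hue, hXf.1]⟩
  obtain ⟨w₂, hw₂, hw₂min⟩ := Finset.exists_min_image (ends F \ Xf) (fun w => (M' w).card)
    ⟨v, by simp [hve, hXf.2.1]⟩
  rw [Finset.mem_inter] at hw₁
  rw [Finset.mem_sdiff] at hw₂
  have hM₁ := hM w₁ Xf hXf hw₁.2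
  have hM₂ := hM' w₂ Xf hXf hw₂.2
  have hA : ∀ w ∈ ends F, w ∈ Xf → w ∈ M w₁ := by
    intro w hw hwX
    have h1 := hM w Xf hXf hwX
    exact h1.1.subset_of_card_le hlam hF hM₁.1 (hw₁max w (by simp [hw, hwX])) h1.2.1
  have hA' : ∀ w ∈ ends F, w ∉ Xf → w ∉ M' w₂ := by
    intro w hw hwX hwM
    have h1 := hM' w Xf hXf hwX
    exact h1.2.1 (hM₂.1.subset_of_card_le hlam hF h1.1 (hw₂min w (by simp [hw, hwX])) hwM)
  -- In a chain, members with the same number `c` of ends of `F` contain the same ends. Hence the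
  -- tight cut of every `f` in `Γ` lies between the two marks, and since `f` crosses no mark, both
  -- its ends lie in the gap.
  have hinside : ∀ f ∈ Γ, ∀ z ∈ f, z ∉ M w₁ ∧ z ∈ M' w₂ := by
    intro f hf z hz
    obtain ⟨-, -, hmarks, X, hX, hXf', hXc⟩ := hΓ f hf
    have hlabel : ends F ∩ X = ends F ∩ Xf := by
      rcases le_total X.card Xf.card with h | h
      · exact Finset.eq_of_subset_of_card_le
          (Finset.inter_subset_inter le_rfl (hX.subset_of_card_le hlam hF hXf h)) (by omega)
      · exact (Finset.eq_of_subset_of_card_le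
          (Finset.inter_subset_inter le_rfl (hXf.subset_of_card_le hlam hF hX h)) (by omega)).symm
    have h1 : w₁ ∈ X := by
      have : w₁ ∈ ends F ∩ Xf := by simp [hw₁]
      rw [← hlabel] at this
      exact (Finset.mem_inter.1 this).2
    have h2 : w₂ ∉ X := by
      intro h
      have : w₂ ∈ ends F ∩ X := by simp [hw₂.1, h]
      rw [hlabel] at this
      exact hw₂.2 (Finset.mem_inter.1 this).2
    have h3 := (hM w₁ X hX h1).2.2
    have h4 := (hM' w₂ X hX h2).2.2
    have h5 := (hmarks w₁ hw₁.1).1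
    have h6 := (hmarks w₂ hw₂.1).2
    obtain ⟨x, y, rfl, hx, hy⟩ := hXf'
    rw [not_crosses_iff] at h5 h6
    have hy1 : y ∉ M w₁ := fun h => hy (h3 h)
    have hx2 : x ∈ M' w₂ := h4 hx
    rcases Sym2.mem_iff.1 hz with rfl | rfl
    · exact ⟨fun h => hy1 (h5.1 h), hx2⟩
    · exact ⟨hy1, h6.1 hx2⟩
  have hsub : Γ ⊆ boundary H (ρ f₀) ∪
      D.filter fun g => ¬ CutConnected (E \ {f₀, g}) lam := by
    intro g hg
    obtain ⟨hgD, hgtight, -, -⟩ := hΓ g hg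
    have hgD' := Finset.mem_sdiff.1 hgD
    have hf₀D' := Finset.mem_sdiff.1 hf₀D
    have hgH : g ∈ H := Finset.mem_sdiff.2 ⟨hD hgD'.1, hgD'.2⟩
    have hf₀H : f₀ ∈ H := Finset.mem_sdiff.2 ⟨hD hf₀D'.1, hf₀D'.2⟩
    rw [Finset.mem_union, mem_boundary, Finset.mem_filter]
    by_cases hcr : Crosses (ρ f₀) g
    · exact Or.inl ⟨hgH, hcr⟩
    refine Or.inr ⟨hgD'.1, ?_⟩
    have hne' : f₀ ≠ g := by
      rintro rfl
      exact hcr hX₀f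
    have hconn := hswap f₀ hf₀D g hgD hne'
    set B := E \ F.erase s(u, v) with hB
    have hBe : B \ {s(u, v)} = H := by
      ext f
      simp only [hB, hH, Finset.mem_sdiff, Finset.mem_erase, Finset.mem_singleton]
      constructor
      · tauto
      · rintro ⟨h1, h2⟩
        exact ⟨⟨h1, fun h => h2 h.2⟩, fun h => h2 (h ▸ heF)⟩
    have hHB : H ⊆ B := hBe ▸ Finset.sdiff_subset
    have hBc : E \ (F.erase s(u, v) ∪ {f₀, g}) = B \ {f₀, g} := by
      rw [hB, Finset.sdiff_sdiff_left', Finset.sdiff_union_distrib]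
    rw [hBc] at hconn
    have heB : s(u, v) ∈ B := by simp [hB, hFE heF]
    -- A tight cut of `B` through `f` would be tight in `H`, hence cross `s(u, v)`; but then `H` has
    -- one edge less in it than `B`.
    have hdelB : ∀ f ∈ Γ, CutConnected (B \ {f}) lam := by
      intro f hf
      obtain ⟨hfD, hft, -, -⟩ := hΓ f hf
      have hfD' := Finset.mem_sdiff.1 hfD
      have hfB : f ∈ B := hHB (Finset.mem_sdiff.2 ⟨hD hfD'.1, hfD'.2⟩)
      by_contra hcon
      obtain ⟨Z, hZf, hZ⟩ := exists_cut_of_not_deletable (hF.mono hHB) hfB hcon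
      have h1 := hF Z hZf.nonempty hZf.ne_univ
      have h2 := cutDeg_mono hHB Z
      have h3 := hft Z (by omega) hZf
      have h4 := cutDeg_sdiff_singleton_add_one heB h3
      rw [hBe] at h4
      omega
    obtain ⟨-, Z, hZf, hZg, hZ⟩ := exists_cut_of_conflict (hHB hf₀H) (hHB hgH)
      (hdelB f₀ hf₀) (hdelB g hg) hconn
    -- If `Z` separates `u` from `v`, it is tight in `H` and crossed by `f₀` and `g`. Up to
    -- complement `Z ⊆ ρ f₀ ⊆ ρ g`, by the choice of `ρ` and of `f₀`, so `g` crosses `ρ f₀`, which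
    -- is excluded.
    by_cases hZe : Crosses Z s(u, v)
    · exfalso
      have hZH : cutDeg H Z = lam := by
        have h4 := cutDeg_sdiff_singleton_add_one heB hZe
        rw [hBe] at h4
        omega
      obtain ⟨Z', hZ', hZ'f, hZ'g⟩ : ∃ Z', IsTightCut H lam u v Z' ∧ Crosses Z' f₀ ∧
          Crosses Z' g := by
        rcases crosses_mk.1 hZe with ⟨h1, h2⟩ | ⟨h1, h2⟩
        · exact ⟨Z, ⟨h1, h2, hZH⟩, hZf, hZg⟩
        · exact ⟨Zᶜ, ⟨by simpa using h2, by simpa using h1, by rw [cutDeg_compl, hZH]⟩,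
            crosses_compl.2 hZf, crosses_compl.2 hZg⟩
      obtain ⟨hg1, hg2, -⟩ := hρ g hg
      exact hcr (hZ'g.of_subset hg2
        (hZ'.subset_of_card_le hlam hF hX₀ (hX₀max Z' hZ' hZ'f))
        (hX₀.subset_of_card_le hlam hF hg1 (hmin g hg)))
    obtain ⟨Y, hYu, hYv, hYd, hYf, hYg⟩ : ∃ Y, u ∉ Y ∧ v ∉ Y ∧ cutDeg H Y ≤ lam + 1 ∧
        Crosses Y f₀ ∧ Crosses Y g := by
      have h1 := cutDeg_mono hHB Z
      have h2 := not_crosses_iff.1 hZe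
      by_cases hu : u ∈ Z
      · exact ⟨Zᶜ, by simpa using hu, by simpa using h2.1 hu, by rw [cutDeg_compl]; omega,
          crosses_compl.2 hZf, crosses_compl.2 hZg⟩
      · exact ⟨Z, hu, fun h => hu (h2.2 h), by omega, hZf, hZg⟩
    -- Restriction of `Y` to the gap does not push its degree above `lam + 1`: the marks have degree
    -- `lam`, and the opposite corners separate `u` from `v`, so they have degree at least `lam`.
    have hd1 : cutDeg H (Y \ M w₁) ≤ lam + 1 := by
      have h1 := cutDeg_sdiff_add_sdiff_le H Y (M w₁)
      have h2 := hF (M w₁ \ Y) ⟨u, by simp [hM₁.1.1, hYu]⟩ fun h => by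
        have := Finset.mem_univ v
        rw [← h] at this
        simp [hM₁.1.2.1] at this
      have h3 := hM₁.1.2.2
      omega
    have hd2 : cutDeg H ((Y \ M w₁) ∩ M' w₂) ≤ lam + 1 := by
      have h1 := cutDeg_inter_add_union_le H (Y \ M w₁) (M' w₂)
      have h2 := hF ((Y \ M w₁) ∪ M' w₂) ⟨u, by simp [hM₂.1.1]⟩ fun h => by
        have := Finset.mem_univ v
        rw [← h] at this
        simp [hM₂.1.2.1, hYv] at this
      have h3 := hM₂.1.2.2
      omega
    set Q := (Y \ M w₁) ∩ M' w₂ with hQ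
    have hQcross : ∀ f ∈ Γ, Crosses Y f → Crosses Q f := by
      intro f hf hfY
      have h1 := hinside f hf
      obtain ⟨x, y, rfl, hx, hy⟩ := hfY
      have hx' := h1 x (by simp)
      exact ⟨x, y, rfl, by simp [hQ, hx, hx'], by simp [hQ, hy]⟩
    -- `Q` contains no end of `F`, so its degree is the same in `E` and in `H`. As `f₀` and `g` both
    -- leave `Q`, they are in conflict in `E`.
    have hQE : cutDeg E Q ≤ lam + 1 := by
      rw [← cutDeg_sdiff_eq (F := F)]
      · exact hd2
      · intro f hf hfQ
        obtain ⟨w, hw, hwQ⟩ := hfQ.exists_mem_ends hf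
        simp only [hQ, Finset.mem_inter, Finset.mem_sdiff] at hwQ
        by_cases hwX : w ∈ Xf
        · exact hwQ.1.2 (hA w hw hwX)
        · exact hA' w hw hwX hwQ.2
    have hQf := hQcross f₀ hf₀ hYf
    have hQg := hQcross g hg hYg
    intro hcon
    have h1 : E \ {f₀, g} = (E \ {f₀}) \ {g} := by
      ext f
      simp only [Finset.mem_sdiff, Finset.mem_insert, Finset.mem_singleton]
      tauto
    rw [h1] at hcon
    have h2 := hcon.lt_cutDeg (by simp [hD hgD'.1, hne'.symm]) hQg
    have h3 := cutDeg_sdiff_singleton_add_one (hD hf₀D'.1) hQf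
    omega
  calc Γ.card ≤ _ := Finset.card_le_card hsub
    _ ≤ _ := Finset.card_union_le _ _
    _ ≤ lam + C := add_le_add hX₀.2.2.le (hconf f₀ (Finset.mem_sdiff.1 hf₀D).1 _ (by simp))

/-- A locally maximal deletion set with fewer than `k` edges in a graph all whose conflict degrees
are small: there are few candidate edges. -/
theorem card_le_of_locally_maximal {E D F : Finset (Sym2 V)} {lam k : ℕ} (hlam : Odd lam)
    (hD : D ⊆ E) (hdel : ∀ f ∈ D, CutConnected (E \ {f}) lam)
    (hFD : F ⊆ D) (hF : CutConnected (E \ F) lam) (hk : F.card < k)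
    (hadd : ∀ f ∈ D \ F, ¬ CutConnected (E \ (F ∪ {f})) lam)
    (hswap : ∀ e ∈ F, ∀ f ∈ D \ F, ∀ g ∈ D \ F, f ≠ g →
      ¬ CutConnected (E \ (F.erase e ∪ {f, g})) lam)
    (hconf : ∀ f ∈ D, ∀ N : Finset (Sym2 V),
      (∀ g ∈ N, g ∈ D ∧ ¬ CutConnected (E \ {f, g}) lam) → N.card ≤ 2 * (k - 1) * lam) :
    D.card ≤ lam * (6 * k ^ 3 + 9 * k ^ 2 + k) := by
  classical
  have hrep : ∀ e : Sym2 V, ∃ p : V × V, e = s(p.1, p.2) := fun e => by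
    induction e with
    | _ x y => exact ⟨(x, y), rfl⟩
  choose p hp using hrep
  choose M hMlam hM using fun (e : Sym2 V) (w : V) =>
    exists_smallest_tightCut hlam hF (p e).1 (p e).2 w
  choose M' hMlam' hM' using fun (e : Sym2 V) (w : V) =>
    exists_largest_tightCut hlam hF (p e).1 (p e).2 w
  set H := E \ F with hH
  let Γ : Sym2 V → ℕ → Finset (Sym2 V) := fun e c => (D \ F).filter fun f =>
      (∀ Y, cutDeg H Y = lam → Crosses Y f → Crosses Y s((p e).1, (p e).2)) ∧
      (∀ w ∈ ends F, ¬ Crosses (M e w) f ∧ ¬ Crosses (M' e w) f) ∧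
      ∃ X, IsTightCut H lam (p e).1 (p e).2 X ∧ Crosses X f ∧ (ends F ∩ X).card = c
  have hΓcard : ∀ e ∈ F, ∀ c, (Γ e c).card ≤ lam + 2 * (k - 1) * lam := by
    intro e he c
    refine card_gap_le (u := (p e).1) (v := (p e).2) (c := c) hlam hD (hFD.trans hD) hF ?_ ?_
      hconf (hM e) (hM' e) ?_
    · rwa [← hp e]
    · rw [← hp e]
      exact hswap e he
    · intro f hf
      exact Finset.mem_filter.1 hf
  -- Since `f` cannot be added to `F`, it lies in a tight cut of `H`; since `f` is deletable in `E`,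
  -- some `e` in `F` crosses that cut. In the chain of `e`, either `f` crosses a mark or it belongs
  -- to the gap with label `c`.
  have hcover : D \ F ⊆ F.biUnion fun e =>
      ((ends F).biUnion fun w => boundary H (M e w) ∪ boundary H (M' e w)) ∪
      (Finset.range (ends F).card).biUnion fun c => Γ e c := by
    intro f hf
    have hfD := Finset.mem_sdiff.1 hf
    have hfH : f ∈ H := Finset.mem_sdiff.2 ⟨hD hfD.1, hfD.2⟩
    have hnd : ¬ CutConnected (H \ {f}) lam := by
      have := hadd f hf
      rwa [← Finset.sup_eq_union, ← sdiff_sdiff_left] at this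
    obtain ⟨X₀, hX₀f, hX₀⟩ := exists_cut_of_not_deletable hF hfH hnd
    obtain ⟨e, he, hX₀e⟩ := exists_crosses_of_deletable (hD hfD.1) (hdel f hfD.1) hX₀f hX₀.le
    obtain ⟨X, hX, hXf⟩ : ∃ X, IsTightCut H lam (p e).1 (p e).2 X ∧ Crosses X f := by
      rw [hp e] at hX₀e
      rcases crosses_mk.1 hX₀e with ⟨h1, h2⟩ | ⟨h1, h2⟩
      · exact ⟨X₀, ⟨h1, h2, hX₀⟩, hX₀f⟩
      · exact ⟨X₀ᶜ, ⟨by simpa using h2, by simpa using h1, by rw [cutDeg_compl, hX₀]⟩,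
          crosses_compl.2 hX₀f⟩
    refine Finset.mem_biUnion.2 ⟨e, he, Finset.mem_union.2 ?_⟩
    by_cases hmark : ∃ w ∈ ends F, Crosses (M e w) f ∨ Crosses (M' e w) f
    · left
      obtain ⟨w, hw, h⟩ := hmark
      refine Finset.mem_biUnion.2 ⟨w, hw, ?_⟩
      simp only [Finset.mem_union, mem_boundary]
      tauto
    · right
      refine Finset.mem_biUnion.2 ⟨(ends F ∩ X).card, ?_, ?_⟩
      -- The label is smaller than the number of ends of `F`, because the end `v` of `e` is outside
      -- `X`.
      · refine Finset.mem_range.2 (Finset.card_lt_card ?_)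
        refine Finset.ssubset_iff_subset_ne.2 ⟨Finset.inter_subset_left, fun h => ?_⟩
        have hv : (p e).2 ∈ ends F := by
          have := Sym2.mem_mk_right (p e).1 (p e).2
          rw [← hp e] at this
          exact mem_ends.2 ⟨e, he, this⟩
        rw [← h] at hv
        exact hX.2.1 (Finset.mem_inter.1 hv).2
      · refine Finset.mem_filter.2 ⟨hf, ?_, ?_, X, hX, hXf, rfl⟩
        · intro Y hY hYf
          by_contra hYe
          exact hmark (exists_crosses_extreme_tightCut hlam hF (hM e) (hM' e) (hD hfD.1)
            (hdel f hfD.1) hX hXf hY hYf hYe)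
        · intro w hw
          exact ⟨fun h => hmark ⟨w, hw, Or.inl h⟩, fun h => hmark ⟨w, hw, Or.inr h⟩⟩
  have h1 : (D \ F).card ≤ F.card * ((ends F).card * (lam + lam) +
      (ends F).card * (lam + 2 * (k - 1) * lam)) := by
    refine (Finset.card_le_card hcover).trans (Finset.card_biUnion_le_card_mul _ _ _ fun e he => ?_)
    refine (Finset.card_union_le _ _).trans (add_le_add ?_ ?_)
    · refine Finset.card_biUnion_le_card_mul _ _ _ fun w _ => ?_
      exact (Finset.card_union_le _ _).trans (add_le_add (hMlam e w) (hMlam' e w))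
    · refine (Finset.card_biUnion_le_card_mul _ _ _ fun c _ => hΓcard e he c).trans ?_
      simp
  have h2 := card_ends_le F
  have h3 := Finset.card_sdiff_add_card_eq_card hFD
  obtain ⟨j, rfl⟩ : ∃ j, k = j + 1 := ⟨k - 1, by omega⟩
  have hr : F.card ≤ j := by omega
  have hW : (ends F).card ≤ 2 * j := by omega
  have hl : 1 ≤ lam := by
    obtain ⟨a, rfl⟩ := hlam
    omega
  rw [Nat.add_sub_cancel] at h1
  have h4 : (D \ F).card ≤ j * (2 * j * (lam + lam) + 2 * j * (lam + 2 * j * lam)) := by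
    refine h1.trans ?_
    gcongr
  have h5 : j ≤ lam * j := Nat.le_mul_of_pos_left j hl
  -- With `j = k - 1` the count is at most `lam * (4 * j ^ 3 + 6 * j ^ 2 + j)`; the last summand is
  -- the slack.
  have h6 : lam * (6 * (j + 1) ^ 3 + 9 * (j + 1) ^ 2 + (j + 1)) =
      j * (2 * j * (lam + lam) + 2 * j * (lam + 2 * j * lam)) + lam * j +
      lam * (2 * j ^ 3 + 21 * j ^ 2 + 36 * j + 16) := by ring
  omega

end EdgeCut

/-! ### Loop programs -/

namespace RAM

/-- Programs all whose loops run through the numbers below the content of register `0`. -/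
inductive LoopProgram where
  | skip
  | setReg (r : ℕ) (x : Expr)
  | setTab (a : ℕ) (i j x : Expr)
  | seq (P Q : LoopProgram)
  | ite (x : Expr) (P Q : LoopProgram)
  | forLoop (r : ℕ) (P : LoopProgram)

namespace LoopProgram

/-- The program of the machine for a loop program. -/
def compile : LoopProgram → Program
  | skip => .skip
  | setReg r x => .setReg r x
  | setTab a i j x => .setTab a i j x
  | seq P Q => .seq P.compile Q.compile
  | ite x P Q => .ite x P.compile Q.compile
  | forLoop r P => .seq (.setReg r (.const 0)) (.while (.lt (.reg r) (.reg 0))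
      (.seq P.compile (.setReg r (.add (.reg r) (.const 1)))))

/-- The memory after the execution of a loop program. -/
def exec : LoopProgram → Memory → Memory
  | skip, s => s
  | setReg r x, s => s.setReg r (x.eval s)
  | setTab a i j x, s => s.setTab a (i.eval s) (j.eval s) (x.eval s)
  | seq P Q, s => Q.exec (P.exec s)
  | ite x P Q, s => if x.eval s ≠ 0 then P.exec s else Q.exec s
  | forLoop r P, s =>
      (fun m => (P.exec m).setReg r ((P.exec m).reg r + 1))^[s.reg 0] (s.setReg r 0)

/-- Whether register `r` is written. -/
def writesReg : LoopProgram → ℕ → Bool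
  | skip, _ => false
  | setReg r' _, r => r' == r
  | setTab _ _ _ _, _ => false
  | seq P Q, r => P.writesReg r || Q.writesReg r
  | ite _ P Q, r => P.writesReg r || Q.writesReg r
  | forLoop r' P, r => r' == r || P.writesReg r

/-- Whether table `a` is written. -/
def writesTab : LoopProgram → ℕ → Bool
  | skip, _ => false
  | setReg _ _, _ => false
  | setTab a' _ _ _, a => a' == a
  | seq P Q, a => P.writesTab a || Q.writesTab a
  | ite _ P Q, a => P.writesTab a || Q.writesTab a
  | forLoop _ P, a => P.writesTab a

/-- No loop modifies its own counter. -/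
def countersFree : LoopProgram → Bool
  | skip => true
  | setReg _ _ => true
  | setTab _ _ _ _ => true
  | seq P Q => P.countersFree && Q.countersFree
  | ite _ P Q => P.countersFree && Q.countersFree
  | forLoop r P => P.countersFree && !P.writesReg r

open Polynomial in
/-- A bound for the number of steps, in terms of the content of register `0`. -/
noncomputable def time : LoopProgram → ℕ[X]
  | skip => C 1
  | setReg _ x => C (x.cost + 1)
  | setTab _ i j x => C (i.cost + j.cost + x.cost + 1)
  | seq P Q => P.time + Q.time
  | ite x P Q => C (x.cost + 1) + (P.time + Q.time)
  | forLoop _ P => C 6 + X * (C 8 + P.time)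

end LoopProgram

@[simp]
theorem Memory.setReg_reg (s : Memory) (r x r' : ℕ) :
    (s.setReg r x).reg r' = if r' = r then x else s.reg r' := by
  simp [Memory.setReg, Function.update_apply]

@[simp]
theorem Memory.setReg_tab (s : Memory) (r x : ℕ) : (s.setReg r x).tab = s.tab := rfl

@[simp]
theorem Memory.setTab_reg (s : Memory) (a i j x : ℕ) : (s.setTab a i j x).reg = s.reg := rfl

@[simp]
theorem Memory.setTab_tab (s : Memory) (a i j x a' i' j' : ℕ) :
    (s.setTab a i j x).tab a' i' j' =
      if a' = a ∧ i' = i ∧ j' = j then x else s.tab a' i' j' := rfl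

namespace Expr

/-- Conjunction of tests. -/
def and (x y : Expr) : Expr := .sub (.const 1) (.add (.eq x (.const 0)) (.eq y (.const 0)))

@[simp]
theorem eval_reg (s : Memory) (r : ℕ) : (reg r).eval s = s.reg r := rfl

@[simp]
theorem eval_const (s : Memory) (c : ℕ) : (const c).eval s = c := rfl

@[simp]
theorem eval_tab (s : Memory) (a : ℕ) (i j : Expr) :
    (tab a i j).eval s = s.tab a (i.eval s) (j.eval s) := rfl

@[simp]
theorem eval_add (s : Memory) (x y : Expr) : (add x y).eval s = x.eval s + y.eval s := rfl

@[simp]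
theorem eval_sub (s : Memory) (x y : Expr) : (sub x y).eval s = x.eval s - y.eval s := rfl

theorem eval_lt (s : Memory) (x y : Expr) :
    (lt x y).eval s = if x.eval s < y.eval s then 1 else 0 := rfl

theorem eval_eq (s : Memory) (x y : Expr) :
    (eq x y).eval s = if x.eval s = y.eval s then 1 else 0 := rfl

theorem eval_lt_ne_zero {s : Memory} {x y : Expr} :
    (lt x y).eval s ≠ 0 ↔ x.eval s < y.eval s := by
  rw [eval_lt]
  split <;> simp [*]

theorem eval_eq_ne_zero {s : Memory} {x y : Expr} :
    (eq x y).eval s ≠ 0 ↔ x.eval s = y.eval s := by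
  rw [eval_eq]
  split <;> simp [*]

theorem eval_and_ne_zero {s : Memory} {x y : Expr} :
    (and x y).eval s ≠ 0 ↔ x.eval s ≠ 0 ∧ y.eval s ≠ 0 := by
  rw [and, eval_sub, eval_add, eval_eq, eval_eq]
  simp only [eval_const]
  by_cases hx : eval s x = 0 <;> by_cases hy : eval s y = 0 <;> simp [hx, hy]

theorem eval_add_ne_zero {s : Memory} {x y : Expr} :
    (add x y).eval s ≠ 0 ↔ x.eval s ≠ 0 ∨ y.eval s ≠ 0 := by
  rw [eval_add]
  omega

end Expr

namespace LoopProgram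

/-- With `exec_tab`, this reduces frame conditions to computations on the program text, settled by
`decide`. -/
theorem exec_reg {P : LoopProgram} {r : ℕ} (h : P.writesReg r = false) (s : Memory) :
    (P.exec s).reg r = s.reg r := by
  induction P generalizing s with
  | skip => rfl
  | setReg r' x =>
    have : r ≠ r' := by
      rintro rfl
      simp [writesReg] at h
    simp [exec, this]
  | setTab => rfl
  | seq P Q ihP ihQ =>
    simp only [writesReg, Bool.or_eq_false_iff] at h
    rw [exec, ihQ h.2, ihP h.1]
  | ite x P Q ihP ihQ =>
    simp only [writesReg, Bool.or_eq_false_iff] at h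
    rw [exec]
    split
    exacts [ihP h.1 s, ihQ h.2 s]
  | forLoop r' P ih =>
    simp only [writesReg, Bool.or_eq_false_iff, beq_eq_false_iff_ne] at h
    rw [exec]
    generalize s.reg 0 = N
    induction N with
    | zero => simp [h.1.symm]
    | succ N ihN =>
      rw [Function.iterate_succ_apply', Memory.setReg_reg, if_neg h.1.symm, ih h.2, ihN]

theorem exec_tab {P : LoopProgram} {a : ℕ} (h : P.writesTab a = false) (s : Memory) :
    (P.exec s).tab a = s.tab a := by
  induction P generalizing s with
  | skip => rfl
  | setReg r' x => rfl
  | setTab a' i j x =>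
    have : a ≠ a' := by
      rintro rfl
      simp [writesTab] at h
    ext
    simp [exec, this]
  | seq P Q ihP ihQ =>
    simp only [writesTab, Bool.or_eq_false_iff] at h
    rw [exec, ihQ h.2, ihP h.1]
  | ite x P Q ihP ihQ =>
    simp only [writesTab, Bool.or_eq_false_iff] at h
    rw [exec]
    split
    exacts [ihP h.1 s, ihQ h.2 s]
  | forLoop r' P ih =>
    simp only [writesTab] at h
    rw [exec]
    generalize s.reg 0 = N
    induction N with
    | zero => rfl
    | succ N ihN => rw [Function.iterate_succ_apply', Memory.setReg_tab, ih h, ihN]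

theorem iterate_reg {P : LoopProgram} {r : ℕ} (h : P.writesReg r = false) (s : Memory) (N : ℕ) :
    ((fun m => (P.exec m).setReg r ((P.exec m).reg r + 1))^[N] (s.setReg r 0)).reg r = N := by
  induction N with
  | zero => simp
  | succ N ih => rw [Function.iterate_succ_apply', Memory.setReg_reg, if_pos rfl, exec_reg h, ih]

theorem iterate_reg_zero {P : LoopProgram} {r : ℕ} (h0 : (forLoop r P).writesReg 0 = false)
    (s : Memory) (N : ℕ) :
    ((fun m => (P.exec m).setReg r ((P.exec m).reg r + 1))^[N] (s.setReg r 0)).reg 0 =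
      s.reg 0 := by
  simp only [writesReg, Bool.or_eq_false_iff, beq_eq_false_iff_ne] at h0
  induction N with
  | zero => simp [h0.1.symm]
  | succ N ih =>
    rw [Function.iterate_succ_apply', Memory.setReg_reg, if_neg h0.1.symm, exec_reg h0.2, ih]

/-- Induction along a loop. -/
theorem exec_forLoop {P : LoopProgram} {r : ℕ} (h : P.writesReg r = false)
    (h0 : (forLoop r P).writesReg 0 = false) {s m : Memory} (hm : (forLoop r P).exec s = m)
    (I : ℕ → Memory → Prop) (base : I 0 (s.setReg r 0))
    (step : ∀ i m, i < s.reg 0 → m.reg r = i → m.reg 0 = s.reg 0 → I i m →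
      I (i + 1) ((P.exec m).setReg r (i + 1))) :
    I (s.reg 0) m := by
  subst hm
  have key : ∀ N ≤ s.reg 0,
      I N ((fun m => (P.exec m).setReg r ((P.exec m).reg r + 1))^[N] (s.setReg r 0)) := by
    intro N hN
    induction N with
    | zero => exact base
    | succ N ih =>
      have h1 := iterate_reg h s N
      have h2 := step N _ (by omega) h1 (iterate_reg_zero h0 s N) (ih (by omega))
      rw [Function.iterate_succ_apply']
      rwa [exec_reg h, h1]
  exact key _ le_rfl

-- As register `0` is never written and no body changes its counter, each loop makes exactly `s.reg
-- 0` passes, and the same bound applies to every pass.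
open Polynomial in
theorem run_compile {P : LoopProgram} (hP : P.countersFree) (h0 : P.writesReg 0 = false)
    (s : Memory) : ∃ t ≤ P.time.eval (s.reg 0), Run P.compile s (P.exec s) t := by
  induction P generalizing s with
  | skip => exact ⟨_, by simp [time], Run.skip s⟩
  | setReg r x => exact ⟨_, by simp [time], Run.setReg s r x⟩
  | setTab a i j x => exact ⟨_, by simp [time], Run.setTab s a i j x⟩
  | seq P Q ihP ihQ =>
    simp only [writesReg, Bool.or_eq_false_iff] at h0
    simp only [countersFree, Bool.and_eq_true] at hP
    obtain ⟨t, ht, hr⟩ := ihP hP.1 h0.1 s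
    obtain ⟨t', ht', hr'⟩ := ihQ hP.2 h0.2 (P.exec s)
    rw [exec_reg h0.1] at ht'
    exact ⟨t + t', by simp only [time, eval_add]; omega, hr.seq hr'⟩
  | ite x P Q ihP ihQ =>
    simp only [writesReg, Bool.or_eq_false_iff] at h0
    simp only [countersFree, Bool.and_eq_true] at hP
    by_cases hx : x.eval s ≠ 0
    · obtain ⟨t, ht, hr⟩ := ihP hP.1 h0.1 s
      refine ⟨x.cost + 1 + t, by simp only [time, eval_add, eval_C]; omega, ?_⟩
      rw [exec, if_pos hx]
      exact Run.ite_true hx hr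
    · obtain ⟨t, ht, hr⟩ := ihQ hP.2 h0.2 s
      refine ⟨x.cost + 1 + t, by simp only [time, eval_add, eval_C]; omega, ?_⟩
      rw [exec, if_neg hx]
      exact Run.ite_false (not_not.1 hx) hr
  | forLoop r P ih =>
    simp only [countersFree, Bool.and_eq_true, Bool.not_eq_true'] at hP
    have h0' := h0
    simp only [writesReg, Bool.or_eq_false_iff, beq_eq_false_iff_ne] at h0'
    set f : Memory → Memory := fun m => (P.exec m).setReg r ((P.exec m).reg r + 1) with hf
    set n := s.reg 0 with hn
    -- Here `j` passes remain. A loop test takes 4 steps, and so does the increment of the counter: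
    -- 8 per pass besides the body, and 4 for the final failing test. The initial assignment adds 2,
    -- whence the 6 in `time`.
    have key : ∀ j i, i + j = n → ∃ t ≤ 4 + j * (8 + P.time.eval n),
        Run (.while (.lt (.reg r) (.reg 0))
          (.seq P.compile (.setReg r (.add (.reg r) (.const 1)))))
          (f^[i] (s.setReg r 0)) (f^[n] (s.setReg r 0)) t := by
      intro j
      induction j with
      | zero =>
        intro i hi
        have hin : i = n := by omega
        subst hin
        refine ⟨4, by omega, Run.while_false ?_⟩
        rw [← not_ne_iff, Expr.eval_lt_ne_zero, Expr.eval_reg, Expr.eval_reg, iterate_reg hP.2,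
          iterate_reg_zero h0]
        exact lt_irrefl _
      | succ j ihj =>
        intro i hi
        obtain ⟨t, ht, hr⟩ := ihj (i + 1) (by omega)
        obtain ⟨t', ht', hr'⟩ := ih hP.1 h0'.2 (f^[i] (s.setReg r 0))
        rw [iterate_reg_zero h0, ← hn] at ht'
        rw [Function.iterate_succ_apply'] at hr
        refine ⟨_, ?_, Run.while_true ?_ (hr'.seq (Run.setReg _ r _)) hr⟩
        · simp only [Expr.cost]
          have : (j + 1) * (8 + eval n P.time) = j * (8 + eval n P.time) + (8 + eval n P.time) := by
            ring
          omega
        · rw [Expr.eval_lt_ne_zero, Expr.eval_reg, Expr.eval_reg, iterate_reg hP.2,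
            iterate_reg_zero h0]
          omega
    obtain ⟨t, ht, hr⟩ := key n 0 (by omega)
    refine ⟨_, ?_, (Run.setReg s r (.const 0)).seq hr⟩
    simp only [time, eval_add, eval_C, eval_mul, eval_X, Expr.cost]
    omega

theorem eval_time_mono (P : LoopProgram) {m n : ℕ} (h : m ≤ n) :
    P.time.eval m ≤ P.time.eval n := by
  induction P with
  | skip => simp [time]
  | setReg => simp [time]
  | setTab => simp [time]
  | seq P Q ihP ihQ => simp only [time, Polynomial.eval_add]; omega
  | ite x P Q ihP ihQ => simp only [time, Polynomial.eval_add, Polynomial.eval_C]; omega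
  | forLoop r P ih =>
    simp only [time, Polynomial.eval_add, Polynomial.eval_mul, Polynomial.eval_C,
      Polynomial.eval_X]
    gcongr

end LoopProgram

end RAM

/-! ### Minimum cuts by maximum adjacency orderings -/

namespace MinCut

/-- The total weight between `x` and the vertices of `A` on the other side of `C`. -/
def opposite (w : ℕ → ℕ → ℕ) (A C : Finset ℕ) (x : ℕ) : ℕ :=
  ∑ y ∈ A, if (x ∈ C ↔ y ∈ C) then 0 else w x y

/-- The weight of the cut of `A` induced by `C`. -/
def weight (w : ℕ → ℕ → ℕ) (A C : Finset ℕ) : ℕ :=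
  ∑ x ∈ A, ∑ y ∈ A, if x ∈ C ∧ y ∉ C then w x y else 0

/-- All cuts of `A` have weight at least `lam`. -/
def Connected (w : ℕ → ℕ → ℕ) (A : Finset ℕ) (lam : ℕ) : Prop :=
  ∀ C : Finset ℕ, (∃ x ∈ A, x ∈ C) → (∃ x ∈ A, x ∉ C) → lam ≤ weight w A C

variable {w : ℕ → ℕ → ℕ}

theorem weight_insert {A : Finset ℕ} {x : ℕ} (hw : ∀ y ∈ A, w x y = w y x) (C : Finset ℕ)
    (hx : x ∉ A) : weight w (insert x A) C = weight w A C + opposite w A C x := by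
  simp only [weight, opposite, Finset.sum_insert hx, Finset.sum_add_distrib]
  have h : ∑ y ∈ A, (if (x ∈ C ↔ y ∈ C) then 0 else w x y) =
      (∑ y ∈ A, if x ∈ C ∧ y ∉ C then w x y else 0) +
        ∑ y ∈ A, if y ∈ C ∧ x ∉ C then w y x else 0 := by
    rw [← Finset.sum_add_distrib]
    refine Finset.sum_congr rfl fun y hy => ?_
    by_cases h1 : x ∈ C <;> by_cases h2 : y ∈ C <;> simp [h1, h2, hw y hy]
  rw [h]
  have : (if x ∈ C ∧ x ∉ C then w x x else 0) = 0 := if_neg (by tauto)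
  omega

theorem le_opposite {A C : Finset ℕ} {x y : ℕ} (hy : y ∈ A) (h : ¬ (x ∈ C ↔ y ∈ C)) :
    w x y ≤ opposite w A C x := by
  have := Finset.single_le_sum (f := fun y => if (x ∈ C ↔ y ∈ C) then 0 else w x y)
    (fun _ _ => Nat.zero_le _) hy
  simpa [h, opposite] using this

/-- The defining property of maximum adjacency orderings: a vertex outside `A` that is separated
by `C` from the last vertex of `A` has few neighbours in `A`. -/
def AdjacencyBound (w : ℕ → ℕ → ℕ) (S A : Finset ℕ) (last : ℕ) : Prop :=
  ∀ C : Finset ℕ, ∀ x ∈ S, x ∉ A → ¬ (x ∈ C ↔ last ∈ C) →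
    ∑ y ∈ A, w x y ≤ weight w (insert x A) C

theorem adjacencyBound_singleton {S : Finset ℕ} (hw : ∀ x ∈ S, ∀ y ∈ S, w x y = w y x) {v : ℕ}
    (hv : v ∈ S) : AdjacencyBound w S {v} v := by
  intro C x hxS hx hxv
  rw [weight_insert (fun y hy => hw x hxS y (by rwa [Finset.mem_singleton.1 hy])) C hx,
    Finset.sum_singleton]
  have := le_opposite (w := w) (Finset.mem_singleton_self v) hxv
  omega

/-- Induction step of Stoer and Wagner. The cut on `A`, `v` and `x` is bounded by applying the old
bound to `v` or to `x`, whichever is separated from `last`, and then adding the other one, which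
contributes at least the weight between `v` and `x`. -/
theorem AdjacencyBound.insert {S A : Finset ℕ} (hw : ∀ x ∈ S, ∀ y ∈ S, w x y = w y x)
    (hAS : A ⊆ S) {last v : ℕ} (h : AdjacencyBound w S A last) (hvS : v ∈ S) (hv : v ∉ A)
    (hmax : ∀ x ∈ S, x ∉ A → ∑ y ∈ A, w x y ≤ ∑ y ∈ A, w v y) :
    AdjacencyBound w S (Insert.insert v A) v := by
  intro C x hxS hx hxv
  have hxA : x ∉ A := fun h => hx (Finset.mem_insert_of_mem h)
  have hne : v ≠ x := by
    rintro rfl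
    exact hxv Iff.rfl
  rw [Finset.sum_insert hv]
  by_cases hxl : x ∈ C ↔ last ∈ C
  -- Here the old bound is only available for `v`; it serves for `x` because `v` has maximal weight
  -- to `A`.
  · have hvl : ¬ (v ∈ C ↔ last ∈ C) := by tauto
    have h1 := h C v hvS hv hvl
    have h2 := hmax x hxS hxA
    have h3 := le_opposite (w := w) (Finset.mem_insert_self v A) hxv
    have h4 : ∀ y ∈ Insert.insert v A, w x y = w y x := fun y hy => by
      refine hw x hxS y ?_
      rcases Finset.mem_insert.1 hy with rfl | hy
      exacts [hvS, hAS hy]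
    rw [weight_insert h4 C hx]
    omega
  · have h1 := h C x hxS hxA hxl
    have hvx : v ∉ Insert.insert x A := by simp [hne, hv]
    have hvx' : ¬ (v ∈ C ↔ x ∈ C) := by tauto
    have h3 := le_opposite (w := w) (Finset.mem_insert_self x A) hvx'
    have h4 : ∀ y ∈ Insert.insert x A, w v y = w y v := fun y hy => by
      refine hw v hvS y ?_
      rcases Finset.mem_insert.1 hy with rfl | hy
      exacts [hxS, hAS hy]
    rw [Finset.insert_comm, weight_insert h4 C hvx]
    rw [hw v hvS x hxS] at h3
    omega

theorem weight_congr {w' : ℕ → ℕ → ℕ} {A C C' : Finset ℕ}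
    (hw : ∀ x ∈ A, ∀ y ∈ A, x ≠ y → w x y = w' x y) (hC : ∀ x ∈ A, x ∈ C ↔ x ∈ C') :
    weight w A C = weight w' A C' := by
  refine Finset.sum_congr rfl fun x hx => Finset.sum_congr rfl fun y hy => ?_
  by_cases hxy : x = y
  · subst hxy
    rw [if_neg (by tauto), if_neg (by tauto)]
  · simp only [hC x hx, hC y hy, hw x hx y hy hxy]

/-- Merging the vertex `t` into `s` preserves the cuts that do not separate `s` and `t`. -/
theorem weight_merge {w' : ℕ → ℕ → ℕ} {A : Finset ℕ} (hw : ∀ x ∈ A, ∀ y ∈ A, w x y = w y x)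
    (hw' : ∀ x ∈ A, ∀ y ∈ A, w' x y = w' y x) {s t : ℕ} (hs : s ∈ A) (ht : t ∈ A) (hst : s ≠ t)
    (h1 : ∀ y ∈ A, y ≠ s → y ≠ t → w' s y = w s y + w t y)
    (h2 : ∀ x ∈ A, ∀ y ∈ A, x ≠ s → x ≠ t → y ≠ s → y ≠ t → w' x y = w x y)
    {C : Finset ℕ} (hC : s ∈ C ↔ t ∈ C) : weight w A C = weight w' (A.erase t) C := by
  obtain ⟨B, hBs, hBt, rfl⟩ : ∃ B : Finset ℕ, s ∉ B ∧ t ∉ B ∧ A = insert t (insert s B) := by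
    refine ⟨(A.erase t).erase s, by simp, by simp, ?_⟩
    rw [Finset.insert_erase (by simp [hs, hst]), Finset.insert_erase ht]
  have ht' : t ∉ insert s B := by simp [hBt, hst.symm]
  rw [Finset.erase_insert ht', weight_insert (fun y hy => hw t ht y (by simp [hy])) C ht',
    weight_insert (fun y hy => hw s hs y (by simp [hy])) C hBs,
    weight_insert (fun y hy => hw' s hs y (by simp [hy])) C hBs]
  have e1 : weight w B C = weight w' B C := by
    refine weight_congr (fun x hx y hy _ => ?_) fun _ _ => Iff.rfl
    refine (h2 x (by simp [hx]) y (by simp [hy]) ?_ ?_ ?_ ?_).symm <;> rintro rfl <;> tauto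
  have e2 : opposite w' B C s = opposite w B C s + opposite w B C t := by
    simp only [opposite]
    rw [← Finset.sum_add_distrib]
    refine Finset.sum_congr rfl fun y hy => ?_
    have := h1 y (by simp [hy]) (by rintro rfl; tauto) (by rintro rfl; tauto)
    by_cases h : t ∈ C ↔ y ∈ C
    · simp [hC, h]
    · simp [hC, h, this]
  have e3 : opposite w (insert s B) C t = opposite w B C t := by
    simp only [opposite]
    rw [Finset.sum_insert hBs, if_pos hC.symm, zero_add]
  omega

/-- Cuts separating `s` from `t` are all bounded below by the degree of `t`, which `{t}` attains;
the other cuts are those of the graph after merging. -/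
theorem connected_merge {w' : ℕ → ℕ → ℕ} {A : Finset ℕ}
    (hw : ∀ x ∈ A, ∀ y ∈ A, w x y = w y x) (hw' : ∀ x ∈ A, ∀ y ∈ A, w' x y = w' y x)
    {s t lam : ℕ} (hs : s ∈ A) (ht : t ∈ A) (hst : s ≠ t)
    (h1 : ∀ y ∈ A, y ≠ s → y ≠ t → w' s y = w s y + w t y)
    (h2 : ∀ x ∈ A, ∀ y ∈ A, x ≠ s → x ≠ t → y ≠ s → y ≠ t → w' x y = w x y)
    (hcut : ∀ C : Finset ℕ, ¬ (t ∈ C ↔ s ∈ C) → ∑ y ∈ A.erase t, w t y ≤ weight w A C) :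
    Connected w A lam ↔ lam ≤ ∑ y ∈ A.erase t, w t y ∧ Connected w' (A.erase t) lam := by
  constructor
  · intro h
    constructor
    · have h3 := h {t} ⟨t, ht, by simp⟩ ⟨s, hs, by simp [hst]⟩
      have h4 : weight w A {t} = ∑ y ∈ A.erase t, w t y := by
        rw [weight, ← Finset.sum_erase_add _ _ ht, Finset.sum_eq_zero, zero_add,
          ← Finset.sum_erase_add _ _ ht]
        · simp only [Finset.mem_singleton, true_and, not_true_eq_false, if_false, add_zero]
          refine Finset.sum_congr rfl fun y hy => ?_
          simp [Finset.ne_of_mem_erase hy]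
        · intro x hx
          refine Finset.sum_eq_zero fun y _ => ?_
          simp [Finset.ne_of_mem_erase hx]
      omega
    · intro C hC hC'
      -- A cut of the merged graph is lifted by putting `t` on the side of `s`.
      set C' := if s ∈ C then insert t C else C.erase t with hCC'
      have hmem : ∀ x, x ≠ t → (x ∈ C' ↔ x ∈ C) := by
        intro x hx
        rw [hCC']
        split <;> simp [hx]
      have hst' : s ∈ C' ↔ t ∈ C' := by
        rw [hmem s hst, hCC']
        split <;> simp [*]
      have h3 : weight w' (A.erase t) C = weight w A C' := by
        rw [weight_merge hw hw' hs ht hst h1 h2 hst']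
        exact weight_congr (fun _ _ _ _ _ => rfl)
          fun x hx => (hmem x (Finset.ne_of_mem_erase hx)).symm
      rw [h3]
      obtain ⟨x, hx, hxC⟩ := hC
      obtain ⟨y, hy, hyC⟩ := hC'
      rw [Finset.mem_erase] at hx hy
      exact h C' ⟨x, hx.2, (hmem x hx.1).2 hxC⟩ ⟨y, hy.2, fun h => hyC ((hmem y hy.1).1 h)⟩
  · rintro ⟨h3, h4⟩ C hC hC'
    by_cases hC'' : s ∈ C ↔ t ∈ C
    · rw [weight_merge hw hw' hs ht hst h1 h2 hC'']
      have aux : ∀ p : ℕ → Prop, (p s ↔ p t) → (∃ x ∈ A, p x) → ∃ x ∈ A.erase t, p x := by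
        rintro p hp ⟨x, hx, hpx⟩
        by_cases hxt : x = t
        · subst hxt
          exact ⟨s, by simp [hs, hst], hp.2 hpx⟩
        · exact ⟨x, by simp [hx, hxt], hpx⟩
      exact h4 C (aux _ hC'' hC) (aux _ (not_congr hC'') hC')
    · exact h3.trans (hcut C (by tauto))

end MinCut

/-! ### A program that tests connectivity -/

namespace MinCut

/-- The invariant of the computation of a maximum adjacency ordering of `S`: `A` is the set of the
vertices chosen so far, `prev` and `last` are the last two of them, `avail` is `0` at the vertices
that can be chosen next, and `key` gives their total weight to `A`. -/
structure OrderInvariant (n : ℕ) (S : Finset ℕ) (w : ℕ → ℕ → ℕ) (A : Finset ℕ)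
    (avail key : ℕ → ℕ) (prev last : ℕ) : Prop where
  subset : A ⊆ S
  avail_iff : ∀ v < n, avail v = 0 ↔ v ∈ S ∧ v ∉ A
  key_eq : ∀ v ∈ S, v ∉ A → key v = ∑ y ∈ A, w v y
  cases : (A = ∅ ∧ prev = n ∧ last = n) ∨ last ∈ A ∧ AdjacencyBound w S A last ∧
    (A = {last} ∧ prev = n ∨ prev ∈ A ∧ prev ≠ last ∧
      key last = ∑ y ∈ A.erase last, w last y ∧
      ∀ C : Finset ℕ, ¬ (last ∈ C ↔ prev ∈ C) → key last ≤ weight w A C)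

/-- Applied to the new vertex `v` itself, the adjacency bound says that every cut between `v` and
the previous vertex weighs at least `key v`. This is the property that makes merging these two safe.
-/
theorem OrderInvariant.step {n : ℕ} {S : Finset ℕ} {w : ℕ → ℕ → ℕ} {A : Finset ℕ}
    {avail key avail' key' : ℕ → ℕ} {prev last v : ℕ}
    (h : OrderInvariant n S w A avail key prev last)
    (hS : S ⊆ Finset.range n) (hw : ∀ x ∈ S, ∀ y ∈ S, w x y = w y x)
    (hv : v < n) (hva : avail v = 0) (hmax : ∀ x < n, avail x = 0 → key x ≤ key v)
    (havail : ∀ x < n, avail' x = if x = v then 1 else avail x)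
    (hkey : ∀ x < n, key' x = if avail' x = 0 then key x + w v x else key x) :
    OrderInvariant n S w (insert v A) avail' key' last v := by
  obtain ⟨hvS, hvA⟩ := (h.avail_iff v hv).1 hva
  have hlt : ∀ x ∈ S, x < n := fun x hx => Finset.mem_range.1 (hS hx)
  have hav' : ∀ x < n, avail' x = 0 ↔ x ∈ S ∧ x ∉ insert v A := by
    intro x hx
    rw [havail x hx, Finset.mem_insert]
    by_cases hxv : x = v
    · simp [hxv]
    · simp [hxv, h.avail_iff x hx]
  -- `v` is no longer available, so its key stays frozen at its weight to the earlier vertices.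
  have hkv : key' v = ∑ y ∈ A, w v y := by
    rw [hkey v hv, if_neg, h.key_eq v hvS hvA]
    simp [havail v hv]
  have hmax' : ∀ x ∈ S, x ∉ A → ∑ y ∈ A, w x y ≤ ∑ y ∈ A, w v y := by
    intro x hx hxA
    rw [← h.key_eq x hx hxA, ← h.key_eq v hvS hvA]
    exact hmax x (hlt x hx) ((h.avail_iff x (hlt x hx)).2 ⟨hx, hxA⟩)
  refine ⟨Finset.insert_subset hvS h.subset, hav', ?_, Or.inr ⟨by simp, ?_, ?_⟩⟩
  · intro x hx hxA
    rw [hkey x (hlt x hx), if_pos ((hav' x (hlt x hx)).2 ⟨hx, hxA⟩), Finset.sum_insert hvA,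
      h.key_eq x hx (fun h => hxA (Finset.mem_insert_of_mem h)), hw v hvS x hx, add_comm]
  · rcases h.cases with ⟨rfl, -, -⟩ | ⟨hl, hb, -⟩
    · exact adjacencyBound_singleton hw hvS
    · exact hb.insert hw h.subset hvS hvA hmax'
  · rcases h.cases with ⟨rfl, -, hl⟩ | ⟨hl, hb, -⟩
    · exact Or.inl ⟨rfl, hl⟩
    · refine Or.inr ⟨by simp [hl], fun hlv => hvA (hlv ▸ hl), ?_, ?_⟩
      · rw [hkv, Finset.erase_insert hvA]
      · intro C hC
        rw [hkv]
        exact hb C v hvS hvA hC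

end MinCut

namespace RAM

namespace LoopProgram

infixr:60 ";;" => LoopProgram.seq

open RAM.Expr in
/-- Register `7` gets an available vertex with maximal key, or the content of register `0` if there
is none.  Row `1` of table `5` is `0` at the available vertices, row `2` holds the keys. -/
def pickVertex : LoopProgram :=
  .setReg 7 (reg 0) ;;
  .forLoop 6 (.ite
    (.and (eq (tab 5 (const 1) (reg 6)) (const 0))
      (add (eq (reg 7) (reg 0)) (lt (tab 5 (const 2) (reg 7)) (tab 5 (const 2) (reg 6)))))
    (.setReg 7 (reg 6)) .skip)

open RAM.Expr in
/-- Append the vertex in register `7` to the ordering; registers `8` and `9` hold the last two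
vertices, table `4` the weights. -/
def appendVertex : LoopProgram :=
  .setReg 8 (reg 9) ;;
  .setReg 9 (reg 7) ;;
  .setTab 5 (const 1) (reg 7) (const 1) ;;
  .forLoop 6 (.ite (eq (tab 5 (const 1) (reg 6)) (const 0))
    (.setTab 5 (const 2) (reg 6) (add (tab 5 (const 2) (reg 6)) (tab 4 (reg 7) (reg 6)))) .skip)

open RAM.Expr in
/-- Compute a maximum adjacency ordering of the vertices where row `0` of table `5` is `0`. -/
def orderVertices : LoopProgram :=
  .forLoop 6 (.setTab 5 (const 1) (reg 6) (tab 5 (const 0) (reg 6)) ;;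
    .setTab 5 (const 2) (reg 6) (const 0)) ;;
  .setReg 8 (reg 0) ;;
  .setReg 9 (reg 0) ;;
  .forLoop 5 (pickVertex ;; .ite (lt (reg 7) (reg 0)) appendVertex .skip)

open RAM.Expr in
/-- Merge the vertex in register `9` into the one in register `8`. -/
def mergeVertices : LoopProgram :=
  .ite (lt (tab 5 (const 2) (reg 9)) (reg 1)) (.setReg 3 (const 0)) .skip ;;
  .forLoop 6 (.setTab 4 (reg 8) (reg 6) (add (tab 4 (reg 8) (reg 6)) (tab 4 (reg 9) (reg 6))) ;;
    .setTab 4 (reg 6) (reg 8) (tab 4 (reg 8) (reg 6))) ;;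
  .setTab 5 (const 0) (reg 9) (const 1)

open RAM.Expr in
/-- Set register `3` to `1` if all cuts of the graph with the weights in table `4` have weight at
least the content of register `1`, and to `0` otherwise. -/
def testConnectivity : LoopProgram :=
  .setReg 3 (const 1) ;;
  .forLoop 6 (.setTab 5 (const 0) (reg 6) (const 0)) ;;
  .forLoop 4 (orderVertices ;; .ite (lt (reg 8) (reg 0)) mergeVertices .skip)

theorem exec_skip (s : Memory) : skip.exec s = s := rfl

theorem exec_setReg (r : ℕ) (x : Expr) (s : Memory) :
    (setReg r x).exec s = s.setReg r (x.eval s) := rfl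

theorem exec_setTab (a : ℕ) (i j x : Expr) (s : Memory) :
    (setTab a i j x).exec s = s.setTab a (i.eval s) (j.eval s) (x.eval s) := rfl

theorem exec_seq (P Q : LoopProgram) (s : Memory) : (P ;; Q).exec s = Q.exec (P.exec s) := rfl

theorem exec_ite (x : Expr) (P Q : LoopProgram) (s : Memory) :
    (ite x P Q).exec s = if x.eval s ≠ 0 then P.exec s else Q.exec s := rfl

theorem pickVertex_spec {s m : Memory} (hm : pickVertex.exec s = m) :
    (m.reg 7 = s.reg 0 ∧ ∀ v < s.reg 0, s.tab 5 1 v ≠ 0) ∨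
    (m.reg 7 < s.reg 0 ∧ s.tab 5 1 (m.reg 7) = 0 ∧
      ∀ v < s.reg 0, s.tab 5 1 v = 0 → s.tab 5 2 v ≤ s.tab 5 2 (m.reg 7)) := by
  rw [pickVertex, exec_seq, exec_setReg] at hm
  have key := exec_forLoop (by decide) (by decide) hm
    (fun i m => m.tab = s.tab ∧ ((m.reg 7 = s.reg 0 ∧ ∀ v < i, s.tab 5 1 v ≠ 0) ∨
      (m.reg 7 < s.reg 0 ∧ s.tab 5 1 (m.reg 7) = 0 ∧
      ∀ v < i, s.tab 5 1 v = 0 → s.tab 5 2 v ≤ s.tab 5 2 (m.reg 7)))) (by simp) ?_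
  · simpa using key.2
  · rintro i m hi h6 h0 ⟨htab, hI⟩
    simp only [Memory.setReg_reg, Expr.eval_reg, OfNat.zero_ne_ofNat, if_false] at hi h0
    rw [exec_ite]
    split_ifs with hc <;>
    simp only [Expr.eval_and_ne_zero, Expr.eval_eq_ne_zero, Expr.eval_add_ne_zero,
        Expr.eval_lt_ne_zero, Expr.eval_tab, Expr.eval_const, Expr.eval_reg, h6, h0, htab] at hc
    · refine ⟨by simp [exec_setReg, htab], Or.inr ?_⟩
      have h7 : (((setReg 7 (.reg 6)).exec m).setReg 6 (i + 1)).reg 7 = i := by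
        simp [exec_setReg, h6]
      rw [h7]
      refine ⟨hi, hc.1, fun v hv hv0 => ?_⟩
      rcases Nat.lt_or_eq_of_le (Nat.le_of_lt_succ hv) with hv | rfl
      · rcases hI with ⟨h7, hI⟩ | ⟨h7, h7', hI⟩
        · exact absurd hv0 (hI v hv)
        · have := hI v hv hv0
          rcases hc.2 with h | h <;> omega
      · exact le_rfl
    · refine ⟨by simp [exec_skip, htab], ?_⟩
      have h7s : ((skip.exec m).setReg 6 (i + 1)).reg 7 = m.reg 7 := by simp [exec_skip]
      rw [h7s]
      rcases hI with ⟨h7, hI⟩ | ⟨h7, h7', hI⟩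
      · refine Or.inl ⟨h7, fun v hv hv0 => ?_⟩
        rcases Nat.lt_or_eq_of_le (Nat.le_of_lt_succ hv) with hv | rfl
        · exact hI v hv hv0
        · exact hc ⟨hv0, Or.inl h7⟩
      · refine Or.inr ⟨h7, h7', fun v hv hv0 => ?_⟩
        rcases Nat.lt_or_eq_of_le (Nat.le_of_lt_succ hv) with hv | rfl
        · exact hI v hv hv0
        · by_contra hlt
          exact hc ⟨hv0, Or.inr (by omega)⟩

theorem appendVertex_spec {s m : Memory} (hm : appendVertex.exec s = m) :
    m.reg 8 = s.reg 9 ∧ m.reg 9 = s.reg 7 ∧ m.tab 5 0 = s.tab 5 0 ∧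
    (∀ x, m.tab 5 1 x = if x = s.reg 7 then 1 else s.tab 5 1 x) ∧
    ∀ x < s.reg 0, m.tab 5 2 x =
      if m.tab 5 1 x = 0 then s.tab 5 2 x + s.tab 4 (s.reg 7) x else s.tab 5 2 x := by
  rw [appendVertex, exec_seq, exec_seq, exec_seq, exec_setReg, exec_setReg, exec_setTab] at hm
  have key := exec_forLoop (by decide) (by decide) hm
    (fun i m => m.reg 7 = s.reg 7 ∧ m.reg 8 = s.reg 9 ∧ m.reg 9 = s.reg 7 ∧ m.tab 4 = s.tab 4 ∧
      m.tab 5 0 = s.tab 5 0 ∧ (∀ x, m.tab 5 1 x = if x = s.reg 7 then 1 else s.tab 5 1 x) ∧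
      ∀ x, m.tab 5 2 x =
        if x < i ∧ m.tab 5 1 x = 0 then s.tab 5 2 x + s.tab 4 (s.reg 7) x else s.tab 5 2 x) ?_ ?_
  · obtain ⟨-, h8, h9, -, hr0, hr1, hr2⟩ := key
    refine ⟨h8, h9, hr0, hr1, fun x hx => ?_⟩
    rw [hr2 x]
    simp [hx]
  · refine ⟨by simp, by simp, by simp, ?_, ?_, ?_, ?_⟩
    · ext; simp
    · ext; simp
    · simp
    · simp
  · rintro i m hi h6 h0 ⟨h7, h8, h9, h4, hr0, hr1, hr2⟩
    rw [exec_ite]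
    split_ifs with hc <;>
    simp only [Expr.eval_eq_ne_zero, Expr.eval_tab, Expr.eval_const, Expr.eval_reg, h6] at hc
    · rw [exec_setTab]
      refine ⟨by simp [h7], by simp [h8], by simp [h9], ?_, ?_, ?_, ?_⟩
      · ext; simp [h4]
      · ext; simp [hr0]
      · simpa using hr1
      · intro x
        simp only [Memory.setReg_tab, Memory.setTab_tab, Expr.eval_add, Expr.eval_tab,
          Expr.eval_const, Expr.eval_reg, h6, h7, h4, hr2]
        by_cases hx : x = i
        · subst hx
          simp [hc]
        · have : x < i + 1 ↔ x < i := by omega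
          simp [hx, this]
    · rw [exec_skip]
      refine ⟨by simp [h7], by simp [h8], by simp [h9], by simp [h4], by simp [hr0],
        by simpa using hr1, ?_⟩
      intro x
      simp only [Memory.setReg_tab, hr2]
      by_cases hx : x = i
      · subst hx
        simp [hc]
      · have : x < i + 1 ↔ x < i := by omega
        simp [this]

/-- The vertices below `n` where `f` is `0`. -/
def zeros (n : ℕ) (f : ℕ → ℕ) : Finset ℕ := (Finset.range n).filter fun v => f v = 0

theorem mem_zeros {n : ℕ} {f : ℕ → ℕ} {v : ℕ} : v ∈ zeros n f ↔ v < n ∧ f v = 0 := by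
  simp [zeros]

theorem orderVertices_spec {s m : Memory} (hm : orderVertices.exec s = m)
    (hw : ∀ x < s.reg 0, ∀ y < s.reg 0, s.tab 4 x y = s.tab 4 y x) :
    m.tab 5 0 = s.tab 5 0 ∧ MinCut.OrderInvariant (s.reg 0) (zeros (s.reg 0) (s.tab 5 0))
      (s.tab 4) (zeros (s.reg 0) (s.tab 5 0)) (m.tab 5 1) (m.tab 5 2) (m.reg 8) (m.reg 9) := by
  set n := s.reg 0 with hn
  set S := zeros n (s.tab 5 0) with hS
  have hSn : S ⊆ Finset.range n := Finset.filter_subset _ _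
  have hwS : ∀ x ∈ S, ∀ y ∈ S, s.tab 4 x y = s.tab 4 y x := fun x hx y hy =>
    hw x (Finset.mem_range.1 (hSn hx)) y (Finset.mem_range.1 (hSn hy))
  rw [orderVertices, exec_seq] at hm
  generalize hm₁ : exec (forLoop 6 _) s = m₁ at hm
  have key₁ := exec_forLoop (by decide) (by decide) hm₁
    (fun i m => m.reg 0 = n ∧ m.tab 4 = s.tab 4 ∧ m.tab 5 0 = s.tab 5 0 ∧
      ∀ x < i, m.tab 5 1 x = s.tab 5 0 x ∧ m.tab 5 2 x = 0) (by simp [hn]) ?_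
  swap
  · rintro i m hi h6 h0 ⟨-, h4, hr0, hr⟩
    rw [exec_seq, exec_setTab, exec_setTab]
    refine ⟨by simp [h0, hn], ?_, ?_, ?_⟩
    · ext; simp [h4]
    · ext; simp [hr0]
    · intro x hx
      simp only [Memory.setReg_tab, Memory.setTab_tab, Expr.eval_tab, Memory.setTab_reg,
        Expr.eval_const, Expr.eval_reg, h6, hr0]
      by_cases hxi : x = i
      · simp [hxi]
      · simp [hxi, hr x (by omega)]
  obtain ⟨h0₁, h4₁, hr0₁, hr₁⟩ := key₁
  rw [exec_seq, exec_seq, exec_setReg, exec_setReg] at hm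
  -- Each round appends a vertex or finds `A = S`; since `S` has at most `n` elements, `n` rounds
  -- suffice.
  have key₂ := exec_forLoop (by decide) (by decide) hm
    (fun i m => m.reg 0 = n ∧ m.tab 4 = s.tab 4 ∧ m.tab 5 0 = s.tab 5 0 ∧
      ∃ A, (i ≤ A.card ∨ A = S) ∧ MinCut.OrderInvariant n S (s.tab 4) A (m.tab 5 1) (m.tab 5 2)
        (m.reg 8) (m.reg 9)) ?_ ?_
  · obtain ⟨-, -, hr0, A, hA, hI⟩ := key₂
    refine ⟨hr0, ?_⟩
    have hAS : A = S := by
      rcases hA with hA | hA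
      · refine Finset.eq_of_subset_of_card_le hI.subset ?_
        have := Finset.card_le_card hSn
        rw [Finset.card_range] at this
        simp [h0₁] at hA
        omega
      · exact hA
    rwa [hAS] at hI
  · refine ⟨by simp [h0₁], by simp [h4₁], by simp [hr0₁], ∅, by simp, by simp, ?_, ?_, ?_⟩
    · intro v hv
      simp [(hr₁ v hv).1, hS, mem_zeros, hv]
    · intro v hv _
      have hv' := Finset.mem_range.1 (hSn hv)
      simp [(hr₁ v hv').2]
    · simp [h0₁]
  · rintro i m hi h5 h0 ⟨h0', h4, hr0, A, hA, hI⟩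
    clear h0 hm
    rw [exec_seq]
    generalize hm' : pickVertex.exec m = m'
    have hp := pickVertex_spec hm'
    have f0 : m'.reg 0 = n := by rw [← hm', exec_reg (by decide), h0']
    have f8 : m'.reg 8 = m.reg 8 := by rw [← hm', exec_reg (by decide)]
    have f9 : m'.reg 9 = m.reg 9 := by rw [← hm', exec_reg (by decide)]
    have f4 : m'.tab 4 = s.tab 4 := by rw [← hm', exec_tab (by decide), h4]
    have f5 : m'.tab 5 = m.tab 5 := by rw [← hm', exec_tab (by decide)]
    rw [h0'] at hp
    rw [exec_ite]
    split_ifs with hc <;>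
    simp only [Expr.eval_lt_ne_zero, Expr.eval_reg, f0] at hc
    · generalize hm'' : appendVertex.exec m' = m''
      obtain ⟨a8, a9, ar0, ar1, ar2⟩ := appendVertex_spec hm''
      have g0 : m''.reg 0 = n := by rw [← hm'', exec_reg (by decide), f0]
      have g4 : m''.tab 4 = s.tab 4 := by rw [← hm'', exec_tab (by decide), f4]
      rcases hp with ⟨hp, -⟩ | ⟨hp1, hp2, hp3⟩
      · omega
      refine ⟨by simp [g0], by simp [g4], by simp [ar0, f5, hr0], insert (m'.reg 7) A, ?_, ?_⟩
      · have hvA := ((hI.avail_iff _ hp1).1 hp2).2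
        left
        rw [Finset.card_insert_of_notMem hvA]
        rcases hA with hA | hA
        · omega
        · subst hA
          exact absurd ((hI.avail_iff _ hp1).1 hp2).1 hvA
      · simp only [Memory.setReg_tab, Memory.setReg_reg]
        norm_num
        rw [a8, a9, f9]
        refine hI.step hSn hwS hp1 hp2 hp3 (fun x _ => ?_) fun x hx => ?_
        · rw [ar1, f5]
        · rw [ar2 x (by omega), f4, f5]
    · rw [exec_skip]
      refine ⟨by simp [f0], by simp [f4], by simp [f5, hr0], A, ?_, ?_⟩
      · right
        refine Finset.Subset.antisymm hI.subset fun v hv => ?_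
        by_contra hvA
        have hvn := Finset.mem_range.1 (hSn hv)
        rcases hp with ⟨-, hp⟩ | ⟨hp, -⟩
        · exact hp v hvn ((hI.avail_iff v hvn).2 ⟨hv, hvA⟩)
        · exact hc hp
      · simp only [Memory.setReg_tab, Memory.setReg_reg]
        norm_num
        rwa [f8, f9, f5]

/-- The diagonal entry of the merged vertex is left unspecified; no cut counts it. -/
theorem mergeVertices_spec {s m : Memory} (hm : mergeVertices.exec s = m)
    (h89 : s.reg 8 ≠ s.reg 9) :
    m.reg 3 = (if s.tab 5 2 (s.reg 9) < s.reg 1 then 0 else s.reg 3) ∧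
    (∀ x, m.tab 5 0 x = if x = s.reg 9 then 1 else s.tab 5 0 x) ∧
    (∀ x y, x ≠ s.reg 8 → y ≠ s.reg 8 → m.tab 4 x y = s.tab 4 x y) ∧
    (∀ y < s.reg 0, y ≠ s.reg 8 →
      m.tab 4 (s.reg 8) y = s.tab 4 (s.reg 8) y + s.tab 4 (s.reg 9) y) ∧
    ∀ y < s.reg 0, m.tab 4 y (s.reg 8) = m.tab 4 (s.reg 8) y := by
  rw [mergeVertices, exec_seq, exec_seq] at hm
  generalize hm₁ : exec (ite _ _ _) s = m₁ at hm
  have h3 : m₁.reg 3 = if s.tab 5 2 (s.reg 9) < s.reg 1 then 0 else s.reg 3 := by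
    rw [← hm₁, exec_ite]
    simp only [Expr.eval_lt_ne_zero, Expr.eval_tab, Expr.eval_const, Expr.eval_reg]
    split_ifs <;> simp [exec_setReg, exec_skip]
  have h0 : m₁.reg 0 = s.reg 0 := by rw [← hm₁, exec_reg (by decide)]
  have h8 : m₁.reg 8 = s.reg 8 := by rw [← hm₁, exec_reg (by decide)]
  have h9 : m₁.reg 9 = s.reg 9 := by rw [← hm₁, exec_reg (by decide)]
  have h4 : m₁.tab 4 = s.tab 4 := by rw [← hm₁, exec_tab (by decide)]
  have h5 : m₁.tab 5 = s.tab 5 := by rw [← hm₁, exec_tab (by decide)]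
  generalize hm₂ : exec (forLoop 6 _) m₁ = m₂ at hm
  have key := exec_forLoop (by decide) (by decide) hm₂
    (fun i m => m.reg 8 = s.reg 8 ∧ m.reg 9 = s.reg 9 ∧
      (∀ x y, x ≠ s.reg 8 → y ≠ s.reg 8 → m.tab 4 x y = s.tab 4 x y) ∧
      (∀ y, y ≠ s.reg 8 → m.tab 4 (s.reg 8) y =
        if y < i then s.tab 4 (s.reg 8) y + s.tab 4 (s.reg 9) y else s.tab 4 (s.reg 8) y) ∧
      ∀ y < i, m.tab 4 y (s.reg 8) = m.tab 4 (s.reg 8) y) (by simp [h8, h9, h4]) ?_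
  swap
  · rintro i m hi g6 - ⟨g8, g9, hu, hp, hsym⟩
    rw [exec_seq, exec_setTab, exec_setTab]
    refine ⟨by simp [g8], by simp [g9], ?_, ?_, ?_⟩
    · intro x y hx hy
      simp [g6, g8, hx, hy, hu]
    · intro y hy
      simp only [Memory.setReg_tab, Memory.setTab_tab, Memory.setTab_reg, Expr.eval_add,
        Expr.eval_tab, Expr.eval_reg, g6, g8, g9, hy, and_false, if_false, true_and]
      by_cases hyi : y = i
      · subst hyi
        simp [hp y hy, hu (s.reg 9) y h89.symm hy]
      · have : y < i + 1 ↔ y < i := by omega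
        simp [hyi, hp y hy, this]
    · intro y hy
      simp only [Memory.setReg_tab, Memory.setTab_tab, Memory.setTab_reg, Expr.eval_add,
        Expr.eval_tab, Expr.eval_reg, g6, g8, g9, true_and, and_true]
      by_cases hyi : y = i
      · subst hyi
        simp
      · have hy' := hsym y (by omega)
        by_cases hy8 : y = s.reg 8
        · simp [hy8]
        · simp [hyi, hy8, hy']
  obtain ⟨g8, g9, hu, hp, hsym⟩ := key
  rw [exec_setTab] at hm
  subst hm
  have g3 : m₂.reg 3 = m₁.reg 3 := by rw [← hm₂, exec_reg (by decide)]
  have g5 : m₂.tab 5 = m₁.tab 5 := by rw [← hm₂, exec_tab (by decide)]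
  refine ⟨by simp [g3, h3], fun x => by simp [g9, g5, h5], fun x y hx hy => by simp [hu x y hx hy],
    fun y hy hy8 => ?_, fun y hy => ?_⟩
  · simp [hp y hy8, h0, hy]
  · simpa using hsym y (by omega)

theorem testConnectivity_spec {s m : Memory} (hm : testConnectivity.exec s = m)
    (hw : ∀ x < s.reg 0, ∀ y < s.reg 0, s.tab 4 x y = s.tab 4 y x) :
    m.reg 3 ≤ 1 ∧
      (m.reg 3 = 1 ↔ MinCut.Connected (s.tab 4) (Finset.range (s.reg 0)) (s.reg 1)) := by
  set n := s.reg 0 with hn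
  set lam := s.reg 1 with hlam
  rw [testConnectivity, exec_seq, exec_seq, exec_setReg] at hm
  generalize hm₁ : exec (forLoop 6 _) _ = m₁ at hm
  have key₁ := exec_forLoop (by decide) (by decide) hm₁
    (fun i m => ∀ x < i, m.tab 5 0 x = 0) (by simp) ?_
  swap
  · rintro i m hi h6 - h
    intro x hx
    simp only [exec_setTab, Memory.setReg_tab, Memory.setTab_tab, Expr.eval_reg, h6,
      Expr.eval_const, true_and]
    by_cases hxi : x = i
    · simp [hxi]
    · simp [hxi, h x (by omega)]
  have a0 : m₁.reg 0 = n := by rw [← hm₁, exec_reg (by decide)]; simp [hn]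
  have a1 : m₁.reg 1 = lam := by rw [← hm₁, exec_reg (by decide)]; simp [hlam]
  have a3 : m₁.reg 3 = 1 := by rw [← hm₁, exec_reg (by decide)]; simp
  have a4 : m₁.tab 4 = s.tab 4 := by rw [← hm₁, exec_tab (by decide)]; simp
  have aS : zeros n (m₁.tab 5 0) = Finset.range n := by
    ext v
    rw [mem_zeros, Finset.mem_range]
    simp only [Memory.setReg_reg, OfNat.zero_ne_ofNat, if_false, ← hn] at key₁
    exact ⟨fun h => h.1, fun h => ⟨h, key₁ v h⟩⟩
  -- Each round removes one vertex while at least two remain. After `n` rounds at most one is left,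
  -- where connectivity is vacuous, so register `3` holds the whole answer.
  have key₂ := exec_forLoop (by decide) (by decide) hm
    (fun i m => m.reg 0 = n ∧ m.reg 1 = lam ∧
      (∀ x < n, ∀ y < n, m.tab 4 x y = m.tab 4 y x) ∧
      ((zeros n (m.tab 5 0)).card + i ≤ n ∨ (zeros n (m.tab 5 0)).card ≤ 1) ∧ m.reg 3 ≤ 1 ∧
      (MinCut.Connected (s.tab 4) (Finset.range n) lam ↔
        m.reg 3 = 1 ∧ MinCut.Connected (m.tab 4) (zeros n (m.tab 5 0)) lam)) ?_ ?_
  · obtain ⟨-, -, -, hcard, h3, hiff⟩ := key₂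
    rw [hiff]
    refine ⟨h3, fun h => ⟨h, ?_⟩, fun h => h.1⟩
    have hcard' : (zeros n (m.tab 5 0)).card ≤ 1 := by omega
    rw [Finset.card_le_one] at hcard'
    rintro C ⟨x, hx, hxC⟩ ⟨y, hy, hyC⟩
    exact absurd (hcard' x hx y hy ▸ hxC) hyC
  · simp only [Memory.setReg_reg, Memory.setReg_tab]
    norm_num
    rw [aS, a4]
    exact ⟨a0, a1, hw, by simp, by omega, by simp [a3]⟩
  · rintro i m hi h4 - ⟨h0, h1, hsym, hcard, h3, hiff⟩
    clear hm
    rw [exec_seq]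
    generalize hm' : orderVertices.exec m = m'
    obtain ⟨o5, hO⟩ := orderVertices_spec hm' (by rwa [h0])
    rw [h0] at hO
    set S := zeros n (m.tab 5 0) with hS
    have hSn : ∀ x ∈ S, x < n := fun x hx => (mem_zeros.1 hx).1
    have f0 : m'.reg 0 = n := by rw [← hm', exec_reg (by decide), h0]
    have f1 : m'.reg 1 = lam := by rw [← hm', exec_reg (by decide), h1]
    have f3 : m'.reg 3 = m.reg 3 := by rw [← hm', exec_reg (by decide)]
    have f4 : m'.tab 4 = m.tab 4 := by rw [← hm', exec_tab (by decide)]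
    rw [exec_ite]
    split_ifs with hc <;> simp only [Expr.eval_lt_ne_zero, Expr.eval_reg, f0] at hc
    · rcases hO.cases with ⟨-, h8, -⟩ | ⟨hl, -, ⟨-, h8⟩ | ⟨hp, hpl, hkey, hcut⟩⟩
      · omega
      · omega
      generalize hm'' : mergeVertices.exec m' = m''
      obtain ⟨g3, g5, gu, gp, gs⟩ := mergeVertices_spec hm'' hpl
      have g0 : m''.reg 0 = n := by rw [← hm'', exec_reg (by decide), f0]
      have g1 : m''.reg 1 = lam := by rw [← hm'', exec_reg (by decide), f1]
      rw [f0] at gp gs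
      rw [f4] at gu gp
      rw [f3, f1] at g3
      have hS' : zeros n (m''.tab 5 0) = S.erase (m'.reg 9) := by
        ext v
        rw [Finset.mem_erase, hS, mem_zeros, mem_zeros, g5, o5]
        by_cases hv : v = m'.reg 9 <;> simp [hv]
      have hsym'' : ∀ x < n, ∀ y < n, m''.tab 4 x y = m''.tab 4 y x := by
        intro x hx y hy
        by_cases hx8 : x = m'.reg 8
        · rw [hx8, gs y hy]
        · by_cases hy8 : y = m'.reg 8
          · rw [hy8, gs x hx]
          · rw [gu x y hx8 hy8, gu y x hy8 hx8, hsym x hx y hy]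
      have hmerge := MinCut.connected_merge (lam := lam) (w := m.tab 4) (w' := m''.tab 4)
        (fun x hx y hy => hsym x (hSn x hx) y (hSn y hy))
        (fun x hx y hy => hsym'' x (hSn x hx) y (hSn y hy)) hp hl hpl
        (fun y hy hy8 _ => gp y (hSn y hy) hy8)
        (fun x _ y _ hx8 _ hy8 _ => gu x y hx8 hy8)
        (fun C hC => hkey ▸ hcut C hC)
      rw [← hkey, ← hS'] at hmerge
      simp only [Memory.setReg_reg, Memory.setReg_tab]
      norm_num
      refine ⟨g0, g1, hsym'', ?_, ?_, ?_⟩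
      · rw [hS', Finset.card_erase_of_mem hl]
        omega
      · rw [g3]
        split_ifs <;> omega
      · rw [hiff, hmerge, g3]
        split_ifs with hlt
        · simp
          omega
        · simp [not_lt.1 hlt]
    · rw [exec_skip]
      simp only [Memory.setReg_reg, Memory.setReg_tab]
      norm_num
      rw [f3, f4, o5]
      refine ⟨f0, f1, hsym, Or.inr ?_, h3, hiff⟩
      rcases hO.cases with ⟨h, -, -⟩ | ⟨hl, -, ⟨h, -⟩ | ⟨hp, -⟩⟩
      · rw [← hS, h]; simp
      · rw [← hS, h]; simp
      · exact absurd (hSn _ hp) hc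

end LoopProgram

end RAM

/-! ### Edge connectivity and cuts -/

namespace EdgeCut

/-- Deleting the boundary of `X` confines walks from `X` to `X`. Conversely, if deleting `s`
separates `v` from `u`, the vertices still reachable from `u` form a cut with boundary inside `s`.
-/
theorem isEdgeConnected_iff {V : Type*} [Fintype V] [DecidableEq V] {G : SimpleGraph V}
    {E : Finset (Sym2 V)} (hE : ∀ e, e ∈ E ↔ e ∈ G.edgeSet) {lam : ℕ} :
    G.IsEdgeConnected lam ↔ CutConnected E lam := by
  classical
  constructor
  · rintro h X ⟨x, hx⟩ hXu
    by_contra! hlt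
    obtain ⟨y, hy⟩ : ∃ y, y ∉ X := by
      by_contra! h
      exact hXu (Finset.eq_univ_iff_forall.2 h)
    have hr := @h x y (boundary E X : Set (Sym2 V))
      (by rw [Set.encard_coe_eq_coe_finsetCard]; exact_mod_cast hlt)
    rw [SimpleGraph.reachable_iff_reflTransGen] at hr
    have : ∀ z, Relation.ReflTransGen
        (G.deleteEdges (boundary E X : Set (Sym2 V))).Adj x z → z ∈ X := by
      intro z hz
      induction hz with
      | refl => exact hx
      | tail _ hbc ih =>
        by_contra hc
        rw [SimpleGraph.deleteEdges_adj] at hbc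
        refine hbc.2 (Finset.mem_coe.2 (mem_boundary.2 ⟨(hE _).2 hbc.1, ?_⟩))
        exact ⟨_, _, rfl, ih, hc⟩
    exact hy (this y hr)
  · intro h u v s hs
    by_contra hv
    set X : Finset V := Finset.univ.filter fun x => (G.deleteEdges s).Reachable u x with hX
    have h1 := h X ⟨u, by simp [hX]⟩ fun hu => by
      have := Finset.mem_univ v
      rw [← hu, hX, Finset.mem_filter] at this
      exact hv this.2
    have hsub : (boundary E X : Set (Sym2 V)) ⊆ s := by
      intro e he
      obtain ⟨heE, x, y, rfl, hx, hy⟩ := mem_boundary.1 (Finset.mem_coe.1 he)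
      by_contra hes
      simp only [hX, Finset.mem_filter, Finset.mem_univ, true_and] at hx hy
      refine hy (hx.trans (SimpleGraph.Adj.reachable ?_))
      rw [SimpleGraph.deleteEdges_adj]
      exact ⟨(hE _).1 heE, hes⟩
    have h2 := Set.encard_le_encard hsub
    rw [Set.encard_coe_eq_coe_finsetCard] at h2
    have h3 : ((boundary E X).card : ℕ∞) < lam := lt_of_le_of_lt h2 hs
    have h4 : (boundary E X).card < lam := by exact_mod_cast h3
    rw [cutDeg] at h1
    omega

/-- The table `t` is the adjacency matrix of the edge set `F`. -/
def IsMatrixOf {n : ℕ} (t : ℕ → ℕ → ℕ) (F : Set (Sym2 (Fin n))) : Prop :=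
  ∀ i j : Fin n, (s(i, j) ∈ F → t i j = 1) ∧ (s(i, j) ∉ F → t i j = 0)

/-- Each crossing edge is counted exactly once, oriented from inside `C` to outside. -/
theorem weight_eq_cutDeg {n : ℕ} {w : ℕ → ℕ → ℕ} {E : Finset (Sym2 (Fin n))}
    (hw : IsMatrixOf w (E : Set (Sym2 (Fin n)))) (C : Finset ℕ) :
    MinCut.weight w (Finset.range n) C =
      cutDeg E (Finset.univ.filter fun i : Fin n => (i : ℕ) ∈ C) := by
  classical
  set X : Finset (Fin n) := Finset.univ.filter fun i : Fin n => (i : ℕ) ∈ C with hX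
  have h1 : MinCut.weight w (Finset.range n) C =
      ((Finset.univ : Finset (Fin n × Fin n)).filter
        fun p => p.1 ∈ X ∧ p.2 ∉ X ∧ s(p.1, p.2) ∈ E).card := by
    rw [MinCut.weight, Finset.sum_range, Finset.card_filter, ← Finset.univ_product_univ,
      Finset.sum_product]
    refine Finset.sum_congr rfl fun i _ => ?_
    rw [Finset.sum_range]
    refine Finset.sum_congr rfl fun j _ => ?_
    have h2 := hw i j
    simp only [Finset.mem_coe] at h2
    by_cases hi : (i : ℕ) ∈ C <;> by_cases hj : (j : ℕ) ∈ C <;> by_cases he : s(i, j) ∈ E <;>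
      simp [hX, hi, hj, he, h2]
  rw [h1, cutDeg]
  refine Finset.card_nbij (fun p => s(p.1, p.2)) ?_ ?_ ?_
  · rintro ⟨x, y⟩ hp
    obtain ⟨-, hp⟩ := Finset.mem_filter.1 hp
    exact mem_boundary.2 ⟨hp.2.2, x, y, rfl, hp.1, hp.2.1⟩
  · rintro ⟨x, y⟩ hp ⟨x', y'⟩ hp' h
    obtain ⟨-, hp⟩ := Finset.mem_filter.1 hp
    obtain ⟨-, hp'⟩ := Finset.mem_filter.1 hp'
    rcases Sym2.eq_iff.1 h with ⟨rfl, rfl⟩ | ⟨rfl, rfl⟩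
    · rfl
    · exact absurd hp.1 hp'.2.1
  · intro e he
    obtain ⟨heE, x, y, rfl, hx, hy⟩ := mem_boundary.1 (Finset.mem_coe.1 he)
    exact ⟨(x, y), by simp [hx, hy, heE], rfl⟩

theorem cutConnected_iff_connected {n : ℕ} {w : ℕ → ℕ → ℕ} {E : Finset (Sym2 (Fin n))}
    (hw : IsMatrixOf w (E : Set (Sym2 (Fin n)))) {lam : ℕ} :
    CutConnected E lam ↔ MinCut.Connected w (Finset.range n) lam := by
  constructor
  · rintro h C ⟨x, hx, hxC⟩ ⟨y, hy, hyC⟩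
    rw [weight_eq_cutDeg hw]
    rw [Finset.mem_range] at hx hy
    refine h _ ⟨⟨x, hx⟩, by simpa using hxC⟩ fun hu => ?_
    have := Finset.mem_univ (⟨y, hy⟩ : Fin n)
    rw [← hu, Finset.mem_filter] at this
    exact hyC this.2
  · rintro h X ⟨x, hx⟩ hXu
    obtain ⟨y, hy⟩ : ∃ y, y ∉ X := by
      by_contra! h
      exact hXu (Finset.eq_univ_iff_forall.2 h)
    have hmem : ∀ i : Fin n, (i : ℕ) ∈ X.map Fin.valEmbedding ↔ i ∈ X := fun i =>
      Finset.mem_map' Fin.valEmbedding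
    have h1 := h (X.map Fin.valEmbedding) ⟨x, by simp, (hmem x).2 hx⟩
      ⟨y, by simp, fun h => hy ((hmem y).1 h)⟩
    rw [weight_eq_cutDeg hw] at h1
    convert h1 using 2
    ext i
    rw [Finset.mem_filter, hmem]
    simp

end EdgeCut

/-! ### Induction principles for nested loops -/

namespace RAM

namespace LoopProgram

/-- Induction along a double loop. -/
theorem exec_forLoop_forLoop {P : LoopProgram} {r r' : ℕ} (hr : P.writesReg r = false)
    (hr' : P.writesReg r' = false) (hne : r' ≠ r)
    (h0 : (forLoop r (forLoop r' P)).writesReg 0 = false)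
    {s m : Memory} (hm : (forLoop r (forLoop r' P)).exec s = m)
    (I : ℕ → ℕ → Memory → Prop) (hI : ∀ i j m x, I i j m → I i j (m.setReg r x))
    (hI' : ∀ i j m x, I i j m → I i j (m.setReg r' x)) (base : I 0 0 s)
    (step : ∀ i j m, i < s.reg 0 → j < s.reg 0 → m.reg r = i → m.reg r' = j →
      m.reg 0 = s.reg 0 → I i j m → I i (j + 1) (P.exec m))
    (carry : ∀ i m, i < s.reg 0 → I i (s.reg 0) m → I (i + 1) 0 m) : I (s.reg 0) 0 m := by
  have hw : (forLoop r' P).writesReg r = false := by simp [writesReg, hr, hne]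
  have h0' : (forLoop r' P).writesReg 0 = false := by
    rw [writesReg] at h0
    exact (Bool.or_eq_false_iff.1 h0).2
  refine exec_forLoop hw h0 hm (fun i m => I i 0 m) (hI _ _ _ _ base) ?_
  intro i m hi hmr hm0 hIm
  refine hI _ _ _ _ (carry i _ hi ?_)
  generalize hm' : (forLoop r' P).exec m = m'
  have := exec_forLoop hr' h0' hm' (fun j m => m.reg r = i ∧ I i j m)
    ⟨by simp [hne.symm, hmr], hI' _ _ _ _ hIm⟩ ?_
  · rw [hm0] at this
    exact this.2
  · rintro j m₁ hj hmr' hm0' ⟨hm₁, hIm₁⟩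
    refine ⟨by simp [hne.symm, exec_reg hr, hm₁], hI' _ _ _ _ ?_⟩
    exact step i j m₁ hi (by omega) hm₁ hmr' (by omega) hIm₁

/-- Nested loops with the given counters. -/
def forLoops (rs : List ℕ) (P : LoopProgram) : LoopProgram := rs.foldr forLoop P

/-- Nested loops that establish a persistent property for all values of the counters. -/
theorem exec_forLoops {P : LoopProgram} {rs : List ℕ} (hrs : rs.Nodup)
    (hw : ∀ r ∈ rs, P.writesReg r = false) (h0 : (forLoops rs P).writesReg 0 = false)
    {s m : Memory} (hm : (forLoops rs P).exec s = m)
    (I : Memory → Prop) (Q : List ℕ → Memory → Prop)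
    (hI : ∀ r ∈ rs, ∀ m x, I m → I (m.setReg r x))
    (hQ : ∀ r ∈ rs, ∀ τ m x, Q τ m → Q τ (m.setReg r x))
    (base : I s)
    (step : ∀ m, m.reg 0 = s.reg 0 → (∀ r ∈ rs, m.reg r < s.reg 0) → I m →
      I (P.exec m) ∧ Q (rs.map m.reg) (P.exec m) ∧ ∀ τ, Q τ m → Q τ (P.exec m)) :
    I m ∧ ∀ τ : List ℕ, τ.length = rs.length → (∀ x ∈ τ, x < s.reg 0) → Q τ m := by
  induction rs generalizing s m I Q with
  | nil =>
    subst hm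
    obtain ⟨h1, h2, -⟩ := step s rfl (by simp) base
    refine ⟨h1, fun τ hτ _ => ?_⟩
    rw [List.length_nil, List.length_eq_zero_iff] at hτ
    rw [hτ]
    exact h2
  | cons r rs ih =>
    rw [List.nodup_cons] at hrs
    have hwr : ∀ rs' : List ℕ, r ∉ rs' → (forLoops rs' P).writesReg r = false := by
      intro rs' hr
      induction rs' with
      | nil => exact hw r (by simp)
      | cons r' rs' ih' =>
        rw [List.mem_cons, not_or] at hr
        change (forLoop r' (forLoops rs' P)).writesReg r = false
        simp [writesReg, ih' hr.2, Ne.symm hr.1]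
    have h0' : (forLoops rs P).writesReg 0 = false := by
      change (forLoop r (forLoops rs P)).writesReg 0 = false at h0
      rw [writesReg] at h0
      exact (Bool.or_eq_false_iff.1 h0).2
    have key := exec_forLoop (hwr rs hrs.1) h0 hm
      (fun i m => I m ∧ ∀ x < i, ∀ τ : List ℕ, τ.length = rs.length →
        (∀ x ∈ τ, x < s.reg 0) → Q (x :: τ) m) ⟨hI r (by simp) _ _ base, by simp⟩ ?_
    · refine ⟨key.1, fun τ hτ hτn => ?_⟩
      cases τ with
      | nil => simp at hτ
      | cons x τ =>
        exact key.2 x (hτn x (by simp)) τ (by simpa using hτ) fun y hy => hτn y (by simp [hy])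
    · rintro i m₁ hi hmr hm0 ⟨hIm, hQm⟩
      generalize hm₂ : (forLoops rs P).exec m₁ = m₂
      -- For the inner loops the invariant also fixes the outer counter at `i` and preserves every
      -- `Q` established before this pass.
      have key' := ih hrs.2 (fun r' hr' => hw r' (by simp [hr'])) h0' hm₂
        (fun m => I m ∧ m.reg r = i ∧ ∀ τ, Q τ m₁ → Q τ m) (fun τ m => Q (i :: τ) m)
        (fun r' hr' m x h => ⟨hI r' (by simp [hr']) _ _ h.1, by
          have : r ≠ r' := by
            rintro rfl
            exact hrs.1 hr'
          simp [this, h.2.1], fun τ hτ => hQ r' (by simp [hr']) _ _ _ (h.2.2 τ hτ)⟩)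
        (fun r' hr' τ m x h => hQ r' (by simp [hr']) _ _ _ h)
        ⟨hIm, hmr, fun _ h => h⟩ ?_
      · obtain ⟨h1, h2⟩ := key'
        rw [hm0] at h2
        refine ⟨hI r (by simp) _ _ h1.1, fun x hx τ hτ hτn => hQ r (by simp) _ _ _ ?_⟩
        by_cases hxi : x = i
        · subst hxi
          exact h2 τ hτ hτn
        · exact h1.2.2 _ (hQm x (by omega) τ hτ hτn)
      · rintro m' h0m' hreg ⟨hIm', hrm', hQm'⟩
        rw [hm0] at h0m' hreg
        obtain ⟨a1, a2, a3⟩ := step m' h0m' (by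
          intro r' hr'
          rcases List.mem_cons.1 hr' with rfl | hr'
          · omega
          · exact hreg r' hr') hIm'
        refine ⟨⟨a1, by rw [exec_reg (hw r (by simp)), hrm'], fun τ hτ => a3 τ (hQm' τ hτ)⟩, ?_,
          fun τ hτ => a3 _ hτ⟩
        simpa [hrm'] using a2

end LoopProgram

end RAM

/-! ### The search for deletion sets and irrelevant edges -/

namespace EdgeCut

variable {n : ℕ}

theorem IsMatrixOf.ne_zero_iff {t : ℕ → ℕ → ℕ} {F : Set (Sym2 (Fin n))} (h : IsMatrixOf t F)
    (i j : Fin n) : t i j ≠ 0 ↔ s(i, j) ∈ F := by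
  by_cases hF : s(i, j) ∈ F
  · simp [hF, (h i j).1 hF]
  · simp [hF, (h i j).2 hF]

theorem IsMatrixOf.unique {t : ℕ → ℕ → ℕ} {F F' : Finset (Sym2 (Fin n))}
    (h : IsMatrixOf t (F : Set (Sym2 (Fin n)))) (h' : IsMatrixOf t (F' : Set (Sym2 (Fin n)))) :
    F = F' := by
  ext e
  induction e with
  | _ x y => rw [← Finset.mem_coe, ← h.ne_zero_iff, h'.ne_zero_iff, Finset.mem_coe]

theorem IsMatrixOf.congr {t t' : ℕ → ℕ → ℕ} {F : Set (Sym2 (Fin n))} (h : IsMatrixOf t F)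
    (ht : ∀ x < n, ∀ y < n, t' x y = t x y) : IsMatrixOf t' F := fun i j => by
  rw [ht i i.2 j j.2]
  exact h i j

/-- The edge set obtained from `F` by removing `a` and adding `b` and `c`. -/
def exchange (F : Finset (Sym2 (Fin n))) (a b c : Sym2 (Fin n)) : Finset (Sym2 (Fin n)) :=
  F.erase a ∪ {b, c}

end EdgeCut

namespace RAM

namespace LoopProgram

open EdgeCut

variable {n : ℕ}

open RAM.Expr in
/-- Tests whether registers `10` and `11` hold the ends of the edge with ends in registers `p`
and `q`. -/
def sameEdge (p q : ℕ) : Expr :=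
  add (.and (eq (reg 10) (reg p)) (eq (reg 11) (reg q)))
    (.and (eq (reg 10) (reg q)) (eq (reg 11) (reg p)))

open RAM.Expr in
/-- Tests whether registers `10` and `11` hold the ends of an edge of the set obtained from the one
in table `2` by removing the edge with ends in registers `12`, `13`, and adding those with ends in
registers `14`, `15` and `16`, `17`. -/
def inCandidate : Expr :=
  add (.and (tab 2 (reg 10) (reg 11)) (eq (sameEdge 12 13) (const 0)))
    (add (sameEdge 14 15) (sameEdge 16 17))

open RAM.Expr in
/-- Put into table `3` the edge set obtained from the one in table `2` by removing the edge with
ends in registers `12`, `13`, and adding those with ends in registers `14`, `15` and `16`, `17`.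
Put into table `4` the adjacency matrix of the graph in table `0` without these edges. -/
def buildCandidate : LoopProgram :=
  .forLoop 10 (.forLoop 11 (
    .ite inCandidate
      (.setTab 3 (reg 10) (reg 11) (const 1)) (.setTab 3 (reg 10) (reg 11) (const 0)) ;;
    .setTab 4 (reg 10) (reg 11) (sub (tab 0 (reg 10) (reg 11)) (tab 3 (reg 10) (reg 11)))))

/-- Build a candidate and test it. -/
def testCandidate : LoopProgram := buildCandidate ;; testConnectivity

open RAM.Expr in
/-- Copy table `3` to table `2`. -/
def acceptCandidate : LoopProgram :=
  .forLoop 10 (.forLoop 11 (.setTab 2 (reg 10) (reg 11) (tab 3 (reg 10) (reg 11))))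

open RAM.Expr in
/-- Copy table `2` to table `0`. -/
def outputSet : LoopProgram :=
  .forLoop 10 (.forLoop 11 (.setTab 0 (reg 10) (reg 11) (tab 2 (reg 10) (reg 11))))

open RAM.Expr in
/-- Tests whether registers `p` and `q` hold the ends, in order, of an edge of the graph in table
`0` that is not in table `1`. -/
def isFreeEdge (p q : ℕ) : Expr :=
  .and (lt (reg p) (reg q)) (.and (tab 0 (reg p) (reg q)) (eq (tab 1 (reg p) (reg q)) (const 0)))

open RAM.Expr in
/-- Tests whether the edges with ends in registers `14`, `15` and `16`, `17` are the same. -/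
def sameFreeEdge : Expr := .and (eq (reg 14) (reg 16)) (eq (reg 15) (reg 17))

open RAM.Expr in
/-- One step of the local search: try to remove an edge and add two, or to add an edge.  Register
`20` holds the number of edges in table `2`. -/
def improve : LoopProgram :=
  .ite (.and (lt (reg 20) (reg 2)) (.and (.and (isFreeEdge 14 15) (isFreeEdge 16 17))
      (.and (.and (eq (tab 2 (reg 14) (reg 15)) (const 0)) (eq (tab 2 (reg 16) (reg 17)) (const 0)))
        (eq (add sameFreeEdge (tab 2 (reg 12) (reg 13))) (const 1)))))
    (testCandidate ;; .ite (reg 3) (acceptCandidate ;; .setReg 20 (add (reg 20) (const 1))) .skip)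
    .skip

/-- Try all steps of the local search. -/
def searchRound : LoopProgram := forLoops [12, 13, 14, 15, 16, 17] improve

/-- The local search. -/
def localSearch : LoopProgram := .forLoop 18 (.forLoop 19 searchRound)

/-- The input `(G, lam, k, R)` is in the memory. -/
structure HasInput (lam k : ℕ) (E : Finset (Sym2 (Fin n))) (R : Set (Sym2 (Fin n)))
    (m : Memory) : Prop where
  reg_zero : m.reg 0 = n
  reg_one : m.reg 1 = lam
  reg_two : m.reg 2 = k
  graph : IsMatrixOf (m.tab 0) (E : Set (Sym2 (Fin n)))
  forbidden : IsMatrixOf (m.tab 1) R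

theorem HasInput.setReg {lam k : ℕ} {E : Finset (Sym2 (Fin n))} {R : Set (Sym2 (Fin n))}
    {m : Memory} (h : HasInput lam k E R m) {r : ℕ} (hr : 2 < r) (x : ℕ) :
    HasInput lam k E R (m.setReg r x) := by
  refine ⟨?_, ?_, ?_, h.graph, h.forbidden⟩
  · rw [Memory.setReg_reg, if_neg (by omega), h.reg_zero]
  · rw [Memory.setReg_reg, if_neg (by omega), h.reg_one]
  · rw [Memory.setReg_reg, if_neg (by omega), h.reg_two]

theorem HasInput.exec {lam k : ℕ} {E : Finset (Sym2 (Fin n))} {R : Set (Sym2 (Fin n))}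
    {s m : Memory} {P : LoopProgram} (h : HasInput lam k E R s) (hm : P.exec s = m)
    (hP : (P.writesReg 0 || P.writesReg 1 || P.writesReg 2 || P.writesTab 0 || P.writesTab 1) =
      false) : HasInput lam k E R m := by
  simp only [Bool.or_eq_false_iff] at hP
  obtain ⟨⟨⟨⟨h0, h1⟩, h2⟩, t0⟩, t1⟩ := hP
  subst hm
  exact ⟨by rw [exec_reg h0, h.reg_zero], by rw [exec_reg h1, h.reg_one],
    by rw [exec_reg h2, h.reg_two], by rw [exec_tab t0]; exact h.graph,
    by rw [exec_tab t1]; exact h.forbidden⟩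

theorem sameEdge_ne_zero {m : Memory} {p q : ℕ} {x y u v : Fin n} (hx : m.reg 10 = x)
    (hy : m.reg 11 = y) (hu : m.reg p = u) (hv : m.reg q = v) :
    (sameEdge p q).eval m ≠ 0 ↔ s(x, y) = s(u, v) := by
  simp only [sameEdge, Expr.eval_add_ne_zero, Expr.eval_and_ne_zero, Expr.eval_eq_ne_zero,
    Expr.eval_reg, hx, hy, hu, hv, Fin.val_inj, Sym2.eq_iff]

theorem isFreeEdge_ne_zero {lam k : ℕ} {E : Finset (Sym2 (Fin n))} {R : Set (Sym2 (Fin n))}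
    {m : Memory} (h : HasInput lam k E R m) {p q : ℕ} {u v : Fin n} (hu : m.reg p = u)
    (hv : m.reg q = v) :
    (isFreeEdge p q).eval m ≠ 0 ↔ u < v ∧ s(u, v) ∈ E ∧ s(u, v) ∉ R := by
  simp only [isFreeEdge, Expr.eval_and_ne_zero, Expr.eval_eq_ne_zero, Expr.eval_lt_ne_zero,
    Expr.eval_tab, Expr.eval_reg, Expr.eval_const, hu, hv, Fin.val_fin_lt]
  rw [h.graph.ne_zero_iff, Finset.mem_coe, ← not_ne_iff, h.forbidden.ne_zero_iff]

theorem acceptCandidate_spec {s m : Memory} (hm : acceptCandidate.exec s = m) :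
    ∀ x < s.reg 0, ∀ y < s.reg 0, m.tab 2 x y = s.tab 3 x y := by
  have key := exec_forLoop_forLoop (by decide) (by decide) (by decide) (by decide) hm
    (fun i j m => m.tab 3 = s.tab 3 ∧ ∀ x y, x < i ∨ x = i ∧ y < j → y < s.reg 0 →
      m.tab 2 x y = s.tab 3 x y) (fun i j m x h => h) (fun i j m x h => h) (by simp) ?_ ?_
  · intro x hx y hy
    exact key.2 x y (Or.inl hx) hy
  · rintro i j m hi hj h10 h11 - ⟨h3, hI⟩
    rw [exec_setTab]
    refine ⟨by ext; simp [h3], fun x y hxy hy => ?_⟩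
    by_cases hc : x = i ∧ y = j
    · simp [hc, h10, h11, h3]
    · simp only [Memory.setTab_tab, Expr.eval_reg, h10, h11, hc, and_false, if_false]
      exact hI x y (by omega) hy
  · rintro i m hi ⟨h3, hI⟩
    exact ⟨h3, fun x y hxy hy => hI x y (by omega) hy⟩

theorem outputSet_spec {s m : Memory} (hm : outputSet.exec s = m) :
    ∀ x < s.reg 0, ∀ y < s.reg 0, m.tab 0 x y = s.tab 2 x y := by
  have key := exec_forLoop_forLoop (by decide) (by decide) (by decide) (by decide) hm
    (fun i j m => m.tab 2 = s.tab 2 ∧ ∀ x y, x < i ∨ x = i ∧ y < j → y < s.reg 0 →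
      m.tab 0 x y = s.tab 2 x y) (fun i j m x h => h) (fun i j m x h => h) (by simp) ?_ ?_
  · intro x hx y hy
    exact key.2 x y (Or.inl hx) hy
  · rintro i j m hi hj h10 h11 - ⟨h3, hI⟩
    rw [exec_setTab]
    refine ⟨by ext; simp [h3], fun x y hxy hy => ?_⟩
    by_cases hc : x = i ∧ y = j
    · simp [hc, h10, h11, h3]
    · simp only [Memory.setTab_tab, Expr.eval_reg, h10, h11, hc, and_false, if_false]
      exact hI x y (by omega) hy
  · rintro i m hi ⟨h3, hI⟩
    exact ⟨h3, fun x y hxy hy => hI x y (by omega) hy⟩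

theorem inCandidate_ne_zero {m : Memory} {F : Finset (Sym2 (Fin n))}
    (hF : IsMatrixOf (m.tab 2) (F : Set (Sym2 (Fin n)))) {x y a₁ a₂ b₁ b₂ c₁ c₂ : Fin n}
    (hx : m.reg 10 = x) (hy : m.reg 11 = y)
    (ha₁ : m.reg 12 = a₁) (ha₂ : m.reg 13 = a₂) (hb₁ : m.reg 14 = b₁) (hb₂ : m.reg 15 = b₂)
    (hc₁ : m.reg 16 = c₁) (hc₂ : m.reg 17 = c₂) :
    inCandidate.eval m ≠ 0 ↔ s(x, y) ∈ exchange F s(a₁, a₂) s(b₁, b₂) s(c₁, c₂) := by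
  rw [inCandidate, Expr.eval_add_ne_zero, Expr.eval_add_ne_zero, Expr.eval_and_ne_zero,
    Expr.eval_eq_ne_zero, sameEdge_ne_zero hx hy hb₁ hb₂, sameEdge_ne_zero hx hy hc₁ hc₂,
    Expr.eval_const, ← not_ne_iff, sameEdge_ne_zero hx hy ha₁ ha₂, Expr.eval_tab,
    Expr.eval_reg, Expr.eval_reg, hx, hy, hF.ne_zero_iff, exchange]
  simp only [Finset.mem_coe, Finset.mem_union, Finset.mem_erase, Finset.mem_insert,
    Finset.mem_singleton, ne_eq, and_comm]

theorem buildCandidate_spec {s m : Memory} (hm : buildCandidate.exec s = m)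
    {E F : Finset (Sym2 (Fin n))} (h0 : s.reg 0 = n)
    (hE : IsMatrixOf (s.tab 0) (E : Set (Sym2 (Fin n))))
    (hF : IsMatrixOf (s.tab 2) (F : Set (Sym2 (Fin n)))) {a₁ a₂ b₁ b₂ c₁ c₂ : Fin n}
    (ha₁ : s.reg 12 = a₁) (ha₂ : s.reg 13 = a₂) (hb₁ : s.reg 14 = b₁) (hb₂ : s.reg 15 = b₂)
    (hc₁ : s.reg 16 = c₁) (hc₂ : s.reg 17 = c₂) :
    IsMatrixOf (m.tab 3) (exchange F s(a₁, a₂) s(b₁, b₂) s(c₁, c₂) : Set (Sym2 (Fin n))) ∧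
    IsMatrixOf (m.tab 4)
      ((E \ exchange F s(a₁, a₂) s(b₁, b₂) s(c₁, c₂) : Finset _) : Set (Sym2 (Fin n))) := by
  generalize hX : exchange F s(a₁, a₂) s(b₁, b₂) s(c₁, c₂) = X
  have key := exec_forLoop_forLoop (by decide) (by decide) (by decide) (by decide) hm
    (fun i j m => (∀ r, r ≠ 10 → r ≠ 11 → m.reg r = s.reg r) ∧ m.tab 0 = s.tab 0 ∧
      m.tab 2 = s.tab 2 ∧ ∀ x y : Fin n, (x : ℕ) < i ∨ (x : ℕ) = i ∧ (y : ℕ) < j →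
        m.tab 3 x y = (if s(x, y) ∈ X then 1 else 0) ∧
        m.tab 4 x y = if s(x, y) ∈ E \ X then 1 else 0)
    (fun i j m x h => ⟨fun r h1 h2 => by simp [h1, h.1 r h1 h2], h.2⟩)
    (fun i j m x h => ⟨fun r h1 h2 => by simp [h2, h.1 r h1 h2], h.2⟩) (by simp) ?_ ?_
  · constructor
    · intro x y
      rw [(key.2.2.2 x y (Or.inl (by omega))).1]
      exact ⟨fun h => if_pos h, fun h => if_neg h⟩
    · intro x y
      rw [(key.2.2.2 x y (Or.inl (by omega))).2]
      exact ⟨fun h => if_pos h, fun h => if_neg h⟩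
  · rintro i j m hi hj h10 h11 - ⟨hr, t0, t2, hI⟩
    clear hm
    obtain ⟨i, rfl⟩ : ∃ i' : Fin n, i = i' := ⟨⟨i, by omega⟩, rfl⟩
    obtain ⟨j, rfl⟩ : ∃ j' : Fin n, j = j' := ⟨⟨j, by omega⟩, rfl⟩
    have htest := inCandidate_ne_zero (t2 ▸ hF) h10 h11
      ((hr 12 (by decide) (by decide)).trans ha₁) ((hr 13 (by decide) (by decide)).trans ha₂)
      ((hr 14 (by decide) (by decide)).trans hb₁) ((hr 15 (by decide) (by decide)).trans hb₂)
      ((hr 16 (by decide) (by decide)).trans hc₁) ((hr 17 (by decide) (by decide)).trans hc₂)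
    rw [hX] at htest
    -- Truncated subtraction of 0/1 entries is set difference, also where an edge of `X` is not in
    -- `E`.
    have hcell : s.tab 0 i j - (if s(i, j) ∈ X then 1 else 0) =
        if s(i, j) ∈ E \ X then 1 else 0 := by
      have h1 := hE i j
      simp only [Finset.mem_coe] at h1
      by_cases h2 : s(i, j) ∈ E <;> by_cases h3 : s(i, j) ∈ X <;> simp [h1, h2, h3]
    rw [exec_seq]
    generalize hm' : exec (ite inCandidate _ _) m = m'
    have hm'' : m' = m.setTab 3 i j (if s(i, j) ∈ X then 1 else 0) := by
      rw [← hm', exec_ite]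
      by_cases h : s(i, j) ∈ X
      · rw [if_pos (htest.2 h), if_pos h, exec_setTab, Expr.eval_reg, Expr.eval_reg, h10, h11,
          Expr.eval_const]
      · rw [if_neg (fun h' => h (htest.1 h')), if_neg h, exec_setTab, Expr.eval_reg,
          Expr.eval_reg, h10, h11, Expr.eval_const]
    rw [hm'', exec_setTab]
    refine ⟨fun r h1 h2 => by simpa using hr r h1 h2, by ext; simp [t0], by ext; simp [t2], ?_⟩
    intro x y hxy
    simp only [Memory.setTab_tab, Memory.setTab_reg, Expr.eval_reg, Expr.eval_sub, Expr.eval_tab,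
      h10, h11, t0, Fin.val_inj]
    by_cases hc : x = i ∧ y = j
    · obtain ⟨rfl, rfl⟩ := hc
      simpa using hcell
    · have := hI x y (by
        rw [← Fin.val_inj, ← Fin.val_inj] at hc
        omega)
      simpa [hc] using this
  · rintro i m hi ⟨hr, t0, t2, hI⟩
    exact ⟨hr, t0, t2, fun x y hxy => hI x y (by omega)⟩

theorem testCandidate_spec {s m : Memory} (hm : testCandidate.exec s = m) {lam k : ℕ}
    {E F : Finset (Sym2 (Fin n))} {R : Set (Sym2 (Fin n))} (hs : HasInput lam k E R s)
    (hF : IsMatrixOf (s.tab 2) (F : Set (Sym2 (Fin n)))) {a₁ a₂ b₁ b₂ c₁ c₂ : Fin n}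
    (ha₁ : s.reg 12 = a₁) (ha₂ : s.reg 13 = a₂) (hb₁ : s.reg 14 = b₁) (hb₂ : s.reg 15 = b₂)
    (hc₁ : s.reg 16 = c₁) (hc₂ : s.reg 17 = c₂) :
    IsMatrixOf (m.tab 3) (exchange F s(a₁, a₂) s(b₁, b₂) s(c₁, c₂) : Set (Sym2 (Fin n))) ∧
    (m.reg 3 ≠ 0 ↔ CutConnected (E \ exchange F s(a₁, a₂) s(b₁, b₂) s(c₁, c₂)) lam) := by
  rw [testCandidate, exec_seq] at hm
  generalize hm' : buildCandidate.exec s = m' at hm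
  obtain ⟨h3, h4⟩ := buildCandidate_spec hm' hs.reg_zero hs.graph hF ha₁ ha₂ hb₁ hb₂ hc₁ hc₂
  generalize exchange F s(a₁, a₂) s(b₁, b₂) s(c₁, c₂) = X at h3 h4 ⊢
  have hs' := hs.exec hm' (by decide)
  have hsym : ∀ x < m'.reg 0, ∀ y < m'.reg 0, m'.tab 4 x y = m'.tab 4 y x := by
    rw [hs'.reg_zero]
    intro x hx y hy
    have a := h4 ⟨x, hx⟩ ⟨y, hy⟩
    have b := h4 ⟨y, hy⟩ ⟨x, hx⟩
    have hswap : s((⟨y, hy⟩ : Fin n), ⟨x, hx⟩) = s(⟨x, hx⟩, ⟨y, hy⟩) := Sym2.eq_swap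
    rw [hswap] at b
    by_cases h : s(⟨x, hx⟩, ⟨y, hy⟩) ∈ ((E \ X : Finset _) : Set (Sym2 (Fin n)))
    · exact (a.1 h).trans (b.1 h).symm
    · exact (a.2 h).trans (b.2 h).symm
  obtain ⟨hle, hiff⟩ := testConnectivity_spec hm hsym
  rw [hs'.reg_zero, hs'.reg_one, ← cutConnected_iff_connected h4] at hiff
  constructor
  · rw [← hm, exec_tab (by decide)]
    exact h3
  · rw [← hiff]
    omega

end LoopProgram

end RAM

/-! ### The local search -/

namespace EdgeCut

variable {n : ℕ}

/-- Exchanging `a` for `b` and `c` turns `F` into a larger deletion set. -/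
def Improves (E D : Finset (Sym2 (Fin n))) (lam k : ℕ) (F : Finset (Sym2 (Fin n)))
    (a b c : Sym2 (Fin n)) : Prop :=
  F.card < k ∧ b ∈ D \ F ∧ c ∈ D \ F ∧ ((b = c ∧ a ∉ F) ∨ (b ≠ c ∧ a ∈ F)) ∧
    CutConnected (E \ exchange F a b c) lam

theorem Improves.card_exchange {E D F : Finset (Sym2 (Fin n))} {lam k : ℕ} {a b c : Sym2 (Fin n)}
    (h : Improves E D lam k F a b c) : (exchange F a b c).card = F.card + 1 := by
  obtain ⟨-, hb, hc, h | h, -⟩ := h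
  · rw [Finset.mem_sdiff] at hb
    rw [exchange, ← h.1, Finset.erase_eq_of_notMem h.2, Finset.pair_eq_singleton,
      Finset.union_singleton, Finset.card_insert_of_notMem hb.2]
  · rw [Finset.mem_sdiff] at hb hc
    have h1 : c ∉ F.erase a := fun h => hc.2 (Finset.mem_of_mem_erase h)
    have h2 : b ∉ insert c (F.erase a) := by
      rw [Finset.mem_insert, not_or]
      exact ⟨h.1, fun h => hb.2 (Finset.mem_of_mem_erase h)⟩
    have h3 := Finset.card_pos.2 ⟨a, h.2⟩
    rw [exchange, Finset.union_insert, Finset.union_singleton, Finset.card_insert_of_notMem h2,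
      Finset.card_insert_of_notMem h1, Finset.card_erase_of_mem h.2]
    omega

theorem Improves.exchange_subset {E D F : Finset (Sym2 (Fin n))} {lam k : ℕ}
    {a b c : Sym2 (Fin n)} (h : Improves E D lam k F a b c) (hF : F ⊆ D) :
    exchange F a b c ⊆ D := by
  obtain ⟨-, hb, hc, -⟩ := h
  intro e he
  simp only [exchange, Finset.mem_union, Finset.mem_insert, Finset.mem_singleton] at he
  rcases he with he | rfl | rfl
  · exact hF (Finset.mem_of_mem_erase he)
  · exact (Finset.mem_sdiff.1 hb).1
  · exact (Finset.mem_sdiff.1 hc).1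

/-- No exchange improves `F`. -/
def LocallyMaximal (E D : Finset (Sym2 (Fin n))) (lam k : ℕ) (F : Finset (Sym2 (Fin n))) : Prop :=
  ∀ a b c, ¬ Improves E D lam k F a b c

open Classical in
/-- The edges of `E` outside `R`. -/
noncomputable def freeEdges (E : Finset (Sym2 (Fin n))) (R : Set (Sym2 (Fin n))) :
    Finset (Sym2 (Fin n)) := E.filter fun e => e ∉ R

theorem mem_freeEdges {E : Finset (Sym2 (Fin n))} {R : Set (Sym2 (Fin n))} {e : Sym2 (Fin n)} :
    e ∈ freeEdges E R ↔ e ∈ E ∧ e ∉ R := by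
  simp [freeEdges]

end EdgeCut

namespace RAM

namespace LoopProgram

open EdgeCut

variable {n : ℕ}

/-- The memory holds a deletion set `F` with at most `k` edges, and its size. -/
structure HoldsSet (lam k : ℕ) (E : Finset (Sym2 (Fin n))) (R : Set (Sym2 (Fin n)))
    (F : Finset (Sym2 (Fin n))) (m : Memory) : Prop where
  input : HasInput lam k E R m
  matrix : IsMatrixOf (m.tab 2) (F : Set (Sym2 (Fin n)))
  card_eq : m.reg 20 = F.card
  subset : F ⊆ freeEdges E R
  connected : CutConnected (E \ F) lam
  card_le : F.card ≤ k

theorem HoldsSet.setReg {lam k : ℕ} {E : Finset (Sym2 (Fin n))} {R : Set (Sym2 (Fin n))}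
    {F : Finset (Sym2 (Fin n))} {m : Memory} (h : HoldsSet lam k E R F m) {r : ℕ} (hr : 2 < r)
    (hr' : r ≠ 20) (x : ℕ) : HoldsSet lam k E R F (m.setReg r x) :=
  ⟨h.input.setReg hr x, h.matrix, by rw [Memory.setReg_reg, if_neg (Ne.symm hr'), h.card_eq],
    h.subset, h.connected, h.card_le⟩

theorem improve_spec {s m : Memory} (hm : improve.exec s = m) {lam k : ℕ}
    {E F : Finset (Sym2 (Fin n))} {R : Set (Sym2 (Fin n))} (hs : HoldsSet lam k E R F s)
    {a₁ a₂ b₁ b₂ c₁ c₂ : Fin n}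
    (ha₁ : s.reg 12 = a₁) (ha₂ : s.reg 13 = a₂) (hb₁ : s.reg 14 = b₁) (hb₂ : s.reg 15 = b₂)
    (hc₁ : s.reg 16 = c₁) (hc₂ : s.reg 17 = c₂) :
    (HoldsSet lam k E R F m ∧ (b₁ < b₂ → c₁ < c₂ →
      ¬ Improves E (freeEdges E R) lam k F s(a₁, a₂) s(b₁, b₂) s(c₁, c₂))) ∨
    (Improves E (freeEdges E R) lam k F s(a₁, a₂) s(b₁, b₂) s(c₁, c₂) ∧
      HoldsSet lam k E R (exchange F s(a₁, a₂) s(b₁, b₂) s(c₁, c₂)) m) := by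
  have hin := hs.input
  have htest : Expr.eval s (.and (.lt (.reg 20) (.reg 2))
      (.and (.and (isFreeEdge 14 15) (isFreeEdge 16 17))
      (.and (.and (.eq (.tab 2 (.reg 14) (.reg 15)) (.const 0))
        (.eq (.tab 2 (.reg 16) (.reg 17)) (.const 0)))
        (.eq (.add sameFreeEdge (.tab 2 (.reg 12) (.reg 13))) (.const 1))))) ≠ 0 ↔
      F.card < k ∧ ((b₁ < b₂ ∧ s(b₁, b₂) ∈ E ∧ s(b₁, b₂) ∉ R) ∧
        (c₁ < c₂ ∧ s(c₁, c₂) ∈ E ∧ s(c₁, c₂) ∉ R)) ∧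
      (s(b₁, b₂) ∉ F ∧ s(c₁, c₂) ∉ F) ∧
      ((b₁ = c₁ ∧ b₂ = c₂) ∧ s(a₁, a₂) ∉ F ∨ ¬ (b₁ = c₁ ∧ b₂ = c₂) ∧ s(a₁, a₂) ∈ F) := by
    have hsame : sameFreeEdge.eval s ≠ 0 ↔ b₁ = c₁ ∧ b₂ = c₂ := by
      simp only [sameFreeEdge, Expr.eval_and_ne_zero, Expr.eval_eq_ne_zero, Expr.eval_reg, hb₁,
        hb₂, hc₁, hc₂, Fin.val_inj]
    have hsame1 : sameFreeEdge.eval s ≤ 1 := by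
      simp [sameFreeEdge, Expr.and]
    have ha1 := hs.matrix a₁ a₂
    have hnz : ∀ x y, s.tab 2 x y = 0 ↔ ¬ s.tab 2 x y ≠ 0 := fun x y => by simp
    simp only [Expr.eval_and_ne_zero, isFreeEdge_ne_zero hin hb₁ hb₂,
      isFreeEdge_ne_zero hin hc₁ hc₂, Expr.eval_lt_ne_zero, Expr.eval_eq_ne_zero, Expr.eval_tab,
      Expr.eval_reg, Expr.eval_const, Expr.eval_add, hs.card_eq, hin.reg_two, ha₁, ha₂, hb₁, hb₂,
      hc₁, hc₂]
    rw [hnz b₁ b₂, hnz c₁ c₂, hs.matrix.ne_zero_iff, hs.matrix.ne_zero_iff, Finset.mem_coe,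
      Finset.mem_coe, ← hsame]
    simp only [Finset.mem_coe] at ha1
    -- Exactly one of `b = c` and `a ∈ F` holds: a pure addition with a dummy `a` outside `F`, or a
    -- genuine exchange of one edge for two.
    have hone : sameFreeEdge.eval s + s.tab 2 a₁ a₂ = 1 ↔
        (sameFreeEdge.eval s ≠ 0 ∧ s(a₁, a₂) ∉ F ∨ ¬ sameFreeEdge.eval s ≠ 0 ∧ s(a₁, a₂) ∈ F) := by
      by_cases ha : s(a₁, a₂) ∈ F
      · rw [ha1.1 ha]
        simp [ha]
      · rw [ha1.2 ha]
        simp only [ha, not_false_eq_true, and_true, and_false, or_false]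
        omega
    rw [hone]
  rw [improve, exec_ite] at hm
  split_ifs at hm with hc
  · obtain ⟨hk, ⟨⟨hb, hbE, hbR⟩, hcc, hcE, hcR⟩, ⟨hbF, hcF⟩, hsw⟩ := htest.1 hc
    rw [exec_seq] at hm
    generalize hm₁ : testCandidate.exec s = m₁ at hm
    obtain ⟨h3, hiff⟩ := testCandidate_spec hm₁ hin hs.matrix ha₁ ha₂ hb₁ hb₂ hc₁ hc₂
    have hin₁ := hin.exec hm₁ (by decide)
    have h2₁ : m₁.tab 2 = s.tab 2 := by rw [← hm₁, exec_tab (by decide)]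
    have h20₁ : m₁.reg 20 = s.reg 20 := by rw [← hm₁, exec_reg (by decide)]
    rw [exec_ite] at hm
    split_ifs at hm with hr3 <;> rw [Expr.eval_reg] at hr3
    · right
      have hne : (b₁ = c₁ ∧ b₂ = c₂) ↔ s(b₁, b₂) = s(c₁, c₂) := by
        constructor
        · rintro ⟨rfl, rfl⟩
          rfl
        · intro h
          rcases Sym2.eq_iff.1 h with h | ⟨rfl, rfl⟩
          · exact h
          · exact absurd hb hcc.asymm
      have himp : Improves E (freeEdges E R) lam k F s(a₁, a₂) s(b₁, b₂) s(c₁, c₂) := by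
        refine ⟨hk, ?_, ?_, ?_, hiff.1 hr3⟩
        · rw [Finset.mem_sdiff, mem_freeEdges]
          exact ⟨⟨hbE, hbR⟩, hbF⟩
        · rw [Finset.mem_sdiff, mem_freeEdges]
          exact ⟨⟨hcE, hcR⟩, hcF⟩
        · rwa [hne] at hsw
      refine ⟨himp, ?_⟩
      rw [exec_seq] at hm
      generalize hm₂ : acceptCandidate.exec m₁ = m₂ at hm
      have h2₂ := acceptCandidate_spec hm₂
      rw [hin₁.reg_zero] at h2₂
      have h20₂ : m₂.reg 20 = s.reg 20 := by rw [← hm₂, exec_reg (by decide), h20₁]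
      have hin₂ := hin₁.exec hm₂ (by decide)
      have hin₃ := hin₂.exec hm (by decide)
      rw [exec_setReg] at hm
      subst hm
      refine ⟨hin₃, h3.congr h2₂, ?_, himp.exchange_subset hs.subset, hiff.1 hr3, ?_⟩
      · rw [himp.card_exchange]
        simp [h20₂, hs.card_eq]
      · rw [himp.card_exchange]
        exact hk
    · left
      rw [exec_skip] at hm
      subst hm
      refine ⟨⟨hin₁, by rw [h2₁]; exact hs.matrix, by rw [h20₁, hs.card_eq], hs.subset,
        hs.connected, hs.card_le⟩, fun _ _ himp => hr3 (hiff.2 himp.2.2.2.2)⟩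
  · left
    rw [exec_skip] at hm
    subst hm
    refine ⟨hs, fun hb hcc himp => hc (htest.2 ?_)⟩
    obtain ⟨hk, hbD, hcD, hsw, -⟩ := himp
    rw [Finset.mem_sdiff, mem_freeEdges] at hbD hcD
    refine ⟨hk, ⟨⟨hb, hbD.1⟩, hcc, hcD.1⟩, ⟨hbD.2, hcD.2⟩, ?_⟩
    rcases hsw with ⟨h1, h2⟩ | ⟨h1, h2⟩
    · refine Or.inl ⟨?_, h2⟩
      rcases Sym2.eq_iff.1 h1 with h | ⟨rfl, rfl⟩
      · exact h
      · exact absurd hb hcc.asymm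
    · refine Or.inr ⟨?_, h2⟩
      rintro ⟨rfl, rfl⟩
      exact h1 rfl

theorem exists_lt_of_not_isDiag {e : Sym2 (Fin n)} (h : ¬ e.IsDiag) :
    ∃ x y : Fin n, x < y ∧ e = s(x, y) := by
  induction e with
  | _ x y =>
    rw [Sym2.mk_isDiag_iff] at h
    rcases lt_or_gt_of_ne h with h | h
    · exact ⟨x, y, h, rfl⟩
    · exact ⟨y, x, h, Sym2.eq_swap⟩

theorem searchRound_spec {s m : Memory} (hm : searchRound.exec s = m) {lam k : ℕ}
    {E F₀ : Finset (Sym2 (Fin n))} {R : Set (Sym2 (Fin n))} (hs : HoldsSet lam k E R F₀ s)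
    (hE : ∀ e ∈ E, ¬ e.IsDiag) :
    ∃ F, HoldsSet lam k E R F m ∧
      (F = F₀ ∧ LocallyMaximal E (freeEdges E R) lam k F₀ ∨
        ¬ LocallyMaximal E (freeEdges E R) lam k F₀ ∧ F₀.card < F.card) := by
  have hn := hs.input.reg_zero
  -- The persistent property is conditional on table `2` still holding `F₀`. Once a move succeeds
  -- the set is larger than `F₀` for good and the property becomes vacuous; if none does, all moves
  -- from `F₀` have been refuted.
  have key := exec_forLoops (by decide) (by decide) (by decide) hm
    (fun m => ∃ F, HoldsSet lam k E R F m ∧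
      (F = F₀ ∨ ¬ LocallyMaximal E (freeEdges E R) lam k F₀ ∧ F₀.card < F.card))
    (fun τ m => IsMatrixOf (m.tab 2) (F₀ : Set (Sym2 (Fin n))) →
      ∀ a₁ a₂ b₁ b₂ c₁ c₂ : Fin n, τ = [↑a₁, ↑a₂, ↑b₁, ↑b₂, ↑c₁, ↑c₂] → b₁ < b₂ → c₁ < c₂ →
        ¬ Improves E (freeEdges E R) lam k F₀ s(a₁, a₂) s(b₁, b₂) s(c₁, c₂))
    ?_ (fun r _ τ m x h => h) ⟨F₀, hs, Or.inl rfl⟩ ?_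
  · obtain ⟨⟨F, hF, hF'⟩, hQ⟩ := key
    refine ⟨F, hF, ?_⟩
    rcases hF' with rfl | hF'
    · refine Or.inl ⟨rfl, fun a b c himp => ?_⟩
      have hbd := hE b (mem_freeEdges.1 (Finset.mem_sdiff.1 himp.2.1).1).1
      have hcd := hE c (mem_freeEdges.1 (Finset.mem_sdiff.1 himp.2.2.1).1).1
      obtain ⟨b₁, b₂, hb, rfl⟩ := exists_lt_of_not_isDiag hbd
      obtain ⟨c₁, c₂, hc, rfl⟩ := exists_lt_of_not_isDiag hcd
      induction a with
      | _ a₁ a₂ =>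
        refine hQ [↑a₁, ↑a₂, ↑b₁, ↑b₂, ↑c₁, ↑c₂] rfl ?_ hF.matrix a₁ a₂ b₁ b₂ c₁ c₂ rfl hb hc himp
        simp [hn]
    · exact Or.inr hF'
  · rintro r hr m x ⟨F, hF, hF'⟩
    refine ⟨F, hF.setReg ?_ ?_ x, hF'⟩ <;> fin_cases hr <;> decide
  · rintro m - hreg ⟨F, hF, hF'⟩
    rw [hn] at hreg
    have h12 := hreg 12 (by decide)
    have h13 := hreg 13 (by decide)
    have h14 := hreg 14 (by decide)
    have h15 := hreg 15 (by decide)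
    have h16 := hreg 16 (by decide)
    have h17 := hreg 17 (by decide)
    generalize hm' : improve.exec m = m'
    have hspec := improve_spec hm' hF (a₁ := ⟨_, h12⟩) (a₂ := ⟨_, h13⟩) (b₁ := ⟨_, h14⟩)
      (b₂ := ⟨_, h15⟩) (c₁ := ⟨_, h16⟩) (c₂ := ⟨_, h17⟩) rfl rfl rfl rfl rfl rfl
    rcases hspec with ⟨hF₁, hno⟩ | ⟨himp, hF₁⟩
    · refine ⟨⟨F, hF₁, hF'⟩, ?_, ?_⟩
      · intro hmat a₁ a₂ b₁ b₂ c₁ c₂ hτ hb hc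
        have hFF := hF₁.matrix.unique hmat
        simp only [List.map_cons, List.map_nil, List.cons.injEq, and_true] at hτ
        obtain ⟨e1, e2, e3, e4, e5, e6⟩ := hτ
        rw [← hFF]
        simp only [e1, e2, e3, e4, e5, e6, Fin.eta] at hno
        exact hno hb hc
      · intro τ hτ hmat
        refine hτ ?_
        rw [← hF₁.matrix.unique hmat]
        exact hF.matrix
    · have hcard := himp.card_exchange
      have hlt : F₀.card < (exchange F s(⟨m.reg 12, h12⟩, ⟨m.reg 13, h13⟩)
          s(⟨m.reg 14, h14⟩, ⟨m.reg 15, h15⟩) s(⟨m.reg 16, h16⟩, ⟨m.reg 17, h17⟩)).card := by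
        rcases hF' with rfl | ⟨-, hF'⟩ <;> omega
      have hne : ¬ IsMatrixOf (m'.tab 2) (F₀ : Set (Sym2 (Fin n))) := by
        intro hmat
        rw [hF₁.matrix.unique hmat] at hlt
        omega
      refine ⟨⟨_, hF₁, Or.inr ⟨?_, hlt⟩⟩, fun h => absurd h hne, fun _ _ h => absurd h hne⟩
      rcases hF' with rfl | ⟨hF', -⟩
      · exact fun h => h _ _ _ himp
      · exact hF'

theorem localSearch_spec {s m : Memory} (hm : localSearch.exec s = m) {lam k : ℕ}
    {E F₀ : Finset (Sym2 (Fin n))} {R : Set (Sym2 (Fin n))} (hs : HoldsSet lam k E R F₀ s)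
    (hE : ∀ e ∈ E, ¬ e.IsDiag) :
    ∃ F, HoldsSet lam k E R F m ∧
      (n * n ≤ F.card ∨ LocallyMaximal E (freeEdges E R) lam k F) := by
  have hn := hs.input.reg_zero
  -- Each round adds at least one edge or finds a local maximum, which later rounds do not change.
  have key := exec_forLoop_forLoop (by decide) (by decide) (by decide) (by decide) hm
    (fun i j m => ∃ F, HoldsSet lam k E R F m ∧
      (i * n + j ≤ F.card ∨ LocallyMaximal E (freeEdges E R) lam k F))
    (fun i j m x ⟨F, h, h'⟩ => ⟨F, h.setReg (by decide) (by decide) x, h'⟩)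
    (fun i j m x ⟨F, h, h'⟩ => ⟨F, h.setReg (by decide) (by decide) x, h'⟩)
    ⟨F₀, hs, Or.inl (by simp)⟩ ?_ ?_
  · rw [hn] at key
    exact key
  · rintro i j m - - - - - ⟨F, hF, hF'⟩
    obtain ⟨F₁, h1, ⟨rfl, h2⟩ | ⟨h2, h3⟩⟩ := searchRound_spec (m := searchRound.exec m) rfl hF hE
    · exact ⟨F₁, h1, Or.inr h2⟩
    · refine ⟨F₁, h1, Or.inl ?_⟩
      rcases hF' with hF' | hF'
      · omega
      · exact absurd hF' h2
  · rintro i m - ⟨F, hF, hF'⟩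
    rw [hn] at hF'
    refine ⟨F, hF, ?_⟩
    rw [add_mul, one_mul, add_zero]
    exact hF'

end LoopProgram

end RAM

/-! ### The search for an irrelevant edge -/

namespace RAM

namespace LoopProgram

open EdgeCut

variable {n : ℕ}

open RAM.Expr in
/-- Record the edge with ends in registers `14`, `15` as irrelevant. -/
def recordEdge : LoopProgram :=
  .setReg 24 (reg 14) ;; .setReg 25 (reg 15) ;; .setReg 26 (const 1)

open RAM.Expr in
/-- Look for edges that are not deletable. -/
def scanDeletable : LoopProgram :=
  forLoops [14, 15] (.setReg 16 (reg 14) ;; .setReg 17 (reg 15) ;;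
    .ite (isFreeEdge 14 15)
      (testCandidate ;; .ite (eq (reg 3) (const 0)) recordEdge .skip) .skip)

open RAM.Expr in
/-- Put into register `23` the number of edges that cannot be deleted together with the edge with
ends in registers `14`, `15`. -/
def countConflicts : LoopProgram :=
  .setReg 23 (const 0) ;;
  .forLoop 16 (.forLoop 17 (.ite (isFreeEdge 16 17)
    (testCandidate ;; .ite (eq (reg 3) (const 0)) (.setReg 23 (add (reg 23) (const 1))) .skip)
    .skip))

open RAM.Expr in
/-- Look for edges with more conflicts than register `21` allows. -/
def scanConflicts : LoopProgram :=
  forLoops [14, 15] (.ite (isFreeEdge 14 15)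
    (countConflicts ;; .ite (lt (reg 21) (reg 23)) recordEdge .skip) .skip)

open RAM.Expr in
/-- Put into register `21` the allowed number of conflicts. -/
def computeThreshold : LoopProgram :=
  .forLoop 18 (.forLoop 19 (.ite (lt (reg 22) (sub (reg 2) (const 1)))
    (.setReg 21 (add (reg 21) (add (reg 1) (reg 1))) ;; .setReg 22 (add (reg 22) (const 1)))
    .skip))

open RAM.Expr in
/-- Look for an irrelevant edge. -/
def findIrrelevant : LoopProgram :=
  computeThreshold ;; scanDeletable ;; .ite (eq (reg 26) (const 0)) scanConflicts .skip

/-- The memory holds the input and the empty edge set. -/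
structure HoldsEmpty (lam k : ℕ) (E : Finset (Sym2 (Fin n))) (R : Set (Sym2 (Fin n)))
    (m : Memory) : Prop where
  input : HasInput lam k E R m
  matrix : IsMatrixOf (m.tab 2) ((∅ : Finset (Sym2 (Fin n))) : Set (Sym2 (Fin n)))
  reg_left : m.reg 12 = 0
  reg_right : m.reg 13 = 0

variable {lam k : ℕ} {E : Finset (Sym2 (Fin n))} {R : Set (Sym2 (Fin n))} {s m : Memory}

theorem HoldsEmpty.setReg (h : HoldsEmpty lam k E R m) {r : ℕ} (hr : 13 < r) (x : ℕ) :
    HoldsEmpty lam k E R (m.setReg r x) := by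
  refine ⟨h.input.setReg (by omega) x, h.matrix, ?_, ?_⟩
  · rw [Memory.setReg_reg, if_neg (by omega), h.reg_left]
  · rw [Memory.setReg_reg, if_neg (by omega), h.reg_right]

theorem HoldsEmpty.exec {P : LoopProgram} (h : HoldsEmpty lam k E R s) (hm : P.exec s = m)
    (hP : (P.writesReg 0 || P.writesReg 1 || P.writesReg 2 || P.writesTab 0 || P.writesTab 1) =
      false) (hP' : (P.writesTab 2 || P.writesReg 12 || P.writesReg 13) = false) :
    HoldsEmpty lam k E R m := by
  simp only [Bool.or_eq_false_iff] at hP'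
  obtain ⟨⟨t2, h12⟩, h13⟩ := hP'
  refine ⟨h.input.exec hm hP, ?_, ?_, ?_⟩ <;> subst hm
  · rw [exec_tab t2]
    exact h.matrix
  · rw [exec_reg h12, h.reg_left]
  · rw [exec_reg h13, h.reg_right]

theorem HoldsEmpty.testCandidate_spec (h : HoldsEmpty lam k E R s)
    (hm : testCandidate.exec s = m) {b₁ b₂ c₁ c₂ : Fin n}
    (hb₁ : s.reg 14 = b₁) (hb₂ : s.reg 15 = b₂) (hc₁ : s.reg 16 = c₁) (hc₂ : s.reg 17 = c₂) :
    m.reg 3 = 0 ↔ ¬ CutConnected (E \ {s(b₁, b₂), s(c₁, c₂)}) lam := by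
  have hn : 0 < n := b₁.pos
  -- Registers `12` and `13` name the loop at vertex `0`, whose removal from the empty set has no
  -- effect; the candidate is just the pair of edges.
  have := (LoopProgram.testCandidate_spec hm h.input h.matrix (a₁ := ⟨0, hn⟩) (a₂ := ⟨0, hn⟩)
    h.reg_left h.reg_right hb₁ hb₂ hc₁ hc₂).2
  rw [exchange, Finset.erase_empty, Finset.empty_union] at this
  rw [← this, not_not]

/-- If an edge is recorded, then it has property `p`. -/
def Records (n : ℕ) (p : Sym2 (Fin n) → Prop) (m : Memory) : Prop :=
  m.reg 26 ≠ 0 → ∃ u v : Fin n, m.reg 24 = u ∧ m.reg 25 = v ∧ p s(u, v)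

theorem Records.setReg {p : Sym2 (Fin n) → Prop} (h : Records n p m) {r : ℕ}
    (hr : r < 24) (x : ℕ) : Records n p (m.setReg r x) := by
  rw [Records, Memory.setReg_reg, Memory.setReg_reg, Memory.setReg_reg, if_neg (by omega),
    if_neg (by omega), if_neg (by omega)]
  exact h

theorem Records.exec {p : Sym2 (Fin n) → Prop} {P : LoopProgram} (h : Records n p s)
    (hm : P.exec s = m) (hP : (P.writesReg 24 || P.writesReg 25 || P.writesReg 26) = false) :
    Records n p m := by
  simp only [Bool.or_eq_false_iff] at hP
  subst hm
  rw [Records, exec_reg hP.1.1, exec_reg hP.1.2, exec_reg hP.2]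
  exact h

theorem recordEdge_spec (hm : recordEdge.exec s = m) :
    m.reg 24 = s.reg 14 ∧ m.reg 25 = s.reg 15 ∧ m.reg 26 = 1 := by
  simp [← hm, recordEdge, exec_seq, exec_setReg]

theorem scanDeletable_spec (hm : scanDeletable.exec s = m) (hs : HoldsEmpty lam k E R s)
    (h26 : s.reg 26 = 0) (hE : ∀ e ∈ E, ¬ e.IsDiag) :
    Records n (fun e => e ∈ freeEdges E R ∧ ¬ CutConnected (E \ {e}) lam) m ∧
      (m.reg 26 = 0 → ∀ e ∈ freeEdges E R, CutConnected (E \ {e}) lam) := by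
  have hn := hs.input.reg_zero
  have key := exec_forLoops (by decide) (by decide) (by decide) hm
    (fun m => HoldsEmpty lam k E R m ∧
      Records n (fun e => e ∈ freeEdges E R ∧ ¬ CutConnected (E \ {e}) lam) m)
    (fun τ m => m.reg 26 = 0 → ∀ u v : Fin n, τ = [↑u, ↑v] → u < v → s(u, v) ∈ freeEdges E R →
        CutConnected (E \ {s(u, v)}) lam)
    ?_ ?_ ⟨hs, fun h => absurd h26 h⟩ ?_
  · obtain ⟨⟨-, hrec⟩, hQ⟩ := key
    refine ⟨hrec, fun h e he => ?_⟩
    obtain ⟨u, v, huv, rfl⟩ := exists_lt_of_not_isDiag (hE e (mem_freeEdges.1 he).1)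
    exact hQ [↑u, ↑v] rfl (by simp [hn]) h u v rfl huv he
  · rintro r hr m x ⟨h, h'⟩
    refine ⟨h.setReg ?_ x, h'.setReg ?_ x⟩ <;> fin_cases hr <;> decide
  · rintro r hr τ m x h
    rw [Memory.setReg_reg, if_neg]
    · exact h
    · fin_cases hr <;> decide
  · rintro m - hreg ⟨h, h'⟩
    rw [hn] at hreg
    obtain ⟨u, hu⟩ : ∃ u : Fin n, m.reg 14 = u := ⟨⟨_, hreg 14 (by decide)⟩, rfl⟩
    obtain ⟨v, hv⟩ : ∃ v : Fin n, m.reg 15 = v := ⟨⟨_, hreg 15 (by decide)⟩, rfl⟩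
    rw [exec_seq, exec_seq, exec_setReg, exec_setReg]
    set m₁ := (m.setReg 16 ((Expr.reg 14).eval m)).setReg 17
      ((Expr.reg 15).eval (m.setReg 16 ((Expr.reg 14).eval m))) with hm₁
    have e₁ : HoldsEmpty lam k E R m₁ := (h.setReg (by decide) _).setReg (by decide) _
    have r₁ := (h'.setReg (r := 16) (by decide) ((Expr.reg 14).eval m)).setReg (r := 17) (by decide)
      ((Expr.reg 15).eval (m.setReg 16 ((Expr.reg 14).eval m)))
    rw [← hm₁] at r₁
    have h14 : m₁.reg 14 = u := by simp [hm₁, hu]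
    have h15 : m₁.reg 15 = v := by simp [hm₁, hv]
    have h16 : m₁.reg 16 = u := by simp [hm₁, hu]
    have h17 : m₁.reg 17 = v := by simp [hm₁, hv]
    have h26 : m₁.reg 26 = m.reg 26 := by simp [hm₁]
    have hτ : [14, 15].map m.reg = [(u : ℕ), (v : ℕ)] := by simp [hu, hv]
    have hinj : ∀ u' v' : Fin n, [(u : ℕ), (v : ℕ)] = [(u' : ℕ), (v' : ℕ)] → u' = u ∧ v' = v := by
      intro u' v' h
      simp only [List.cons.injEq, and_true, Fin.val_inj] at h
      exact ⟨h.1.symm, h.2.symm⟩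
    rw [hτ]
    clear_value m₁
    rw [exec_ite]
    split_ifs with hfree
    · rw [isFreeEdge_ne_zero e₁.input h14 h15, ← mem_freeEdges] at hfree
      rw [exec_seq]
      generalize hm₂ : testCandidate.exec m₁ = m₂
      have htest := e₁.testCandidate_spec hm₂ h14 h15 h16 h17
      rw [Finset.pair_eq_singleton] at htest
      have e₂ := e₁.exec hm₂ (by decide) (by decide)
      have r₂ := r₁.exec hm₂ (by decide)
      have h14' : m₂.reg 14 = u := by rw [← hm₂, exec_reg (by decide), h14]
      have h15' : m₂.reg 15 = v := by rw [← hm₂, exec_reg (by decide), h15]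
      have h26' : m₂.reg 26 = m.reg 26 := by rw [← hm₂, exec_reg (by decide), h26]
      rw [exec_ite]
      split_ifs with hr3 <;> rw [Expr.eval_eq_ne_zero, Expr.eval_reg, Expr.eval_const] at hr3
      · generalize hm₃ : recordEdge.exec m₂ = m₃
        obtain ⟨a, b, c⟩ := recordEdge_spec hm₃
        refine ⟨⟨e₂.exec hm₃ (by decide) (by decide), fun _ => ⟨u, v, a.trans h14', b.trans h15',
          hfree.2, htest.1 hr3⟩⟩, ?_, ?_⟩
        · rw [c]
          simp
        · intro τ _
          rw [c]
          simp
      · rw [exec_skip]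
        refine ⟨⟨e₂, r₂⟩, fun _ u' v' h _ _ => ?_, fun τ hQ => by rwa [h26']⟩
        obtain ⟨rfl, rfl⟩ := hinj u' v' h
        by_contra hcon
        exact hr3 (htest.2 hcon)
    · rw [exec_skip]
      refine ⟨⟨e₁, r₁⟩, fun _ u' v' h huv hmem => ?_, fun τ hQ => by rwa [h26]⟩
      obtain ⟨rfl, rfl⟩ := hinj u' v' h
      refine absurd ?_ hfree
      rw [isFreeEdge_ne_zero e₁.input h14 h15, ← mem_freeEdges]
      exact ⟨huv, hmem⟩

/-- Each edge is counted once, by its ends in increasing order. -/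
theorem card_eq_sum_range {C : Finset (Sym2 (Fin n))} (hC : ∀ e ∈ C, ¬ e.IsDiag)
    {g : ℕ → ℕ → ℕ} (hg : ∀ u v : Fin n, g u v = if u < v ∧ s(u, v) ∈ C then 1 else 0) :
    ∑ x ∈ Finset.range n, ∑ y ∈ Finset.range n, g x y = C.card := by
  have h1 : ∑ x ∈ Finset.range n, ∑ y ∈ Finset.range n, g x y =
      ((Finset.univ : Finset (Fin n × Fin n)).filter
        fun p => p.1 < p.2 ∧ s(p.1, p.2) ∈ C).card := by
    rw [Finset.sum_range, Finset.card_filter, ← Finset.univ_product_univ, Finset.sum_product]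
    refine Finset.sum_congr rfl fun i _ => ?_
    rw [Finset.sum_range]
    exact Finset.sum_congr rfl fun j _ => hg i j
  rw [h1]
  refine Finset.card_nbij (fun p => s(p.1, p.2)) ?_ ?_ ?_
  · rintro ⟨x, y⟩ hp
    exact (Finset.mem_filter.1 hp).2.2
  · rintro ⟨x, y⟩ hp ⟨x', y'⟩ hp' h
    obtain ⟨-, hp, -⟩ := Finset.mem_filter.1 hp
    obtain ⟨-, hp', -⟩ := Finset.mem_filter.1 hp'
    rcases Sym2.eq_iff.1 h with ⟨rfl, rfl⟩ | ⟨rfl, rfl⟩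
    · rfl
    · exact absurd hp hp'.asymm
  · intro e he
    obtain ⟨x, y, hxy, rfl⟩ := exists_lt_of_not_isDiag (hC e he)
    exact ⟨(x, y), by simpa [hxy] using he, rfl⟩

open Classical in
/-- The free edges that cannot be deleted together with `e`. -/
noncomputable def conflicts (E : Finset (Sym2 (Fin n))) (R : Set (Sym2 (Fin n))) (lam : ℕ)
    (e : Sym2 (Fin n)) : Finset (Sym2 (Fin n)) :=
  (freeEdges E R).filter fun f => ¬ CutConnected (E \ {e, f}) lam

theorem mem_conflicts {e f : Sym2 (Fin n)} :
    f ∈ conflicts E R lam e ↔ f ∈ freeEdges E R ∧ ¬ CutConnected (E \ {e, f}) lam := by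
  simp [conflicts]

theorem countConflicts_spec (hm : countConflicts.exec s = m) (hs : HoldsEmpty lam k E R s)
    (hE : ∀ e ∈ E, ¬ e.IsDiag) {u v : Fin n} (hu : s.reg 14 = u) (hv : s.reg 15 = v) :
    m.reg 23 = (conflicts E R lam s(u, v)).card := by
  classical
  set C := conflicts E R lam s(u, v) with hC
  rw [countConflicts, exec_seq, exec_setReg, Expr.eval_const] at hm
  set s₁ := s.setReg 23 0 with hs₁
  have hn : s₁.reg 0 = n := by simp [hs₁, hs.input.reg_zero]
  -- The indicator of the conflicting edges, extended to all natural numbers because the loop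
  -- counters are not elements of `Fin n`.
  set g : ℕ → ℕ → ℕ := fun x y =>
    if ∃ c d : Fin n, (c : ℕ) = x ∧ (d : ℕ) = y ∧ c < d ∧ s(c, d) ∈ C then 1 else 0 with hg
  have hg' : ∀ c d : Fin n, g c d = if c < d ∧ s(c, d) ∈ C then 1 else 0 := by
    intro c d
    refine if_congr ⟨?_, fun h => ⟨c, d, rfl, rfl, h⟩⟩ rfl rfl
    rintro ⟨c', d', h1, h2, h⟩
    rw [Fin.val_inj] at h1 h2
    rwa [h1, h2] at h
  have key := exec_forLoop_forLoop (by decide) (by decide) (by decide) (by decide) hm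
    (fun i j m => (HoldsEmpty lam k E R m ∧ m.reg 14 = u ∧ m.reg 15 = v) ∧
      m.reg 23 = ∑ x ∈ Finset.range i, ∑ y ∈ Finset.range n, g x y + ∑ y ∈ Finset.range j, g i y)
    (fun i j m x h => ⟨⟨h.1.1.setReg (by decide) x, by simpa using h.1.2⟩, by simpa using h.2⟩)
    (fun i j m x h => ⟨⟨h.1.1.setReg (by decide) x, by simpa using h.1.2⟩, by simpa using h.2⟩)
    ⟨⟨hs.setReg (by decide) 0, by simp [hs₁, hu, hv]⟩, by simp [hs₁]⟩ ?_ ?_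
  · rw [key.2, hn, Finset.sum_range_zero, add_zero]
    refine card_eq_sum_range (fun e he => ?_) hg'
    exact hE e (mem_freeEdges.1 (mem_conflicts.1 he).1).1
  · rintro i j m hi hj h16 h17 - ⟨⟨he, h14, h15⟩, h23⟩
    obtain ⟨c, rfl⟩ : ∃ c : Fin n, i = c := ⟨⟨i, by omega⟩, rfl⟩
    obtain ⟨d, rfl⟩ : ∃ d : Fin n, j = d := ⟨⟨j, by omega⟩, rfl⟩
    rw [Finset.sum_range_succ, ← add_assoc, ← h23, hg', exec_ite]
    have hmem : s(c, d) ∈ C ↔ (s(c, d) ∈ E ∧ s(c, d) ∉ R) ∧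
        ¬ CutConnected (E \ {s(u, v), s(c, d)}) lam := by
      rw [hC, mem_conflicts, mem_freeEdges]
    split_ifs with hfree h1 h1
    · rw [exec_seq]
      generalize hm₁ : testCandidate.exec m = m₁
      have htest := he.testCandidate_spec hm₁ h14 h15 h16 h17
      have e₁ := he.exec hm₁ (by decide) (by decide)
      have r14 : m₁.reg 14 = u := by rw [← hm₁, exec_reg (by decide), h14]
      have r15 : m₁.reg 15 = v := by rw [← hm₁, exec_reg (by decide), h15]
      have r23 : m₁.reg 23 = m.reg 23 := by rw [← hm₁, exec_reg (by decide)]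
      rw [exec_ite, if_pos (by
        rw [Expr.eval_eq_ne_zero]
        exact htest.2 (hmem.1 h1.2).2), exec_setReg]
      exact ⟨⟨e₁.setReg (by decide) _, by simp [r14, r15]⟩, by simp [r23]⟩
    · rw [exec_seq]
      generalize hm₁ : testCandidate.exec m = m₁
      have htest := he.testCandidate_spec hm₁ h14 h15 h16 h17
      have e₁ := he.exec hm₁ (by decide) (by decide)
      have r14 : m₁.reg 14 = u := by rw [← hm₁, exec_reg (by decide), h14]
      have r15 : m₁.reg 15 = v := by rw [← hm₁, exec_reg (by decide), h15]
      have r23 : m₁.reg 23 = m.reg 23 := by rw [← hm₁, exec_reg (by decide)]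
      rw [isFreeEdge_ne_zero he.input h16 h17] at hfree
      rw [exec_ite, if_neg (by
        rw [Expr.eval_eq_ne_zero]
        exact fun h => h1 ⟨hfree.1, hmem.2 ⟨hfree.2, htest.1 h⟩⟩), exec_skip]
      exact ⟨⟨e₁, r14, r15⟩, by rw [r23, add_zero]⟩
    · rw [isFreeEdge_ne_zero he.input h16 h17] at hfree
      exact absurd ⟨h1.1, (hmem.1 h1.2).1⟩ hfree
    · exact ⟨⟨he, h14, h15⟩, by rw [exec_skip, add_zero]⟩
  · rintro i m - h
    rw [hn] at h
    rw [Finset.sum_range_succ, Finset.sum_range_zero, add_zero]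
    exact h

theorem scanConflicts_spec (hm : scanConflicts.exec s = m) (hs : HoldsEmpty lam k E R s)
    (h26 : s.reg 26 = 0) (hE : ∀ e ∈ E, ¬ e.IsDiag) :
    Records n (fun e => e ∈ freeEdges E R ∧ s.reg 21 < (conflicts E R lam e).card) m ∧
      (m.reg 26 = 0 → ∀ e ∈ freeEdges E R, (conflicts E R lam e).card ≤ s.reg 21) := by
  have hn := hs.input.reg_zero
  generalize hthr : s.reg 21 = thr
  have key := exec_forLoops (by decide) (by decide) (by decide) hm
    (fun m => (HoldsEmpty lam k E R m ∧ m.reg 21 = thr) ∧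
      Records n (fun e => e ∈ freeEdges E R ∧ thr < (conflicts E R lam e).card) m)
    (fun τ m => m.reg 26 = 0 → ∀ u v : Fin n, τ = [↑u, ↑v] → u < v → s(u, v) ∈ freeEdges E R →
        (conflicts E R lam s(u, v)).card ≤ thr)
    ?_ ?_ ⟨⟨hs, hthr⟩, fun h => absurd h26 h⟩ ?_
  · obtain ⟨⟨-, hrec⟩, hQ⟩ := key
    refine ⟨hrec, fun h e he => ?_⟩
    obtain ⟨u, v, huv, rfl⟩ := exists_lt_of_not_isDiag (hE e (mem_freeEdges.1 he).1)
    exact hQ [↑u, ↑v] rfl (by simp [hn]) h u v rfl huv he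
  · rintro r hr m x ⟨⟨h, h21⟩, h'⟩
    refine ⟨⟨h.setReg ?_ x, ?_⟩, h'.setReg ?_ x⟩
    · fin_cases hr <;> decide
    · rw [Memory.setReg_reg, if_neg, h21]
      fin_cases hr <;> decide
    · fin_cases hr <;> decide
  · rintro r hr τ m x h
    rw [Memory.setReg_reg, if_neg]
    · exact h
    · fin_cases hr <;> decide
  · rintro m - hreg ⟨⟨h, h21⟩, h'⟩
    rw [hn] at hreg
    obtain ⟨u, hu⟩ : ∃ u : Fin n, m.reg 14 = u := ⟨⟨_, hreg 14 (by decide)⟩, rfl⟩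
    obtain ⟨v, hv⟩ : ∃ v : Fin n, m.reg 15 = v := ⟨⟨_, hreg 15 (by decide)⟩, rfl⟩
    have hτ : [14, 15].map m.reg = [(u : ℕ), (v : ℕ)] := by simp [hu, hv]
    have hinj : ∀ u' v' : Fin n, [(u : ℕ), (v : ℕ)] = [(u' : ℕ), (v' : ℕ)] → u' = u ∧ v' = v := by
      intro u' v' h
      simp only [List.cons.injEq, and_true, Fin.val_inj] at h
      exact ⟨h.1.symm, h.2.symm⟩
    rw [hτ, exec_ite]
    split_ifs with hfree
    · rw [isFreeEdge_ne_zero h.input hu hv, ← mem_freeEdges] at hfree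
      rw [exec_seq]
      generalize hm₁ : countConflicts.exec m = m₁
      have hcount := countConflicts_spec hm₁ h hE hu hv
      have e₁ := h.exec hm₁ (by decide) (by decide)
      have r₁ := h'.exec hm₁ (by decide)
      have h14 : m₁.reg 14 = u := by rw [← hm₁, exec_reg (by decide), hu]
      have h15 : m₁.reg 15 = v := by rw [← hm₁, exec_reg (by decide), hv]
      have h21' : m₁.reg 21 = thr := by rw [← hm₁, exec_reg (by decide), h21]
      have h26' : m₁.reg 26 = m.reg 26 := by rw [← hm₁, exec_reg (by decide)]
      rw [exec_ite]
      split_ifs with hlt <;>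
        rw [Expr.eval_lt_ne_zero, Expr.eval_reg, Expr.eval_reg, h21', hcount] at hlt
      · generalize hm₂ : recordEdge.exec m₁ = m₂
        obtain ⟨a, b, c⟩ := recordEdge_spec hm₂
        refine ⟨⟨⟨e₁.exec hm₂ (by decide) (by decide), ?_⟩, fun _ => ⟨u, v, a.trans h14,
          b.trans h15, hfree.2, hlt⟩⟩, ?_, ?_⟩
        · rw [← hm₂, exec_reg (by decide), h21']
        · rw [c]
          simp
        · intro τ _
          rw [c]
          simp
      · rw [exec_skip]
        refine ⟨⟨⟨e₁, h21'⟩, r₁⟩, fun _ u' v' h _ _ => ?_, fun τ hQ => by rwa [h26']⟩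
        obtain ⟨rfl, rfl⟩ := hinj u' v' h
        exact not_lt.1 hlt
    · rw [exec_skip]
      refine ⟨⟨⟨h, h21⟩, h'⟩, fun _ u' v' hτ huv hmem => ?_, fun τ hQ => hQ⟩
      obtain ⟨rfl, rfl⟩ := hinj u' v' hτ
      refine absurd ?_ hfree
      rw [isFreeEdge_ne_zero h.input hu hv, ← mem_freeEdges]
      exact ⟨huv, hmem⟩

/-- Without multiplication the product has to be summed up, and `k` may be exponential in the input
size. Stopping after `n * n` additions is harmless, since no edge has more than `n * n` conflicts.
-/
theorem computeThreshold_spec (hm : computeThreshold.exec s = m) (hs : HasInput lam k E R s)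
    (h21 : s.reg 21 = 0) (h22 : s.reg 22 = 0) : m.reg 21 = 2 * min (k - 1) (n * n) * lam := by
  have hn := hs.reg_zero
  have key := exec_forLoop_forLoop (by decide) (by decide) (by decide) (by decide) hm
    (fun i j m => (m.reg 1 = lam ∧ m.reg 2 = k) ∧ m.reg 22 = min (k - 1) (i * n + j) ∧
      m.reg 21 = 2 * m.reg 22 * lam)
    (fun i j m x h => by simpa using h) (fun i j m x h => by simpa using h)
    ⟨⟨hs.reg_one, hs.reg_two⟩, by simp [h22], by simp [h21, h22]⟩ ?_ ?_
  · rw [hn, add_zero] at key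
    rw [key.2.2, key.2.1]
  · rintro i j m - - - - - ⟨⟨h1, h2⟩, h22, h21⟩
    rw [exec_ite]
    split_ifs with hlt <;>
      simp only [Expr.eval_lt_ne_zero, Expr.eval_reg, Expr.eval_sub, Expr.eval_const, h2] at hlt
    · rw [exec_seq, exec_setReg, exec_setReg]
      refine ⟨by simp [h1, h2], ?_, ?_⟩
      · simp only [Memory.setReg_reg, Expr.eval_add, Expr.eval_reg, Expr.eval_const, if_true]
        simp only [Nat.reduceEqDiff, if_false]
        omega
      · simp only [Memory.setReg_reg, Expr.eval_add, Expr.eval_reg, Expr.eval_const, if_true]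
        simp only [Nat.reduceEqDiff, if_false, h1, h21]
        ring
    · exact ⟨⟨h1, h2⟩, by rw [exec_skip]; omega, h21⟩
  · rintro i m - h
    rw [hn] at h
    rw [add_mul, one_mul, add_zero]
    exact h

theorem findIrrelevant_spec (hm : findIrrelevant.exec s = m) (hs : HoldsEmpty lam k E R s)
    (h21 : s.reg 21 = 0) (h22 : s.reg 22 = 0) (h26 : s.reg 26 = 0) (hE : ∀ e ∈ E, ¬ e.IsDiag) :
    Records n (fun e => e ∈ freeEdges E R ∧ (¬ CutConnected (E \ {e}) lam ∨
      (∀ f ∈ freeEdges E R, CutConnected (E \ {f}) lam) ∧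
        2 * min (k - 1) (n * n) * lam < (conflicts E R lam e).card)) m ∧
    (m.reg 26 = 0 → ∀ e ∈ freeEdges E R, CutConnected (E \ {e}) lam ∧
      (conflicts E R lam e).card ≤ 2 * min (k - 1) (n * n) * lam) := by
  rw [findIrrelevant, exec_seq, exec_seq] at hm
  generalize hm₁ : computeThreshold.exec s = m₁ at hm
  have hthr := computeThreshold_spec hm₁ hs.input h21 h22
  have e₁ := hs.exec hm₁ (by decide) (by decide)
  have h26' : m₁.reg 26 = 0 := by rw [← hm₁, exec_reg (by decide), h26]
  generalize hm₂ : scanDeletable.exec m₁ = m₂ at hm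
  obtain ⟨a, b⟩ := scanDeletable_spec hm₂ e₁ h26' hE
  have e₂ := e₁.exec hm₂ (by decide) (by decide)
  have hthr₂ : m₂.reg 21 = m₁.reg 21 := by rw [← hm₂, exec_reg (by decide)]
  rw [exec_ite] at hm
  split_ifs at hm with h <;> rw [Expr.eval_eq_ne_zero, Expr.eval_reg, Expr.eval_const] at h
  · obtain ⟨c, d⟩ := scanConflicts_spec hm e₂ h hE
    rw [hthr₂, hthr] at c d
    refine ⟨fun hne => ?_, fun h0 e he => ⟨b h e he, d h0 e he⟩⟩
    obtain ⟨u, v, hu, hv, huv, hlt⟩ := c hne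
    exact ⟨u, v, hu, hv, huv, Or.inr ⟨b h, hlt⟩⟩
  · rw [exec_skip] at hm
    subst hm
    refine ⟨fun hne => ?_, fun h0 => absurd h0 h⟩
    obtain ⟨u, v, hu, hv, huv, hlt⟩ := a hne
    exact ⟨u, v, hu, hv, huv, Or.inl hlt⟩

end LoopProgram

end RAM

/-! ### Correctness of the answers -/

namespace EdgeCut

variable {n lam k : ℕ} {G : SimpleGraph (Fin n)} {R : Set (Sym2 (Fin n))}
  {E : Finset (Sym2 (Fin n))}

open EdgeDeletion RAM.LoopProgram

theorem isEdgeConnected_deleteEdges_iff (hE : ∀ e, e ∈ E ↔ e ∈ G.edgeSet)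
    (F : Finset (Sym2 (Fin n))) :
    (G.deleteEdges (F : Set (Sym2 (Fin n)))).IsEdgeConnected lam ↔ CutConnected (E \ F) lam :=
  isEdgeConnected_iff fun e => by
    rw [Finset.mem_sdiff, hE, SimpleGraph.edgeSet_deleteEdges, Set.mem_sdiff, Finset.mem_coe]

theorem isDeletionSet_iff (hE : ∀ e, e ∈ E ↔ e ∈ G.edgeSet) {F : Finset (Sym2 (Fin n))} :
    IsDeletionSet G lam k R F ↔
      F ⊆ freeEdges E R ∧ F.card = k ∧ CutConnected (E \ F) lam := by
  rw [IsDeletionSet, isEdgeConnected_deleteEdges_iff hE]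
  refine and_congr_left fun _ => forall_congr' fun e => ?_
  rw [mem_freeEdges, hE, Finset.mem_coe, Set.mem_sdiff]

theorem card_sym2_le (n : ℕ) : Fintype.card (Sym2 (Fin n)) ≤ n * n := by
  have := Fintype.card_le_of_surjective (fun p : Fin n × Fin n => s(p.1, p.2)) fun e => by
    induction e with
    | _ x y => exact ⟨(x, y), rfl⟩
  simpa using this

/-- A non-deletable edge lies in no deletion set, because `CutConnected` is monotone in the edge
set; an edge with too many conflicts can be avoided by `exists_deletionSet_avoiding`. -/
theorem correct_irrelevantEdge (hlam : Odd lam) (hE : ∀ e, e ∈ E ↔ e ∈ G.edgeSet)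
    {e : Sym2 (Fin n)} (he : e ∈ freeEdges E R)
    (h : ¬ CutConnected (E \ {e}) lam ∨ (∀ f ∈ freeEdges E R, CutConnected (E \ {f}) lam) ∧
      2 * min (k - 1) (n * n) * lam < (conflicts E R lam e).card) :
    (Answer.irrelevantEdge e).Correct G lam k R := by
  have hsub : freeEdges E R ⊆ E := fun f hf => (mem_freeEdges.1 hf).1
  have he' := mem_freeEdges.1 he
  refine ⟨⟨(hE e).1 he'.1, he'.2⟩, ?_, ?_⟩
  · rintro ⟨F, hF⟩
    obtain ⟨hFD, hFk, hFc⟩ := (isDeletionSet_iff hE).1 hF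
    have key : ∃ F' ⊆ freeEdges E R, F'.card = k ∧ e ∉ F' ∧ CutConnected (E \ F') lam := by
      rcases h with h | ⟨hdel, hcard⟩
      · refine ⟨F, hFD, hFk, fun heF => h (hFc.mono ?_), hFc⟩
        exact Finset.sdiff_subset_sdiff le_rfl (Finset.singleton_subset_iff.2 heF)
      · refine exists_deletionSet_avoiding hlam hsub hdel he (N := conflicts E R lam e)
          (fun g hg => mem_conflicts.1 hg) ?_ hFD hFk hFc
        -- If the threshold was capped at `n * n`, it exceeds the number of all pairs and the case
        -- is void.
        rcases le_total (k - 1) (n * n) with hle | hle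
        · rwa [min_eq_left hle] at hcard
        · rw [min_eq_right hle] at hcard
          have h1 : (conflicts E R lam e).card ≤ n * n :=
            (Finset.card_le_univ _).trans (card_sym2_le n)
          have h2 : 1 ≤ lam := hlam.pos
          nlinarith [Nat.mul_le_mul_left (2 * (n * n)) h2]
    obtain ⟨F', hD, hk, heF', hc⟩ := key
    refine ⟨F', (isDeletionSet_iff hE).2 ⟨fun f hf => ?_, hk, hc⟩⟩
    have hf' := mem_freeEdges.1 (hD hf)
    refine mem_freeEdges.2 ⟨hf'.1, ?_⟩
    rintro (h | rfl)
    exacts [hf'.2 h, heF' hf]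
  · rintro ⟨F, hF, hF'⟩
    exact ⟨F, hF.trans (Set.sdiff_subset_sdiff_right Set.subset_union_left), hF'⟩

theorem correct_fewDeletable (hlam : Odd lam) (hE : ∀ e, e ∈ E ↔ e ∈ G.edgeSet)
    {F : Finset (Sym2 (Fin n))} (hFD : F ⊆ freeEdges E R) (hFk : F.card < k)
    (hF : CutConnected (E \ F) lam)
    (hmax : n * n ≤ F.card ∨ LocallyMaximal E (freeEdges E R) lam k F)
    (h : ∀ e ∈ freeEdges E R, CutConnected (E \ {e}) lam ∧
      (conflicts E R lam e).card ≤ 2 * min (k - 1) (n * n) * lam) :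
    (Answer.fewDeletable : Answer n).Correct G lam k R := by
  have hsub : freeEdges E R ⊆ E := fun f hf => (mem_freeEdges.1 hf).1
  have hdiag : ∀ e ∈ E, ¬ e.IsDiag := fun e he => G.not_isDiag_of_mem_edgeSet ((hE e).1 he)
  have hdel : deletable G lam \ R ⊆ (freeEdges E R : Set (Sym2 (Fin n))) := fun e he =>
    mem_freeEdges.2 ⟨(hE e).2 he.1.1, he.2⟩
  have hcard := Set.ncard_le_ncard hdel (Finset.finite_toSet _)
  rw [Set.ncard_coe_finset] at hcard
  refine hcard.trans ?_
  rcases Nat.eq_zero_or_pos n with rfl | hn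
  · rw [Finset.card_eq_zero.2 (Finset.eq_empty_of_isEmpty _)]
    exact Nat.zero_le _
  -- A loop is never an edge of `G`. It is the dummy removed in pure additions, and it shows that
  -- `F` has fewer than `n * n` elements, so the local search did end at a local maximum.
  let d : Sym2 (Fin n) := s(⟨0, hn⟩, ⟨0, hn⟩)
  have hd : d ∉ F := fun hd => hdiag _ (hsub (hFD hd)) (by simp [d])
  have hmax' : LocallyMaximal E (freeEdges E R) lam k F := by
    refine hmax.resolve_left fun hle => ?_
    have h1 : F.card < Fintype.card (Sym2 (Fin n)) := Finset.card_lt_univ_of_notMem hd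
    have h2 := card_sym2_le n
    omega
  refine card_le_of_locally_maximal hlam hsub (fun f hf => (h f hf).1) hFD hF hFk ?_ ?_ ?_
  · intro f hf hc
    refine hmax' d f f ⟨hFk, hf, hf, Or.inl ⟨rfl, hd⟩, ?_⟩
    rwa [exchange, Finset.erase_eq_of_notMem hd, Finset.pair_eq_singleton]
  · intro e he f hf g hg hne hc
    exact hmax' e f g ⟨hFk, hf, hg, Or.inr ⟨hne, he⟩, hc⟩
  · intro f hf N hN
    refine (Finset.card_le_card fun g hg => mem_conflicts.2 (hN g hg)).trans ((h f hf).2.trans ?_)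
    gcongr
    exact min_le_left _ _

end EdgeCut

/-! ### The algorithm -/

namespace RAM

namespace LoopProgram

open RAM.Expr in
/-- The algorithm; it puts the kind of the answer into register `27`. -/
def deletionAlgorithm : LoopProgram :=
  findIrrelevant ;; localSearch ;;
  .ite (eq (reg 20) (reg 2)) (.setReg 27 (const 1) ;; outputSet)
    (.ite (reg 26) (.setReg 27 (const 2) ;; .setReg 1 (reg 24) ;; .setReg 2 (reg 25))
      (.setReg 27 (const 3)))

open EdgeCut EdgeDeletion

theorem holdsEmpty_input {n lam k : ℕ} {G : SimpleGraph (Fin n)} {R : Set (Sym2 (Fin n))}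
    {E : Finset (Sym2 (Fin n))} (hE : ∀ e, e ∈ E ↔ e ∈ G.edgeSet) :
    HoldsEmpty lam k E R (input G lam k R) := by
  refine ⟨⟨rfl, rfl, rfl, fun i j => ?_, fun i j => ?_⟩, fun i j => ?_, rfl, rfl⟩
  · simp [input, hE]
  · simp [input]
  · simp [input]

theorem deletionAlgorithm_spec {n lam k : ℕ} {G : SimpleGraph (Fin n)} {R : Set (Sym2 (Fin n))}
    (hlam : Odd lam) (hG : G.IsEdgeConnected lam) {m : Memory}
    (hm : deletionAlgorithm.exec (input G lam k R) = m) :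
    ∃ a : Answer n, Shows (m.setReg 0 (m.reg 27)) a ∧ a.Correct G lam k R := by
  classical
  obtain ⟨E, hE⟩ : ∃ E : Finset (Sym2 (Fin n)), ∀ e, e ∈ E ↔ e ∈ G.edgeSet :=
    ⟨G.edgeFinset, fun e => SimpleGraph.mem_edgeFinset⟩
  have hdiag : ∀ e ∈ E, ¬ e.IsDiag := fun e he => G.not_isDiag_of_mem_edgeSet ((hE e).1 he)
  have e₀ : HoldsEmpty lam k E R (input G lam k R) := holdsEmpty_input hE
  rw [deletionAlgorithm, exec_seq, exec_seq] at hm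
  generalize hm₁ : findIrrelevant.exec (input G lam k R) = m₁ at hm
  have e₁ := e₀.exec hm₁ (by decide) (by decide)
  have h20 : m₁.reg 20 = 0 := by rw [← hm₁, exec_reg (by decide)]; rfl
  obtain ⟨hrec, hnone⟩ := findIrrelevant_spec hm₁ e₀ rfl rfl rfl hdiag
  generalize hm₂ : localSearch.exec m₁ = m₂ at hm
  have hS : HoldsSet lam k E R ∅ m₁ := ⟨e₁.input, e₁.matrix, by simp [h20], by simp,
    by rw [Finset.sdiff_empty]; exact (isEdgeConnected_iff hE).1 hG, by simp⟩
  obtain ⟨F, hF, hmax⟩ := localSearch_spec hm₂ hS hdiag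
  have r₂ := hrec.exec hm₂ (by decide)
  have h26 : m₂.reg 26 = m₁.reg 26 := by rw [← hm₂, exec_reg (by decide)]
  rw [exec_ite] at hm
  split_ifs at hm with hk <;>
    rw [Expr.eval_eq_ne_zero, Expr.eval_reg, Expr.eval_reg, hF.card_eq, hF.input.reg_two] at hk
  · rw [exec_seq, exec_setReg] at hm
    have hout := outputSet_spec hm
    have h27 : m.reg 27 = 1 := by
      rw [← hm, exec_reg (by decide)]
      simp
    refine ⟨.deletionSet F, ⟨by simp [h27], fun u v => ?_⟩,
      (isDeletionSet_iff hE).2 ⟨hF.subset, hk, hF.connected⟩⟩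
    have hn : (m₂.setReg 27 ((Expr.const 1).eval m₂)).reg 0 = n := by
      simp [hF.input.reg_zero]
    rw [hn] at hout
    rw [Memory.setReg_tab, hout u u.2 v v.2, Memory.setReg_tab]
    split_ifs with h
    exacts [(hF.matrix u v).1 h, (hF.matrix u v).2 h]
  · have hlt := lt_of_le_of_ne hF.card_le hk
    rw [exec_ite] at hm
    split_ifs at hm with hr <;> rw [Expr.eval_reg] at hr
    · obtain ⟨u, v, hu, hv, hmem, hirr⟩ := r₂ hr
      refine ⟨.irrelevantEdge s(u, v), ⟨?_, u, v, ?_, ?_, rfl⟩,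
        correct_irrelevantEdge hlam hE hmem hirr⟩ <;>
        simp [← hm, exec_seq, exec_setReg, hu, hv]
    · refine ⟨.fewDeletable, ?_, correct_fewDeletable hlam hE hF.subset hlt hF.connected hmax
        (hnone (by rw [← h26]; exact not_not.1 hr))⟩
      simp [← hm, exec_setReg, Shows]

end LoopProgram

end RAM

theorem mainTheorem4 :
    ∃ (P : RAM.Program) (p : Polynomial ℕ),
      ∀ (n lam k : ℕ) (G : SimpleGraph (Fin n)) (R : Set (Sym2 (Fin n))),
        Odd lam → G.IsEdgeConnected lam → R ⊆ G.edgeSet →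
          ∃ (s : RAM.Memory) (t : ℕ) (a : EdgeDeletion.Answer n),
            RAM.Run P (EdgeDeletion.input G lam k R) s t ∧
            t ≤ p.eval (EdgeDeletion.inputSize n lam k) ∧
            EdgeDeletion.Shows s a ∧
            a.Correct G lam k R := by
  -- Register `0` bounds all loops, so the kind of the answer is moved there only at the very end,
  -- by an assignment that costs 2 steps.
  refine ⟨.seq RAM.LoopProgram.deletionAlgorithm.compile (.setReg 0 (.reg 27)),
    RAM.LoopProgram.deletionAlgorithm.time + Polynomial.C 2, fun n lam k G R hlam hG _ => ?_⟩
  obtain ⟨t, ht, hrun⟩ := RAM.LoopProgram.run_compile (P := RAM.LoopProgram.deletionAlgorithm)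
    (by decide) (by decide) (EdgeDeletion.input G lam k R)
  obtain ⟨a, hshow, hcorrect⟩ := RAM.LoopProgram.deletionAlgorithm_spec hlam hG rfl
  refine ⟨_, _, a, hrun.seq (RAM.Run.setReg _ _ _), ?_, hshow, hcorrect⟩
  have h1 : (EdgeDeletion.input G lam k R).reg 0 ≤ EdgeDeletion.inputSize n lam k := by
    change n ≤ n + lam.size + k.size
    omega
  have h2 := RAM.LoopProgram.deletionAlgorithm.eval_time_mono h1
  rw [Polynomial.eval_add, Polynomial.eval_C]
  change t + 2 ≤ _
  omega
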